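/- Let $C$ be a compact connected Riemann surface with canonical bundle $K$, let $\Lambda=\Lambda_0\oplus\Lambda_1$ be the complex Grassmann algebra on $N$ generators, let $L$ be a line bundle over $\mathcal O_C\otimes\Lambda_0$ with transition functions $\sigma_{ij}$, and let $b\in H^0(C,K\otimes\Lambda_0)$. Consider $GL(1|1)$ Higgs bundles $(E,\Phi)$ on $C$, given by holomorphic transition functions $g_{ij}$ with values in $GL(1|1;\Lambda)$ and even matrices of one-forms $\Phi_i$ with $\Phi_j=g_{ij}^{-1}\Phi_i g_{ij}$, together with an identification of the Berezinian bundle $\mathrm{sdet}(E)$ with $L$, and with $\mathrm{str}(\Phi)=b$; isomorphisms are even, and compatible with the Higgs fields and with the identifications $\mathrm{sdet}(E)\cong L$. Put $\mathrm{Pic}_\Lambda(C)=H^1(C,(\mathcal O_C\otimes\Lambda_0)^\times)$. For $\alpha=(\alpha_{ij})$, $\beta=(\beta_{ij})$ representing $[\alpha]\in H^1(C,L^{-1}\otimes\Lambda_1)$, $[\beta]\in H^1(C,L\otimes\Lambda_1)$ with $[b]\cdot[\alpha]=0$ and $[b]\cdot[\beta]=0$, let $\gamma_i,\delta_i$ be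 odd holomorphic one-forms with $$\alpha_{ij}b=\gamma_i-\sigma_{ij}^{-1}\gamma_j,\qquad \beta_{ij}b=\sigma_{ij}\delta_j-\delta_i,\qquad\text{and put}\qquad c_{ij}=\beta_{ij}\gamma_i-\delta_i\alpha_{ij}-\beta_{ij}\alpha_{ij}b .$$ We write $[c]=0$ if $\gamma_i,\delta_i$ can be chosen such that the class of $(c_{ij})$ in $H^1(C,K\otimes\Lambda_0)$ vanishes. **Theorem.** The Higgs bundles above are parametrized by the data $$d=(\mathcal L,\tilde a,[\alpha],[\beta],[\tilde\delta],[\tilde\gamma])\in \mathrm{Pic}_\Lambda(C)\times H^0(C,K\otimes\Lambda_0)\times M\times M^*,$$ $$M=H^1(C,L^{-1}\otimes\Lambda_1)\times H^1(C,L\otimes\Lambda_1),\qquad M^*=H^0(C,L\otimes K\otimes\Lambda_1)\times H^0(C,L^{-1}\otimes K\otimes\Lambda_1),$$ subject to the relations $$[b]\cdot[\alpha]=[b]\cdot[\beta]=0,\qquad [c]=0,\qquad [\tilde\delta]\cdot[\alpha]=[\beta]\cdot[\tilde\gamma]\ \text{ in } H^1(C,K\otimes\Lambda_0),$$ in the following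 sense. 1. One can choose cocycles $k_{ij}$, $\alpha_{ij}$, $\beta_{ij}$ representing all classes $\mathcal L$, $[\alpha]$, $[\beta]$, and functions $f_{ij}$ depending only on $([\alpha],[\beta])$, such that for all $\mathcal L,[\alpha],[\beta]$, after refinement of the cover, $$g_{ij}=k_{ij}f_{ij}\begin{pmatrix}1&0\\ \alpha_{ij}&1\end{pmatrix}\Bigl(1-\tfrac{\alpha_{ij}\beta_{ij}}2\Bigr)\begin{pmatrix}1&\beta_{ij}\\0&1\end{pmatrix}\begin{pmatrix}\sigma_{ij}&0\\0&1\end{pmatrix}$$ are the transition functions of a $GL(1|1)$-bundle $E(\mathcal L,[\alpha],[\beta])$, whose Berezinian is $L$. 2. For any such choice, there are Higgs fields $\Phi(d)$ with supertrace $b$ on $E(\mathcal L,[\alpha],[\beta])$, one for each datum $d$ satisfying the relations, such that for all $\mathcal L,[\alpha],[\beta]$ every Higgs field with supertrace $b$ on $E(\mathcal L,[\alpha],[\beta])$ is $\Phi(d)$ for exactly one datum $d$ with these components $\mathcal L,[\alpha],[\beta]$. For fixed $\mathcal L,[\alpha],[\beta]$ the differences of the $(1,2)$ and of the $(2,1)$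 entries of $\Phi(d')$ and $\Phi(d)$ are $\tilde\delta'-\tilde\delta$ and $\tilde\gamma'-\tilde\gamma$; if moreover $\tilde\delta'=\tilde\delta$ and $\tilde\gamma'=\tilde\gamma$, then the difference of the $(1,1)$ entries is $\tilde a'-\tilde a$. 3. Every $(E,\Phi)$ as above is isomorphic to $(E(\mathcal L,[\alpha],[\beta]),\Phi(d))$ for some datum $d$. 4. Two data $d,d'$ give isomorphic Higgs bundles if and only if $[\alpha']=[\alpha]$, $[\beta']=[\beta]$, and there are $\lambda\in H^0(C,L^{-1}\otimes\Lambda_1)$ and $\rho\in H^0(C,L\otimes\Lambda_1)$ with $\mathcal L'=\mathcal L\cdot\exp([\lambda]\cdot[\beta]-[\alpha]\cdot[\rho])$ and $\Phi(d')_i=n_i\Phi(d)_in_i^{-1}$, where $$n_i=\begin{pmatrix}1-\lambda_i\rho_i/2&\rho_i\\ \lambda_i&1+\lambda_i\rho_i/2\end{pmatrix}.$$ In particular, if $H^0(C,L\otimes\Lambda_1)=H^0(C,L^{-1}\otimes\Lambda_1)=0$, then isomorphism classes of Higgs bundles correspond bijectively to the data. -/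

import Mathlib

open scoped Manifold ContDiff

namespace SuperHiggs

/-! ### The Grassmann algebra -/

/-- The complex Grassmann algebra `Λ` on `N` odd generators. -/
abbrev Grassmann (N : ℕ) : Type := ExteriorAlgebra ℂ (Fin N → ℂ)

/-- The even part `Λ₀` (for `i = 0`) and the odd part `Λ₁` (for `i = 1`) of `Λ`. -/
def parityPart (N : ℕ) (i : ZMod 2) : Submodule ℂ (Grassmann N) :=
  CliffordAlgebra.evenOdd (0 : QuadraticForm ℂ (Fin N → ℂ)) i

theorem one_mem_even (N : ℕ) : (1 : Grassmann N) ∈ parityPart N 0 :=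
  (CliffordAlgebra.one_le_evenOdd_zero _) (Submodule.one_le.1 le_rfl)

theorem mul_mem_even {N : ℕ} {a b : Grassmann N} (ha : a ∈ parityPart N 0)
    (hb : b ∈ parityPart N 0) : a * b ∈ parityPart N 0 := by
  have := (CliffordAlgebra.evenOdd_mul_le (0 : QuadraticForm ℂ (Fin N → ℂ)) 0 0)
    (Submodule.mul_mem_mul ha hb)
  rwa [add_zero] at this

theorem Grassmann.finite (N : ℕ) : Module.Finite ℂ (Grassmann N) := by
  have hz : ∀ i, N < i → (LinearMap.range (ExteriorAlgebra.ι ℂ : (Fin N → ℂ) →ₗ[ℂ] _)) ^ i = ⊥ := by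
    intro i hi
    have h := exteriorPower.finrank_eq (R := ℂ) (M := Fin N → ℂ) i
    rw [Module.finrank_fin_fun, Nat.choose_eq_zero_of_lt hi] at h
    exact Submodule.finrank_eq_zero.1 h
  have hs : (⨆ i : ℕ, (LinearMap.range (ExteriorAlgebra.ι ℂ : (Fin N → ℂ) →ₗ[ℂ] _)) ^ i) = ⊤ :=
    CliffordAlgebra.iSup_ι_range_eq_top (0 : QuadraticForm ℂ (Fin N → ℂ))
  have hf : (⨆ i : Fin (N + 1),
      (LinearMap.range (ExteriorAlgebra.ι ℂ : (Fin N → ℂ) →ₗ[ℂ] _)) ^ (i : ℕ)) = ⊤ := by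
    rw [← top_le_iff, ← hs]
    refine iSup_le fun i => ?_
    by_cases hi : N < i
    · rw [hz i hi]; exact bot_le
    · exact le_iSup (fun i : Fin (N + 1) =>
        (LinearMap.range (ExteriorAlgebra.ι ℂ : (Fin N → ℂ) →ₗ[ℂ] _)) ^ (i : ℕ))
        ⟨i, by omega⟩
  refine ⟨?_⟩
  rw [← hf]
  exact Submodule.fg_iSup _ fun i =>
    Submodule.FG.pow (LinearMap.range_eq_map (ExteriorAlgebra.ι ℂ : (Fin N → ℂ) →ₗ[ℂ] _) ▸
      Submodule.FG.map _ Module.Finite.fg_top) _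

/-- Even elements of the Grassmann algebra are central. -/
theorem Grassmann.comm_of_even {N : ℕ} {a : Grassmann N} (ha : a ∈ parityPart N 0)
    (b : Grassmann N) : a * b = b * a := by
  have key : ∀ x, ∀ m : Fin N → ℂ, x ∈ parityPart N 0 →
      x * ExteriorAlgebra.ι ℂ m = ExteriorAlgebra.ι ℂ m * x := by
    intro x m hx
    induction x, hx using CliffordAlgebra.even_induction with
    | algebraMap r => exact Algebra.commutes _ _
    | add x y hx hy ihx ihy => rw [add_mul, mul_add, ihx, ihy]
    | ι_mul_ι_mul m₁ m₂ x hx ih =>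
      have h1 := eq_neg_of_add_eq_zero_left (ExteriorAlgebra.ι_add_mul_swap (R := ℂ) m₁ m)
      have h2 := eq_neg_of_add_eq_zero_left (ExteriorAlgebra.ι_add_mul_swap (R := ℂ) m₂ m)
      change ExteriorAlgebra.ι ℂ m₁ * ExteriorAlgebra.ι ℂ m₂ * x * ExteriorAlgebra.ι ℂ m =
        ExteriorAlgebra.ι ℂ m * (ExteriorAlgebra.ι ℂ m₁ * ExteriorAlgebra.ι ℂ m₂ * x)
      calc _ = ExteriorAlgebra.ι ℂ m₁ * (ExteriorAlgebra.ι ℂ m₂ * ExteriorAlgebra.ι ℂ m) * x := by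
            rw [mul_assoc, ih]; simp only [mul_assoc]
        _ = -(ExteriorAlgebra.ι ℂ m₁ * ExteriorAlgebra.ι ℂ m) * ExteriorAlgebra.ι ℂ m₂ * x := by
            rw [h2]; simp only [mul_assoc, mul_neg, neg_mul]
        _ = _ := by rw [h1]; simp only [mul_assoc, neg_neg]
  induction b using ExteriorAlgebra.induction with
  | algebraMap r => exact (Algebra.commutes _ _).symm
  | ι m => exact key a m ha
  | mul x y hx hy => rw [← mul_assoc, hx, mul_assoc, hy, mul_assoc]
  | add x y hx hy => rw [mul_add, add_mul, hx, hy]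

/-- Square matrices of size `(1|1)` over `Λ`, indexed by the even (`0`) and the odd (`1`) basis
vector. -/
abbrev Mat (N : ℕ) : Type := Matrix (Fin 2) (Fin 2) (Grassmann N)

/-- A `(1|1)`-supermatrix is even if its diagonal entries are even and its off-diagonal entries are
odd. -/
def IsEvenMat {N : ℕ} (M : Mat N) : Prop :=
  M 0 0 ∈ parityPart N 0 ∧ M 1 1 ∈ parityPart N 0 ∧ M 0 1 ∈ parityPart N 1 ∧ M 1 0 ∈ parityPart N 1

/-- The supergroup `GL(1|1)`: even supermatrices with invertible diagonal entries. -/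
def IsGL11 {N : ℕ} (M : Mat N) : Prop :=
  IsEvenMat M ∧ IsUnit (M 0 0) ∧ IsUnit (M 1 1)

/-- The Berezinian `(a / d) (1 - β γ / (d a))` of `!![a, β; γ, d]`. -/
noncomputable def sdet {N : ℕ} (M : Mat N) : Grassmann N :=
  M 0 0 * Ring.inverse (M 1 1) * (1 - M 0 1 * M 1 0 * Ring.inverse (M 1 1 * M 0 0))

/-- The supertrace of `!![a, β; γ, d]`, that is `a - d`. -/
def str {N : ℕ} (M : Mat N) : Grassmann N := M 0 0 - M 1 1

/-- The Gaussian parametrization of `GL(1|1)`: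
`m • !![1, 0; α, 1] * !![1 - α β / 2, 0; 0, 1 - α β / 2] * !![1, β; 0, 1] * !![σ, 0; 0, 1]`.
The Berezinian of this matrix is `σ`. In exponential coordinates `σ = exp s` and
`m = exp (h - s / 2)`. -/
noncomputable def gauss {N : ℕ} (m σ α β : Grassmann N) : Mat N :=
  !![m * (1 - (1 / 2 : ℂ) • (α * β)) * σ, m * β;
     m * α * σ, m * (1 + (1 / 2 : ℂ) • (α * β))]

/-! ### Holomorphic functions and holomorphic one-forms on a Riemann surface -/

section Holomorphic

variable {C : Type*} [TopologicalSpace C] [ChartedSpace ℂ C]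
variable {V : Type*} [AddCommGroup V] [Module ℂ V]

/-- A function with values in a finite-dimensional complex vector space `V` is holomorphic on `U`:
all its compositions with linear functionals are. -/
def HolFun (U : Set C) (f : C → V) : Prop :=
  ∀ φ : V →ₗ[ℂ] ℂ, MDifferentiableOn 𝓘(ℂ, ℂ) 𝓘(ℂ, ℂ) (fun p => φ (f p)) U

variable (C V) in
/-- `V`-valued (a priori arbitrary) sections of the holomorphic cotangent bundle `K` of `C`. -/
abbrev OneForm : Type _ := (p : C) → TangentSpace 𝓘(ℂ, ℂ) p →ₗ[ℂ] V

/-- A linear functional on the tangent line at `p` as a point of the cotangent bundle. -/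
noncomputable def toCotangent {p : C} (l : TangentSpace 𝓘(ℂ, ℂ) p →ₗ[ℂ] ℂ) :
    TangentSpace 𝓘(ℂ, ℂ) p →L[ℂ] ℂ :=
  ⟨l, LinearMap.continuous_of_finiteDimensional (E := ℂ) (F' := ℂ) (𝕜 := ℂ)
    (show ℂ →ₗ[ℂ] ℂ from l)⟩

/-- A one-form with values in a finite-dimensional complex vector space `V` is holomorphic on `U`:
all its compositions with linear functionals are holomorphic sections of the cotangent bundle. -/
def HolForm [IsManifold 𝓘(ℂ, ℂ) ω C] (U : Set C) (η : OneForm C V) : Prop :=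
  ∀ φ : V →ₗ[ℂ] ℂ,
    MDifferentiableOn 𝓘(ℂ, ℂ) (𝓘(ℂ, ℂ).prod 𝓘(ℂ, ℂ →L[ℂ] ℂ))
      (fun p => Bundle.TotalSpace.mk' (ℂ →L[ℂ] ℂ)
        (E := fun q : C => TangentSpace 𝓘(ℂ, ℂ) q →L[ℂ] ℂ) p (toCotangent (φ ∘ₗ η p))) U

theorem HolFun.mono {U W : Set C} {f : C → V} (h : HolFun U f) (hW : W ⊆ U) : HolFun W f :=
  fun φ => (h φ).mono hW

theorem HolFun.const (U : Set C) (c : V) : HolFun U (fun _ : C => c) :=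
  fun _ => mdifferentiableOn_const

theorem HolFun.add {U : Set C} {f g : C → V} (hf : HolFun U f) (hg : HolFun U g) :
    HolFun U (fun p => f p + g p) := by
  intro φ
  simpa only [map_add] using! (hf φ).add (hg φ)

theorem HolFun.neg {U : Set C} {f : C → V} (hf : HolFun U f) : HolFun U (fun p => -f p) := by
  intro φ
  simpa only [map_neg] using! (hf φ).neg

theorem HolFun.mul {N : ℕ} {U : Set C} {f g : C → Grassmann N} (hf : HolFun U f)
    (hg : HolFun U g) : HolFun U (fun p => f p * g p) := by
  intro φ
  have := Grassmann.finite N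
  let b := Module.finBasis ℂ (Grassmann N)
  have h : ∀ p, φ (f p * g p) =
      ∑ i, b.coord i (f p) * (φ ∘ₗ LinearMap.mulLeft ℂ (b i)) (g p) := by
    intro p
    conv_lhs => rw [← b.sum_repr (f p)]
    rw [Finset.sum_mul, map_sum]
    refine Finset.sum_congr rfl fun i _ => ?_
    rw [smul_mul_assoc, map_smul, smul_eq_mul]
    rfl
  simp only [h]
  intro p hp
  have := fun i => ((hf (b.coord i)).mul (hg (φ ∘ₗ LinearMap.mulLeft ℂ (b i)))) p hp
  have h2 := MDifferentiableWithinAt.sum (t := Finset.univ) fun i _ => this i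
  have e : (fun q => ∑ i, b.coord i (f q) * (φ ∘ₗ LinearMap.mulLeft ℂ (b i)) (g q)) =
      ∑ i, (fun q => b.coord i (f q)) * fun q => (φ ∘ₗ LinearMap.mulLeft ℂ (b i)) (g q) := by
    funext q
    rw [Finset.sum_apply]
    rfl
  rw [e]
  exact h2

end Holomorphic

/-! ### Čech cocycles

Open covers are indexed by the points of `C`, the member with index `x` being an open neighbourhood
of `x`. Every open cover has a refinement of this kind, and for such covers refinement is pointwise
inclusion, so that Čech cohomology is the direct limit over them. Cochains are functions on all of
`C` of which only the values on the relevant intersections matter. -/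

/-- An open neighbourhood of every point. -/
structure Cover (C : Type*) [TopologicalSpace C] where
  /-- the neighbourhood of the given point -/
  set : C → TopologicalSpace.Opens C
  mem : ∀ x, x ∈ set x

namespace Cover

variable {C : Type*} [TopologicalSpace C]

instance : LE (Cover C) := ⟨fun U W => ∀ x, U.set x ≤ W.set x⟩

/-- Common refinement. -/
def inf (U W : Cover C) : Cover C := ⟨fun x => U.set x ⊓ W.set x, fun x => ⟨U.mem x, W.mem x⟩⟩

/-- The overlap of two members of a cover. -/
def inter (U : Cover C) (x y : C) : Set C := {p | p ∈ U.set x ∧ p ∈ U.set y}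

theorem inter_mono {U W : Cover C} (h : U ≤ W) (x y : C) : U.inter x y ⊆ W.inter x y :=
  fun _ hp => ⟨h x hp.1, h y hp.2⟩

theorem inf_le_left (U W : Cover C) : U.inf W ≤ U := fun _ _ hp => hp.1

theorem inf_le_right (U W : Cover C) : U.inf W ≤ W := fun _ _ hp => hp.2

theorem le_trans {U W Y : Cover C} (h : U ≤ W) (h' : W ≤ Y) : U ≤ Y := fun x _ hp => h' x (h x hp)

end Cover

section Cech

variable {C : Type*} [TopologicalSpace C] [ChartedSpace ℂ C]

variable (C) in
/-- A multiplicative Čech 1-cocycle with values in `(𝒪 ⊗ Λ₀)ˣ`, that is, a line bundle `L` (over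
`𝒪 ⊗ Λ₀`) given by transition functions. A section `s` of `L` satisfies
`s x = tr x y * s y` on overlaps. -/
structure LineCocycle (N : ℕ) where
  cov : Cover C
  /-- the transition functions -/
  tr : C → C → C → Grassmann N
  hol : ∀ x y, HolFun (cov.inter x y) (tr x y)
  even : ∀ x y, ∀ p ∈ cov.inter x y, tr x y p ∈ parityPart N 0
  unit : ∀ x y, ∀ p ∈ cov.inter x y, IsUnit (tr x y p)
  cocycle : ∀ x y z p, p ∈ cov.set x → p ∈ cov.set y → p ∈ cov.set z →
    tr x z p = tr x y p * tr y z p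

namespace LineCocycle

variable {N : ℕ}

/-- The trivial line bundle. -/
def trivial (C : Type*) [TopologicalSpace C] [ChartedSpace ℂ C] (N : ℕ) : LineCocycle C N where
  cov := ⟨fun _ => ⊤, fun _ => _root_.trivial⟩
  tr := fun _ _ _ => 1
  hol := fun _ _ => HolFun.const _ _
  even := fun _ _ _ _ => one_mem_even N
  unit := fun _ _ _ _ => isUnit_one
  cocycle := fun _ _ _ _ _ _ _ => (mul_one 1).symm

/-- The inverse line bundle `L⁻¹`: on overlaps `tr y x` is the inverse of `tr x y`. -/
def inv (l : LineCocycle C N) : LineCocycle C N where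
  cov := l.cov
  tr := fun x y => l.tr y x
  hol := fun x y => (l.hol y x).mono fun _ hp => ⟨hp.2, hp.1⟩
  even := fun x y p hp => l.even y x p ⟨hp.2, hp.1⟩
  unit := fun x y p hp => l.unit y x p ⟨hp.2, hp.1⟩
  cocycle := fun x y z p hx hy hz => by
    rw [l.cocycle z y x p hz hy hx, Grassmann.comm_of_even (l.even z y p ⟨hz, hy⟩)]

/-- Two multiplicative cocycles are cohomologous after refinement: they differ by the coboundary of
invertible even holomorphic functions `u x` with inverses `v x`. -/
def Rel (k l : LineCocycle C N) : Prop :=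
  ∃ W : Cover C, W ≤ k.cov ∧ W ≤ l.cov ∧ ∃ u v : C → C → Grassmann N,
    (∀ x, HolFun (W.set x : Set C) (u x)) ∧ (∀ x, HolFun (W.set x : Set C) (v x)) ∧
    (∀ x, ∀ p ∈ W.set x, u x p ∈ parityPart N 0 ∧ v x p ∈ parityPart N 0 ∧ u x p * v x p = 1) ∧
    ∀ x y, ∀ p ∈ W.inter x y, l.tr x y p * u y p = u x p * k.tr x y p

theorem rel_equivalence : Equivalence (Rel (C := C) (N := N)) where
  refl k := ⟨k.cov, fun _ _ h => h, fun _ _ h => h, fun _ _ => 1, fun _ _ => 1,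
    fun _ => HolFun.const _ _, fun _ => HolFun.const _ _,
    fun _ _ _ => ⟨one_mem_even N, one_mem_even N, mul_one 1⟩, fun x y p _ => by simp⟩
  symm := by
    rintro k l ⟨W, h1, h2, u, v, hu, hv, huv, h⟩
    refine ⟨W, h2, h1, v, u, hv, hu, fun x p hp => ⟨(huv x p hp).2.1, (huv x p hp).1, ?_⟩, ?_⟩
    · rw [Grassmann.comm_of_even (huv x p hp).2.1, (huv x p hp).2.2]
    · intro x y p hp
      have hx := huv x p hp.1
      have hy := huv y p hp.2
      have hvx : v x p * u x p = 1 := by rw [Grassmann.comm_of_even hx.2.1, hx.2.2]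
      calc k.tr x y p * v y p = v x p * u x p * k.tr x y p * v y p := by rw [hvx, one_mul]
        _ = v x p * (u x p * k.tr x y p) * v y p := by simp only [mul_assoc]
        _ = v x p * (l.tr x y p * (u y p * v y p)) := by rw [← h x y p hp]; simp only [mul_assoc]
        _ = _ := by rw [hy.2.2, mul_one]
  trans := by
    rintro k l m ⟨W, h1, h2, u, v, hu, hv, huv, h⟩ ⟨W', h1', h2', u', v', hu', hv', huv', h'⟩
    refine ⟨W.inf W', Cover.le_trans (Cover.inf_le_left _ _) h1,
      Cover.le_trans (Cover.inf_le_right _ _) h2', fun x p => u' x p * u x p,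
      fun x p => v x p * v' x p,
      fun x => ((hu' x).mono fun _ hp => hp.2).mul ((hu x).mono fun _ hp => hp.1),
      fun x => ((hv x).mono fun _ hp => hp.1).mul ((hv' x).mono fun _ hp => hp.2), ?_, ?_⟩
    · intro x p hp
      have hx := huv x p hp.1
      have hx' := huv' x p hp.2
      refine ⟨mul_mem_even hx'.1 hx.1, mul_mem_even hx.2.1 hx'.2.1, ?_⟩
      calc u' x p * u x p * (v x p * v' x p) = u' x p * (u x p * v x p) * v' x p := by
            simp only [mul_assoc]
        _ = 1 := by rw [hx.2.2, mul_one, hx'.2.2]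
    · intro x y p hp
      have e := h x y p ⟨hp.1.1, hp.2.1⟩
      have e' := h' x y p ⟨hp.1.2, hp.2.2⟩
      rw [← mul_assoc, e', mul_assoc, e, ← mul_assoc]

instance setoid (C : Type*) [TopologicalSpace C] [ChartedSpace ℂ C] (N : ℕ) :
    Setoid (LineCocycle C N) := ⟨Rel, rel_equivalence⟩

end LineCocycle

/-- `Pic_Λ(C) = H¹(C, (𝒪 ⊗ Λ₀)ˣ)`. -/
def Pic (C : Type*) [TopologicalSpace C] [ChartedSpace ℂ C] (N : ℕ) : Type _ :=
  Quotient (LineCocycle.setoid C N)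

/-- The class in `Pic_Λ(C)` of a multiplicative cocycle. -/
def LineCocycle.cls {N : ℕ} (k : LineCocycle C N) : Pic C N := Quotient.mk _ k

/-- A Čech 1-cocycle with values in `L ⊗ Λ₁`, the value on the overlap of `x` and `y` being written
in the frame of `L` over the neighbourhood of `x`. -/
structure OddCocycle {N : ℕ} (l : LineCocycle C N) where
  cov : Cover C
  le : cov ≤ l.cov
  /-- the components of the cocycle -/
  f : C → C → C → Grassmann N
  hol : ∀ x y, HolFun (cov.inter x y) (f x y)
  odd : ∀ x y, ∀ p ∈ cov.inter x y, f x y p ∈ parityPart N 1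
  cocycle : ∀ x y z p, p ∈ cov.set x → p ∈ cov.set y → p ∈ cov.set z →
    f x z p = f x y p + l.tr x y p * f y z p

namespace OddCocycle

variable {N : ℕ} {l : LineCocycle C N}

/-- Two additive cocycles are cohomologous after refinement. -/
def Rel (a b : OddCocycle l) : Prop :=
  ∃ W : Cover C, W ≤ a.cov ∧ W ≤ b.cov ∧ ∃ u : C → C → Grassmann N,
    (∀ x, HolFun (W.set x : Set C) (u x)) ∧ (∀ x, ∀ p ∈ W.set x, u x p ∈ parityPart N 1) ∧
    ∀ x y, ∀ p ∈ W.inter x y, b.f x y p = a.f x y p + (u x p - l.tr x y p * u y p)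

theorem rel_equivalence : Equivalence (Rel (l := l)) where
  refl a := ⟨a.cov, fun _ _ h => h, fun _ _ h => h, fun _ _ => 0, fun _ => HolFun.const _ _,
    fun _ _ _ => zero_mem _, fun x y p _ => by simp⟩
  symm := by
    rintro a b ⟨W, h1, h2, u, hu, ho, h⟩
    refine ⟨W, h2, h1, fun x p => -u x p, fun x => (hu x).neg,
      fun x p hp => neg_mem (ho x p hp), fun x y p hp => ?_⟩
    rw [h x y p hp]
    simp only [mul_neg]
    abel
  trans := by
    rintro a b c ⟨W, h1, h2, u, hu, ho, h⟩ ⟨W', h1', h2', u', hu', ho', h'⟩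
    refine ⟨W.inf W', Cover.le_trans (Cover.inf_le_left _ _) h1,
      Cover.le_trans (Cover.inf_le_right _ _) h2', fun x p => u x p + u' x p,
      fun x => ((hu x).mono fun _ hp => hp.1).add ((hu' x).mono fun _ hp => hp.2),
      fun x p hp => add_mem (ho x p hp.1) (ho' x p hp.2), fun x y p hp => ?_⟩
    rw [h' x y p ⟨hp.1.2, hp.2.2⟩, h x y p ⟨hp.1.1, hp.2.1⟩]
    simp only [mul_add]
    abel

instance setoid (l : LineCocycle C N) : Setoid (OddCocycle l) := ⟨Rel, rel_equivalence⟩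

end OddCocycle

/-- `H¹(C, L ⊗ Λ₁)`. -/
def H1Odd {N : ℕ} (l : LineCocycle C N) : Type _ := Quotient (OddCocycle.setoid l)

/-- The class in `H¹(C, L ⊗ Λ₁)` of a cocycle. -/
def OddCocycle.cls {N : ℕ} {l : LineCocycle C N} (a : OddCocycle l) : H1Odd l := Quotient.mk _ a

/-- `H⁰(C, L ⊗ Λ₁)`: a section is given by its components in the frames of `L`, each extended by
zero outside the neighbourhood on which the frame lives. -/
structure OddSection {N : ℕ} (l : LineCocycle C N) where
  /-- the components of the section -/
  s : C → C → Grassmann N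
  hol : ∀ x, HolFun (l.cov.set x : Set C) (s x)
  odd : ∀ x, ∀ p ∈ l.cov.set x, s x p ∈ parityPart N 1
  compat : ∀ x y, ∀ p ∈ l.cov.inter x y, s x p = l.tr x y p * s y p
  outside : ∀ x p, p ∉ l.cov.set x → s x p = 0

section Forms

variable [IsManifold 𝓘(ℂ, ℂ) ω C] {N : ℕ}

variable (C N) in
/-- `H⁰(C, K ⊗ Λ₀)`. -/
structure EvenForm where
  /-- the underlying one-form -/
  form : OneForm C (Grassmann N)
  hol : HolForm Set.univ form
  even : ∀ p v, form p v ∈ parityPart N 0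

/-- `H⁰(C, L ⊗ K ⊗ Λ₁)`, with the same conventions as `OddSection`. -/
structure OddFormSection (l : LineCocycle C N) where
  /-- the components of the section -/
  s : C → OneForm C (Grassmann N)
  hol : ∀ x, HolForm (l.cov.set x : Set C) (s x)
  odd : ∀ x, ∀ p ∈ l.cov.set x, ∀ v, s x p v ∈ parityPart N 1
  compat : ∀ x y, ∀ p ∈ l.cov.inter x y, ∀ v, s x p v = l.tr x y p * s y p v
  outside : ∀ x p, p ∉ l.cov.set x → s x p = 0

/-- The class in `H¹(C, L ⊗ K ⊗ Λᵢ)` of the Čech 1-cocycle `f` on the cover `U` vanishes: after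
refinement `f` is the coboundary of a 0-cochain. -/
def ClassZero (l : LineCocycle C N) (i : ZMod 2) (U : Cover C)
    (f : C → C → OneForm C (Grassmann N)) : Prop :=
  ∃ W : Cover C, W ≤ U ∧ W ≤ l.cov ∧ ∃ u : C → OneForm C (Grassmann N),
    (∀ x, HolForm (W.set x : Set C) (u x)) ∧
    (∀ x, ∀ p ∈ W.set x, ∀ v, u x p v ∈ parityPart N i) ∧
    ∀ x y, ∀ p ∈ W.inter x y, ∀ v, f x y p v = u x p v - l.tr x y p * u y p v

/-- `[b] · [A] = 0` in `H¹(C, L ⊗ K ⊗ Λ₁)`, for `b ∈ H⁰(C, K ⊗ Λ₀)` and `A ∈ H¹(C, L ⊗ Λ₁)`. -/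
def CupFormZero {l : LineCocycle C N} (b : EvenForm C N) (A : H1Odd l) : Prop :=
  ∃ α : OddCocycle l, α.cls = A ∧ ClassZero l 1 α.cov fun x y p => α.f x y p • b.form p

/-- `[δ] · [A] = [B] · [γ]` in `H¹(C, K ⊗ Λ₀)`: the difference of the products of representing
cocycles has zero class. -/
def CupEq {l : LineCocycle C N} (δ : OddFormSection l) (A : H1Odd l.inv) (B : H1Odd l)
    (γ : OddFormSection l.inv) : Prop :=
  ∃ (α : OddCocycle l.inv) (β : OddCocycle l), α.cls = A ∧ β.cls = B ∧
    ClassZero (LineCocycle.trivial C N) 0 (α.cov.inf β.cov) fun x y p =>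
      LinearMap.mulRight ℂ (α.f x y p) ∘ₗ δ.s x p - β.f x y p • γ.s x p

/-- The cochain `c x y = β x y * γ x - δ x * α x y - β x y * α x y * b x`. -/
noncomputable def cForm (b : EvenForm C N) (α β : C → C → C → Grassmann N)
    (δ γ : C → OneForm C (Grassmann N)) (x y : C) : OneForm C (Grassmann N) := fun p =>
  β x y p • γ x p - LinearMap.mulRight ℂ (α x y p) ∘ₗ δ x p - (β x y p * α x y p) • b.form p

/-- `[c] = 0` in `H¹(C, K ⊗ Λ₀)`. The class of `c` involves solutions `δ`, `γ` of
`α x y * b = γ x - L⁻¹ γ y` and `β x y * b = L δ y - δ x`, where `α`, `β` are cocycles representing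
`A` and `B`. These solutions are unique only up to global sections of `L ⊗ K` and `L⁻¹ ⊗ K`, which
change the class of `c` by elements `[B] · [γ̃] - [δ̃] · [A]`; that `[c]` vanishes means that it does
so for some choice of the solutions. -/
def CZero {l : LineCocycle C N} (b : EvenForm C N) (A : H1Odd l.inv) (B : H1Odd l) : Prop :=
  ∃ (α : OddCocycle l.inv) (β : OddCocycle l), α.cls = A ∧ β.cls = B ∧
    ∃ U : Cover C, U ≤ α.cov ∧ U ≤ β.cov ∧ ∃ δ γ : C → OneForm C (Grassmann N),
      (∀ x, HolForm (U.set x : Set C) (δ x)) ∧ (∀ x, HolForm (U.set x : Set C) (γ x)) ∧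
      (∀ x, ∀ p ∈ U.set x, ∀ v, δ x p v ∈ parityPart N 1 ∧ γ x p v ∈ parityPart N 1) ∧
      (∀ x y, ∀ p ∈ U.inter x y, ∀ v,
        α.f x y p * b.form p v = γ x p v - l.tr y x p * γ y p v) ∧
      (∀ x y, ∀ p ∈ U.inter x y, ∀ v,
        β.f x y p * b.form p v = l.tr x y p * δ y p v - δ x p v) ∧
      ClassZero (LineCocycle.trivial C N) 0 U (cForm b α.f β.f δ γ)

end Forms

/-! ### `GL(1|1)` Higgs bundles -/

/-- A holomorphic `GL(1|1)`-bundle `E`, given by transition functions `g`, together with an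
isomorphism from its Berezinian bundle `sdet E` to the line bundle `L`. In the local frames the
isomorphism is division by the invertible even functions `t x`. -/
structure FramedBundle {N : ℕ} (l : LineCocycle C N) where
  cov : Cover C
  le : cov ≤ l.cov
  /-- the transition functions -/
  g : C → C → C → Mat N
  hol : ∀ x y, HolFun (cov.inter x y) (g x y)
  gl : ∀ x y, ∀ p ∈ cov.inter x y, IsGL11 (g x y p)
  cocycle : ∀ x y z p, p ∈ cov.set x → p ∈ cov.set y → p ∈ cov.set z →
    g x z p = g x y p * g y z p
  /-- the identification of the Berezinian bundle with `L` -/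
  t : C → C → Grassmann N
  t_hol : ∀ x, HolFun (cov.set x : Set C) (t x)
  t_even : ∀ x, ∀ p ∈ cov.set x, t x p ∈ parityPart N 0
  t_unit : ∀ x, ∀ p ∈ cov.set x, IsUnit (t x p)
  sdet_eq : ∀ x y, ∀ p ∈ cov.inter x y, sdet (g x y p) * t y p = t x p * l.tr x y p

section Higgs

variable [IsManifold 𝓘(ℂ, ℂ) ω C] {N : ℕ}

/-- A Higgs field on `E` with supertrace `b`: an even holomorphic section of `End E ⊗ K`, given by
matrices of one-forms `form x`, with `form y = (g x y)⁻¹ * form x * g x y` on overlaps. Each matrix is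
extended by zero outside the neighbourhood on which the frame lives. -/
structure HiggsField {l : LineCocycle C N} (E : FramedBundle l) (b : EvenForm C N) where
  /-- the matrices of the Higgs field in the local frames -/
  form : C → OneForm C (Mat N)
  hol : ∀ x, HolForm (E.cov.set x : Set C) (form x)
  even : ∀ x, ∀ p ∈ E.cov.set x, ∀ v, IsEvenMat (form x p v)
  compat : ∀ x y, ∀ p ∈ E.cov.inter x y, ∀ v, E.g x y p * form y p v = form x p v * E.g x y p
  str_eq : ∀ x, ∀ p ∈ E.cov.set x, ∀ v, str (form x p v) = b.form p v
  outside : ∀ x p, p ∉ E.cov.set x → form x p = 0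

/-- A `GL(1|1)` Higgs bundle whose Berezinian bundle is identified with `L` and whose Higgs field
has supertrace `b`. -/
structure HiggsBundle (l : LineCocycle C N) (b : EvenForm C N) where
  bundle : FramedBundle l
  higgs : HiggsField bundle b

/-- Isomorphism of Higgs bundles, compatible with the identifications of the Berezinian bundles
with `L`: after refinement there are `r x` in `GL(1|1)` with `g' x y = r x * g x y * (r y)⁻¹`,
`form' x = r x * form x * (r x)⁻¹` and `t' x = sdet (r x) * t x`. -/
def Iso {l : LineCocycle C N} {b : EvenForm C N} (X Y : HiggsBundle l b) : Prop :=
  ∃ W : Cover C, W ≤ X.bundle.cov ∧ W ≤ Y.bundle.cov ∧ ∃ r : C → C → Mat N,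
    (∀ x, HolFun (W.set x : Set C) (r x)) ∧ (∀ x, ∀ p ∈ W.set x, IsGL11 (r x p)) ∧
    (∀ x y, ∀ p ∈ W.inter x y, r x p * X.bundle.g x y p = Y.bundle.g x y p * r y p) ∧
    (∀ x, ∀ p ∈ W.set x, sdet (r x p) * X.bundle.t x p = Y.bundle.t x p) ∧
    ∀ x, ∀ p ∈ W.set x, ∀ v, r x p * X.higgs.form x p v = Y.higgs.form x p v * r x p

/-! ### The parametrizing data -/

/-- The choices made in the description of bundles by their invariants: representing cocycles for
all classes in `Pic_Λ(C)`, `H¹(C, L⁻¹ ⊗ Λ₁)` and `H¹(C, L ⊗ Λ₁)`, functions `f A B` which correct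
the failure of the parametrized matrices to satisfy the cocycle condition, and the resulting
bundles `E 𝓛 A B` with transition functions `gauss (k * f) L α β` and Berezinian bundle `L`. -/
structure NormalForms (l : LineCocycle C N) where
  /-- a multiplicative cocycle representing the given class -/
  k : Pic C N → LineCocycle C N
  k_cls : ∀ P, (k P).cls = P
  /-- a cocycle representing the given class -/
  α : H1Odd l.inv → OddCocycle l.inv
  α_cls : ∀ A, (α A).cls = A
  /-- a cocycle representing the given class -/
  β : H1Odd l → OddCocycle l
  β_cls : ∀ B, (β B).cls = B
  /-- the central correction -/
  f : H1Odd l.inv → H1Odd l → C → C → C → Grassmann N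
  /-- the bundle with the given invariants -/
  E : Pic C N → H1Odd l.inv → H1Odd l → FramedBundle l
  le_k : ∀ P A B, (E P A B).cov ≤ (k P).cov
  le_α : ∀ P A B, (E P A B).cov ≤ (α A).cov
  le_β : ∀ P A B, (E P A B).cov ≤ (β B).cov
  g_eq : ∀ P A B x y, ∀ p ∈ (E P A B).cov.inter x y,
    (E P A B).g x y p =
      gauss ((k P).tr x y p * f A B x y p) (l.tr x y p) ((α A).f x y p) ((β B).f x y p)
  t_eq : ∀ P A B x, ∀ p ∈ (E P A B).cov.set x, (E P A B).t x p = 1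

/-- The parametrizing data: elements of
`Pic_Λ(C) × H⁰(K ⊗ Λ₀) × H¹(L⁻¹ ⊗ Λ₁) × H¹(L ⊗ Λ₁) × H⁰(L ⊗ K ⊗ Λ₁) × H⁰(L⁻¹ ⊗ K ⊗ Λ₁)`
satisfying the relations `[b] · [α] = [b] · [β] = 0`, `[c] = 0` and `[δ] · [α] = [β] · [γ]`. -/
structure HiggsData (l : LineCocycle C N) (b : EvenForm C N) where
  pic : Pic C N
  a : EvenForm C N
  A : H1Odd l.inv
  B : H1Odd l
  δ : OddFormSection l
  γ : OddFormSection l.inv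
  bA : CupFormZero b A
  bB : CupFormZero b B
  c : CZero b A B
  rel : CupEq δ A B γ

/-- `P' = [k] · exp ([lam] · [β] - [α] · [rho])`: the class `P'` is represented by the product of `k`
with the exponential of the nilpotent even cocycle `Y = lam x * β x y - α x y * rho x`, whose cube
is zero. -/
def PicShift {l : LineCocycle C N} (k : LineCocycle C N) (α : OddCocycle l.inv) (β : OddCocycle l)
    (lam : OddSection l.inv) (rho : OddSection l) (P' : Pic C N) : Prop :=
  ∃ k' : LineCocycle C N, k'.cls = P' ∧ k'.cov ≤ k.cov ∧ k'.cov ≤ α.cov ∧ k'.cov ≤ β.cov ∧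
    ∀ x y, ∀ p ∈ k'.cov.inter x y,
      let Y := lam.s x p * β.f x y p - α.f x y p * rho.s x p
      k'.tr x y p = k.tr x y p * (1 + Y + (1 / 2 : ℂ) • (Y * Y))

end Higgs

end Cech

end SuperHiggs

namespace SuperHiggs

set_option linter.unusedSimpArgs false

/-! ### Parity and anticommutation in the Grassmann algebra -/

section Parity

variable {N : ℕ}

/-! An even supermatrix with zero diagonal and odd off-diagonal entries `a` (lower) and `b` (upper)
has vanishing cube; its exponential is `gauss 1 1 a b`. The commutator of two such matrices is a
central scalar, so the Baker–Campbell–Hausdorff series stops after the commutator term. Hence every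
element of `GL(1|1)` is uniquely a central factor `m`, times such an exponential, times `diag(σ,
1)`, where `σ` is the Berezinian (`IsGL11.eq_gauss`, `gauss_injective`), and the group law
`gauss_mul` reads: `σ` is multiplicative, `a` and `b` add up with a twist by `σ⁻¹` and `σ`, and `m`
is multiplicative up to the exponential of half of `a₁ σ₁ b₂ - σ₁⁻¹ a₂ b₁`.

For transition functions with Berezinian `L` this says that `α` and `β` are additive cocycles with
values in `L⁻¹ ⊗ Λ₁` and `L ⊗ Λ₁`, and that `m` is a multiplicative cocycle up to the exponential of
the antisymmetrized cup product of `α` and `β`. This error is a coboundary because second cohomology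
vanishes on a curve. What is needed is made explicit in `cup_vanish`: if `α` and `β` are the
coboundaries of smooth cochains `u` and `v`, and `∂̄ w = (∂̄ u) v` locally, then `u x * β x y - w x
+ w y` is holomorphic and bounds the cup product. The local equation is solved with the Cauchy
kernel (`exists_dbar_eq`). Exponentiating gives the central correction `f` (`exists_correction`), so
the normal forms exist. Conversely the central factor of any bundle divided by `f` is a genuine
multiplicative cocycle, whose class is the remaining invariant (`NormalForms.exists_reduction`).

Central factors do not act on Higgs fields, and in Gaussian coordinates the compatibility of two
matrices of a Higgs field is triangular (`higgs_compat_iff`): the off-diagonal entries solve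
inhomogeneous equations with right-hand sides `β b` and `α b`, and the `(1,1)` entry is then a
primitive of the cochain `c`. Solvability is the vanishing of `[b] · [α]`, `[b] · [β]` and `[c]`.
Differences of solutions satisfy the homogeneous system: the off-diagonal parts are global sections
`δ̃`, `γ̃`, the relation `[δ̃] · [α] = [β] · [γ̃]` is the solvability of the equation for the
diagonal, and what is left is a global scalar form `ã`. After one base solution has been chosen for
each bundle this is the parametrization `NormalForms.exists_parametrization`.

An isomorphism of normal forms respects the identifications with `L`, so it has Berezinian one and
equals `gauss q 1 λ ρ`. The additive coordinates of the gauge relation force the odd classes to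
agree and `λ`, `ρ` to be global sections. In the central coordinate the two sides contribute half of
`λ β - α ρ` each, so the line bundle is shifted by its exponential, up to the coboundary of `q`
(`NormalForms.iso_iff`). -/

theorem mul_mem_parity {i j : ZMod 2} {a b : Grassmann N} (ha : a ∈ parityPart N i)
    (hb : b ∈ parityPart N j) : a * b ∈ parityPart N (i + j) :=
  (CliffordAlgebra.evenOdd_mul_le (0 : QuadraticForm ℂ (Fin N → ℂ)) i j)
    (Submodule.mul_mem_mul ha hb)

theorem even_mul_odd {a b : Grassmann N} (ha : a ∈ parityPart N 0) (hb : b ∈ parityPart N 1) :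
    a * b ∈ parityPart N 1 := by simpa using mul_mem_parity ha hb

theorem odd_mul_even {a b : Grassmann N} (ha : a ∈ parityPart N 1) (hb : b ∈ parityPart N 0) :
    a * b ∈ parityPart N 1 := by simpa using mul_mem_parity ha hb

theorem odd_mul_odd {a b : Grassmann N} (ha : a ∈ parityPart N 1) (hb : b ∈ parityPart N 1) :
    a * b ∈ parityPart N 0 := by
  have := mul_mem_parity ha hb
  rwa [show (1 : ZMod 2) + 1 = 0 from rfl] at this

/-- Odd elements anticommute. -/
theorem odd_anticomm {a b : Grassmann N} (ha : a ∈ parityPart N 1) (hb : b ∈ parityPart N 1) :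
    b * a = -(a * b) := by
  -- Against a generator the induction only has to move a pair of generators, which is even and
  -- hence central. The same argument then serves for the other factor.
  have key : ∀ x, ∀ m : Fin N → ℂ, x ∈ parityPart N 1 →
      x * ExteriorAlgebra.ι ℂ m = -(ExteriorAlgebra.ι ℂ m * x) := by
    intro x m hx
    induction x, hx using CliffordAlgebra.odd_induction with
    | ι v => exact eq_neg_of_add_eq_zero_left (ExteriorAlgebra.ι_add_mul_swap (R := ℂ) v m)
    | add x y hx hy ihx ihy => rw [add_mul, mul_add, ihx, ihy, neg_add]
    | ι_mul_ι_mul m₁ m₂ x hx ih =>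
      have h : ExteriorAlgebra.ι ℂ m₁ * ExteriorAlgebra.ι ℂ m₂ ∈ parityPart N 0 :=
        odd_mul_odd (CliffordAlgebra.ι_mem_evenOdd_one _ m₁) (CliffordAlgebra.ι_mem_evenOdd_one _ m₂)
      change ExteriorAlgebra.ι ℂ m₁ * ExteriorAlgebra.ι ℂ m₂ * x * ExteriorAlgebra.ι ℂ m =
        -(ExteriorAlgebra.ι ℂ m * (ExteriorAlgebra.ι ℂ m₁ * ExteriorAlgebra.ι ℂ m₂ * x))
      rw [mul_assoc, ih, ← mul_assoc _ _ x, ← Grassmann.comm_of_even h (ExteriorAlgebra.ι ℂ m),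
        mul_neg, mul_assoc _ _ x]
  induction a, ha using CliffordAlgebra.odd_induction with
  | ι v => exact key b v hb
  | add x y hx hy ihx ihy => rw [add_mul, mul_add, ihx, ihy, neg_add]
  | ι_mul_ι_mul m₁ m₂ x hx ih =>
    have h : ExteriorAlgebra.ι ℂ m₁ * ExteriorAlgebra.ι ℂ m₂ ∈ parityPart N 0 :=
      odd_mul_odd (CliffordAlgebra.ι_mem_evenOdd_one _ m₁) (CliffordAlgebra.ι_mem_evenOdd_one _ m₂)
    change b * (ExteriorAlgebra.ι ℂ m₁ * ExteriorAlgebra.ι ℂ m₂ * x) =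
      -(ExteriorAlgebra.ι ℂ m₁ * ExteriorAlgebra.ι ℂ m₂ * x * b)
    rw [← mul_assoc b, ← Grassmann.comm_of_even h b, mul_assoc, ih, mul_neg, mul_assoc _ x b]

theorem odd_sq {a : Grassmann N} (ha : a ∈ parityPart N 1) : a * a = 0 := by
  have h := odd_anticomm ha ha
  have h2 : (2 : ℂ) • (a * a) = 0 := by
    rw [two_smul]
    nth_rewrite 1 [h]
    exact neg_add_cancel _
  exact (smul_eq_zero.1 h2).resolve_left two_ne_zero

end Parity

/-! ### Multiplication of exponentials of odd matrices -/

section Identities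

variable {A : Type*} [Ring A] [Algebra ℂ A]

/-- Products of exponentials of odd matrices: the commutator is central. -/
theorem expOdd_mul {a b c d : A} (ha : a * a = 0) (hb : b * b = 0) (hc : c * c = 0) (hd : d * d = 0)
    (hab : b * a = -(a * b)) (hac : c * a = -(a * c)) (had : d * a = -(a * d))
    (hbc : c * b = -(b * c)) (hbd : d * b = -(b * d)) (hcd : d * c = -(c * d)) :
    let Z := (1 / 2 : ℂ) • (a * d - c * b)
    let E := 1 + Z + (1 / 2 : ℂ) • (Z * Z)
    (!![1 - (1 / 2 : ℂ) • (a * b), b; a, 1 + (1 / 2 : ℂ) • (a * b)] *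
      !![1 - (1 / 2 : ℂ) • (c * d), d; c, 1 + (1 / 2 : ℂ) • (c * d)] : Matrix (Fin 2) (Fin 2) A) =
    !![E * (1 - (1 / 2 : ℂ) • ((a + c) * (b + d))), E * (b + d);
       E * (a + c), E * (1 + (1 / 2 : ℂ) • ((a + c) * (b + d)))] := by
  -- In right-associated form the anticommutation rules sort every word alphabetically, and words
  -- with a repeated letter vanish; the rest is linear over `ℂ`.
  have h2 : ∀ {x y : A}, y * x = -(x * y) → ∀ z, y * (x * z) = -(x * (y * z)) := by
    intro x y h z; rw [← mul_assoc, h, neg_mul, mul_assoc]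
  have h3 : ∀ {x : A}, x * x = 0 → ∀ z, x * (x * z) = 0 := by
    intro x h z; rw [← mul_assoc, h, zero_mul]
  rw [Matrix.mul_fin_two]
  refine congrArg _ (funext fun i => ?_)
  fin_cases i <;> (refine funext fun j => ?_; fin_cases j) <;>
  · simp only [Matrix.cons_val_zero, Matrix.cons_val_one, Matrix.cons_val', Matrix.cons_val_fin_one,
      Fin.zero_eta, Fin.mk_one, mul_add, add_mul, mul_sub, sub_mul, smul_mul_assoc, mul_smul_comm,
      mul_assoc, ha, hb, hc, hd, hab, hac, had, hbc, hbd, hcd, h2 hab, h2 hac, h2 had, h2 hbc,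
      h2 hbd, h2 hcd, h3 ha, h3 hb, h3 hc, h3 hd, mul_neg, neg_mul, neg_neg, mul_zero, zero_mul,
      mul_one, one_mul, smul_zero, smul_neg, smul_add, smul_sub]
    module

end Identities

/-! ### Inverses in finite-dimensional algebras -/

section Inverse

/-- In a finite-dimensional algebra, subalgebras are closed under inverses. -/
theorem Subalgebra.ringInverse_mem {R : Type*} [Ring R] [Algebra ℂ R] [Module.Finite ℂ R]
    (S : Subalgebra ℂ R) {a : R} (ha : a ∈ S) : Ring.inverse a ∈ S := by
  by_cases h : IsUnit a
  -- Left multiplication by a unit is injective on `S`, hence surjective by finite dimension, and a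
  -- preimage of `1` is the inverse. For a non-unit the value of `Ring.inverse` is `0`, which also
  -- lies in `S`.
  · have hinj : Function.Injective (LinearMap.mulLeft ℂ (⟨a, ha⟩ : S)) := by
      intro x y hxy
      exact Subtype.ext (h.mul_left_cancel (congrArg Subtype.val hxy))
    have : Module.Finite ℂ S := Module.Finite.of_injective S.val.toLinearMap Subtype.val_injective
    obtain ⟨c, hc⟩ := LinearMap.injective_iff_surjective.1 hinj 1
    have hc' : a * (c : R) = 1 := congrArg Subtype.val hc
    have e : Ring.inverse a = c := by
      rw [← mul_one (Ring.inverse a), ← hc', ← mul_assoc, Ring.inverse_mul_cancel _ h, one_mul]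
    rw [e]
    exact c.2
  · rw [Ring.inverse_non_unit _ h]
    exact S.zero_mem

variable {N : ℕ}

instance : Module.Finite ℂ (Grassmann N) := Grassmann.finite N

theorem inverse_mem_even {a : Grassmann N} (ha : a ∈ parityPart N 0) :
    Ring.inverse a ∈ parityPart N 0 :=
  Subalgebra.ringInverse_mem (CliffordAlgebra.even (0 : QuadraticForm ℂ (Fin N → ℂ))) ha

theorem mul_mul_inverse {a : Grassmann N} (ha : IsUnit a) (z : Grassmann N) :
    a * (Ring.inverse a * z) = z := by rw [← mul_assoc, Ring.mul_inverse_cancel _ ha, one_mul]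

theorem inverse_mul_mul {a : Grassmann N} (ha : IsUnit a) (z : Grassmann N) :
    Ring.inverse a * (a * z) = z := by rw [← mul_assoc, Ring.inverse_mul_cancel _ ha, one_mul]

theorem isUnit_inverse {R : Type*} [Ring R] {a : R} (ha : IsUnit a) : IsUnit (Ring.inverse a) :=
  ha.ringInverse

theorem smul_mem_parity {i : ZMod 2} (c : ℂ) {a : Grassmann N} (ha : a ∈ parityPart N i) :
    c • a ∈ parityPart N i := Submodule.smul_mem _ _ ha

end Inverse

/-! ### Gaussian coordinates on `GL(1|1)` -/

section Gauss

variable {N : ℕ}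

/-- Even matrices form a subalgebra. -/
def evenMat (N : ℕ) : Subalgebra ℂ (Mat N) where
  carrier := {M | IsEvenMat M}
  mul_mem' := by
    rintro A B ⟨h1, h2, h3, h4⟩ ⟨k1, k2, k3, k4⟩
    refine ⟨?_, ?_, ?_, ?_⟩ <;> rw [Matrix.mul_apply, Fin.sum_univ_two]
    · exact add_mem (mul_mem_even h1 k1) (odd_mul_odd h3 k4)
    · exact add_mem (odd_mul_odd h4 k3) (mul_mem_even h2 k2)
    · exact add_mem (even_mul_odd h1 k3) (odd_mul_even h3 k2)
    · exact add_mem (odd_mul_even h4 k1) (even_mul_odd h2 k4)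
  add_mem' := by
    rintro A B ⟨h1, h2, h3, h4⟩ ⟨k1, k2, k3, k4⟩
    exact ⟨add_mem h1 k1, add_mem h2 k2, add_mem h3 k3, add_mem h4 k4⟩
  algebraMap_mem' := by
    intro r
    have : (algebraMap ℂ (Grassmann N) r) ∈ parityPart N 0 := by
      rw [Algebra.algebraMap_eq_smul_one]
      exact smul_mem_parity _ (one_mem_even N)
    refine ⟨?_, ?_, ?_, ?_⟩ <;> simp [Matrix.algebraMap_matrix_apply, this]

theorem IsEvenMat.mul {A B : Mat N} (hA : IsEvenMat A) (hB : IsEvenMat B) : IsEvenMat (A * B) :=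
  (evenMat N).mul_mem hA hB

/-- The supertrace is a trace on even matrices. -/
theorem str_mul_comm {A B : Mat N} (hA : IsEvenMat A) (hB : IsEvenMat B) :
    str (A * B) = str (B * A) := by
  obtain ⟨h1, h2, h3, h4⟩ := hA
  obtain ⟨k1, k2, k3, k4⟩ := hB
  simp only [str, Matrix.mul_apply, Fin.sum_univ_two]
  rw [Grassmann.comm_of_even h1, Grassmann.comm_of_even h2, odd_anticomm k4 h3, odd_anticomm k3 h4]
  abel

/-- The exponential of a nilpotent even element with vanishing cube. -/
noncomputable def expE (Z : Grassmann N) : Grassmann N := 1 + Z + (1 / 2 : ℂ) • (Z * Z)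

theorem expE_mem {Z : Grassmann N} (hZ : Z ∈ parityPart N 0) : expE Z ∈ parityPart N 0 :=
  add_mem (add_mem (one_mem_even N) hZ) (smul_mem_parity _ (mul_mem_even hZ hZ))

/-- For odd `a` and `b` the right-hand side is the exponential of the matrix `X` with zero diagonal
and off-diagonal entries `b` and `a`, because `X ^ 2` is diagonal with entries `-(a * b)` and `a *
b`, and `X ^ 3 = 0`. -/
theorem gauss_one_one (a b : Grassmann N) :
    gauss 1 1 a b = !![1 - (1 / 2 : ℂ) • (a * b), b; a, 1 + (1 / 2 : ℂ) • (a * b)] := by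
  simp [gauss]

theorem commute_even {m : Grassmann N} (hm : m ∈ parityPart N 0) (z : Grassmann N) : Commute m z :=
  Grassmann.comm_of_even hm z

/-- Splits off the centre and the torus, so that only products of the exponentials `gauss 1 1 a b`
have to be computed by hand. -/
theorem gauss_eq (m s a b : Grassmann N) :
    gauss m s a b = Matrix.scalar (Fin 2) m * (gauss 1 1 a b * !![s, 0; 0, 1]) := by
  rw [gauss_one_one]
  ext i j
  fin_cases i <;> fin_cases j <;>
    simp [gauss, Matrix.scalar_apply, Matrix.diagonal_mul, mul_assoc]

/-- Conjugation by `diag(s, 1)` rescales the two odd coordinates inversely. This is why `α` takes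
values in `L⁻¹` and `β` in `L`. -/
theorem diag_mul_gauss {s s' a b : Grassmann N} (hs : s ∈ parityPart N 0)
    (hs' : s' ∈ parityPart N 0) (h : s * s' = 1) :
    !![s, 0; 0, 1] * gauss 1 1 a b = gauss 1 1 (s' * a) (s * b) * !![s, 0; 0, 1] := by
  have e1 : s' * a * s = a := by
    rw [mul_assoc, ← Grassmann.comm_of_even hs a, ← mul_assoc, Grassmann.comm_of_even hs', h,
      one_mul]
  have e2 : s' * a * (s * b) = a * b := by rw [← mul_assoc, e1]
  rw [gauss_one_one, gauss_one_one, e2, Matrix.mul_fin_two, Matrix.mul_fin_two, e1]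
  simp [Grassmann.comm_of_even hs]

/-- The group law in the Gaussian parametrization. -/
theorem gauss_mul {m₁ m₂ s₁ s₁' s₂ a₁ a₂ b₁ b₂ : Grassmann N} (hm₂ : m₂ ∈ parityPart N 0)
    (hs : s₁ ∈ parityPart N 0) (hs' : s₁' ∈ parityPart N 0) (h : s₁ * s₁' = 1)
    (ha₁ : a₁ ∈ parityPart N 1) (hb₁ : b₁ ∈ parityPart N 1)
    (ha₂ : a₂ ∈ parityPart N 1) (hb₂ : b₂ ∈ parityPart N 1) :
    gauss m₁ s₁ a₁ b₁ * gauss m₂ s₂ a₂ b₂ =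
      gauss (m₁ * m₂ * expE ((1 / 2 : ℂ) • (a₁ * (s₁ * b₂) - s₁' * a₂ * b₁))) (s₁ * s₂)
        (a₁ + s₁' * a₂) (b₁ + s₁ * b₂) := by
  have hc := even_mul_odd hs' ha₂
  have hd := even_mul_odd hs hb₂
  rw [gauss_eq m₁, gauss_eq m₂, gauss_eq (_ * _ * _)]
  have e := expOdd_mul (odd_sq ha₁) (odd_sq hb₁) (odd_sq hc) (odd_sq hd) (odd_anticomm ha₁ hb₁)
    (odd_anticomm ha₁ hc) (odd_anticomm ha₁ hd) (odd_anticomm hb₁ hc) (odd_anticomm hb₁ hd)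
    (odd_anticomm hc hd)
  rw [← gauss_one_one, ← gauss_one_one] at e
  have e' : gauss 1 1 a₁ b₁ * gauss 1 1 (s₁' * a₂) (s₁ * b₂) =
      Matrix.scalar (Fin 2) (expE ((1 / 2 : ℂ) • (a₁ * (s₁ * b₂) - s₁' * a₂ * b₁))) *
      gauss 1 1 (a₁ + s₁' * a₂) (b₁ + s₁ * b₂) := by
    rw [e, gauss_one_one]
    ext i j
    fin_cases i <;> fin_cases j <;> simp [Matrix.scalar_apply, Matrix.diagonal_mul, expE]
  have hD : (!![s₁, 0; 0, 1] * !![s₂, 0; 0, 1] : Mat N) = !![s₁ * s₂, 0; 0, 1] := by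
    simp [Matrix.mul_fin_two]
  have hS := Matrix.scalar_commute (n := Fin 2) m₂ (commute_even hm₂)
    (gauss 1 1 a₁ b₁ * !![s₁, 0; 0, 1])
  calc _ = Matrix.scalar (Fin 2) m₁ * ((gauss 1 1 a₁ b₁ * !![s₁, 0; 0, 1]) *
        Matrix.scalar (Fin 2) m₂) * (gauss 1 1 a₂ b₂ * !![s₂, 0; 0, 1]) := by
        simp only [mul_assoc]
    _ = Matrix.scalar (Fin 2) m₁ * Matrix.scalar (Fin 2) m₂ * (gauss 1 1 a₁ b₁ *
        (!![s₁, 0; 0, 1] * gauss 1 1 a₂ b₂) * !![s₂, 0; 0, 1]) := by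
        rw [← hS.eq]; simp only [mul_assoc]
    _ = Matrix.scalar (Fin 2) m₁ * Matrix.scalar (Fin 2) m₂ * ((gauss 1 1 a₁ b₁ *
        gauss 1 1 (s₁' * a₂) (s₁ * b₂)) * (!![s₁, 0; 0, 1] * !![s₂, 0; 0, 1])) := by
        rw [diag_mul_gauss hs hs' h]; simp only [mul_assoc]
    _ = _ := by rw [e', hD]; simp only [mul_assoc, map_mul]

theorem gauss_isEvenMat {m s a b : Grassmann N} (hm : m ∈ parityPart N 0)
    (hs : s ∈ parityPart N 0) (ha : a ∈ parityPart N 1) (hb : b ∈ parityPart N 1) :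
    IsEvenMat (gauss m s a b) := by
  have hab := smul_mem_parity (1 / 2 : ℂ) (odd_mul_odd ha hb)
  exact ⟨mul_mem_even (mul_mem_even hm (sub_mem (one_mem_even N) hab)) hs,
    mul_mem_even hm (add_mem (one_mem_even N) hab), even_mul_odd hm hb,
    odd_mul_even (even_mul_odd hm ha) hs⟩

theorem odd_mul_odd_sq {a b : Grassmann N} (ha : a ∈ parityPart N 1) (hb : b ∈ parityPart N 1) :
    a * b * (a * b) = 0 := by
  rw [mul_assoc, ← mul_assoc b, odd_anticomm ha hb, neg_mul, mul_neg, mul_assoc, odd_sq hb]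
  simp

theorem one_add_mul_one_sub {a b : Grassmann N} (c : ℂ) (ha : a ∈ parityPart N 1)
    (hb : b ∈ parityPart N 1) : (1 + c • (a * b)) * (1 - c • (a * b)) = 1 := by
  simp [mul_sub, add_mul, odd_mul_odd_sq ha hb]

theorem one_sub_mul_one_add {a b : Grassmann N} (c : ℂ) (ha : a ∈ parityPart N 1)
    (hb : b ∈ parityPart N 1) : (1 - c • (a * b)) * (1 + c • (a * b)) = 1 := by
  simp [mul_add, sub_mul, odd_mul_odd_sq ha hb]

theorem isUnit_one_sub {a b : Grassmann N} (c : ℂ) (ha : a ∈ parityPart N 1)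
    (hb : b ∈ parityPart N 1) : IsUnit (1 - c • (a * b)) :=
  ⟨⟨_, _, one_sub_mul_one_add c ha hb, one_add_mul_one_sub c ha hb⟩, rfl⟩

theorem isUnit_one_add {a b : Grassmann N} (c : ℂ) (ha : a ∈ parityPart N 1)
    (hb : b ∈ parityPart N 1) : IsUnit (1 + c • (a * b)) :=
  ⟨⟨_, _, one_add_mul_one_sub c ha hb, one_sub_mul_one_add c ha hb⟩, rfl⟩

theorem gauss_isGL11 {m s a b : Grassmann N} (hm : m ∈ parityPart N 0) (hm' : IsUnit m)
    (hs : s ∈ parityPart N 0) (hs' : IsUnit s) (ha : a ∈ parityPart N 1) (hb : b ∈ parityPart N 1) :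
    IsGL11 (gauss m s a b) :=
  ⟨gauss_isEvenMat hm hs ha hb, (hm'.mul (isUnit_one_sub _ ha hb)).mul hs',
    hm'.mul (isUnit_one_add _ ha hb)⟩

theorem gauss_one_zero (N : ℕ) : gauss (1 : Grassmann N) 1 0 0 = 1 := by
  rw [gauss_one_one]; simp [Matrix.one_fin_two]

theorem inverse_eq_of_mul_eq_one {R : Type*} [Ring R] {a b : R} (h : a * b = 1) (h' : b * a = 1) :
    Ring.inverse a = b := by
  have hu : IsUnit a := ⟨⟨a, b, h, h'⟩, rfl⟩
  rw [← mul_one (Ring.inverse a), ← h, ← mul_assoc, Ring.inverse_mul_cancel _ hu, one_mul]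

/-- The central `m` cancels in the quotient of the diagonal entries. With `x = a * b` and `x * x =
0` the remaining factors are `(1 - x/2) / (1 + x/2) = (1 - x/2) ^ 2 = 1 - x` and the correction `1 +
x`, whose product is `1`. -/
theorem sdet_gauss {m s a b : Grassmann N} (hm : m ∈ parityPart N 0) (hm' : IsUnit m)
    (hs : s ∈ parityPart N 0) (hs' : IsUnit s) (ha : a ∈ parityPart N 1) (hb : b ∈ parityPart N 1) :
    sdet (gauss m s a b) = s := by
  have hi := inverse_mem_even hm
  have hj := inverse_mem_even hs
  have cm := fun z => (Grassmann.comm_of_even hm z).symm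
  have ci := fun z => (Grassmann.comm_of_even hi z).symm
  have cj := fun z => (Grassmann.comm_of_even hj z).symm
  have cs := fun z => (Grassmann.comm_of_even hs z).symm
  have h1 := one_add_mul_one_sub (1 / 2) ha hb
  have h2 := one_sub_mul_one_add (1 / 2) ha hb
  have hab := smul_mem_parity (1 / 2 : ℂ) (odd_mul_odd ha hb)
  have hp := add_mem (one_mem_even N) hab
  have hn := sub_mem (one_mem_even N) hab
  have e1 : Ring.inverse (m * (1 + (1 / 2 : ℂ) • (a * b))) =
      (1 - (1 / 2 : ℂ) • (a * b)) * Ring.inverse m := by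
    apply inverse_eq_of_mul_eq_one
    · rw [mul_assoc, ← mul_assoc (1 + _), h1, one_mul, Ring.mul_inverse_cancel _ hm']
    · rw [mul_assoc, ← mul_assoc _ m, Ring.inverse_mul_cancel _ hm', one_mul, h2]
  have e2 : Ring.inverse (m * (1 + (1 / 2 : ℂ) • (a * b)) * (m * (1 - (1 / 2 : ℂ) • (a * b)) * s)) =
      Ring.inverse s * (Ring.inverse m * Ring.inverse m) := by
    have : m * (1 + (1 / 2 : ℂ) • (a * b)) * (m * (1 - (1 / 2 : ℂ) • (a * b)) * s) = m * m * s := by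
      rw [← cm (1 + _), mul_assoc _ m, ← mul_assoc m (m * _), ← mul_assoc m m, ← mul_assoc (1 + _),
        Grassmann.comm_of_even hp, mul_assoc (m * m), h2, mul_one]
    rw [this]
    apply inverse_eq_of_mul_eq_one
    · rw [mul_assoc, mul_mul_inverse hs', mul_assoc, mul_mul_inverse hm',
        Ring.mul_inverse_cancel _ hm']
    · rw [mul_assoc, mul_assoc, mul_assoc, ← mul_assoc (Ring.inverse m) m,
        Ring.inverse_mul_cancel _ hm', one_mul, inverse_mul_mul hm', Ring.inverse_mul_cancel _ hs']
  have e3 : m * b * (m * a * s) * (Ring.inverse s * (Ring.inverse m * Ring.inverse m)) = b * a := by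
    rw [mul_assoc, mul_assoc (m * a), mul_mul_inverse hs', mul_assoc m b, mul_assoc m a,
      ← mul_assoc a, ci (a * _), mul_mul_inverse hm',
      ← mul_assoc b, ci (b * a), mul_mul_inverse hm']
  simp only [sdet, gauss, Matrix.of_apply, Matrix.cons_val_zero, Matrix.cons_val_one,
    Matrix.cons_val', Matrix.cons_val_fin_one]
  rw [e1, e2, e3, odd_anticomm ha hb, sub_neg_eq_add]
  calc m * (1 - (1 / 2 : ℂ) • (a * b)) * s * ((1 - (1 / 2 : ℂ) • (a * b)) * Ring.inverse m) *
        (1 + a * b)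
      = m * ((1 - (1 / 2 : ℂ) • (a * b)) * (s * ((1 - (1 / 2 : ℂ) • (a * b)) *
        (Ring.inverse m * (1 + a * b))))) := by simp only [mul_assoc]
    _ = s * ((1 - (1 / 2 : ℂ) • (a * b)) * (1 - (1 / 2 : ℂ) • (a * b)) * (1 + a * b)) := by
      rw [← mul_assoc _ (Ring.inverse m), ci (1 - _), mul_assoc (Ring.inverse m),
        ← mul_assoc s, ci s, mul_assoc _ s, ← mul_assoc (1 - _) (Ring.inverse m), ci (1 - _),
        mul_assoc (Ring.inverse m), mul_mul_inverse hm', ← mul_assoc _ s, cs (1 - _)]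
      simp only [mul_assoc]
    _ = s := by
      have : (1 - (1 / 2 : ℂ) • (a * b)) * (1 - (1 / 2 : ℂ) • (a * b)) = 1 - (1 : ℂ) • (a * b) := by
        simp only [mul_sub, sub_mul, smul_mul_assoc, mul_smul_comm, odd_mul_odd_sq ha hb, mul_one,
          one_mul]
        module
      rw [this]
      nth_rewrite 2 [← one_smul ℂ (a * b)]
      rw [one_sub_mul_one_add 1 ha hb, mul_one]

/-- Multiplication by `1 + a b / 2` fixes `a` and `b`. Hence the odd coordinates are the quotients
of `m * a` and `m * b` by the lower right entry, and that entry then determines `m`. -/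
theorem gauss_injective {m m' s a a' b b' : Grassmann N} (um' : IsUnit m')
    (us : IsUnit s) (ha : a ∈ parityPart N 1)
    (hb : b ∈ parityPart N 1) (ha' : a' ∈ parityPart N 1) (hb' : b' ∈ parityPart N 1)
    (h : gauss m s a b = gauss m' s a' b') : m = m' ∧ a = a' ∧ b = b' := by
  have h01 : m * b = m' * b' := by simpa [gauss] using congrFun (congrFun h 0) 1
  have h10 : m * a = m' * a' := by
    have : m * a * s = m' * a' * s := by simpa [gauss] using congrFun (congrFun h 1) 0
    exact us.mul_right_cancel this
  have h11 : m * (1 + (1 / 2 : ℂ) • (a * b)) = m' * (1 + (1 / 2 : ℂ) • (a' * b')) := by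
    simpa [gauss] using congrFun (congrFun h 1) 1
  have key : ∀ {a b : Grassmann N}, a ∈ parityPart N 1 → b ∈ parityPart N 1 →
      (1 + (1 / 2 : ℂ) • (a * b)) * a = a ∧ (1 + (1 / 2 : ℂ) • (a * b)) * b = b := by
    intro a b ha hb
    constructor
    · rw [add_mul, smul_mul_assoc, mul_assoc, odd_anticomm ha hb, mul_neg, ← mul_assoc, odd_sq ha]
      simp
    · rw [add_mul, smul_mul_assoc, mul_assoc, odd_sq hb]
      simp
  have hw : ∀ {x x' : Grassmann N}, m * x = m' * x' → (1 + (1 / 2 : ℂ) • (a * b)) * x = x →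
      (1 + (1 / 2 : ℂ) • (a' * b')) * x' = x' → x = x' := by
    intro x x' e e1 e2
    refine (um'.mul (isUnit_one_add (1 / 2) ha' hb')).mul_left_cancel ?_
    rw [← h11, mul_assoc, e1, e, h11, mul_assoc, e2]
  obtain rfl := hw h10 (key ha hb).1 (key ha' hb').1
  obtain rfl := hw h01 (key ha hb).2 (key ha' hb').2
  exact ⟨(isUnit_one_add (1 / 2) ha hb).mul_right_cancel h11, rfl, rfl⟩

/-- Every element of `GL(1|1)` has a Gaussian parametrization. -/
theorem IsGL11.eq_gauss {M : Mat N} (h : IsGL11 M) :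
    M = gauss (M 1 1 * (1 - (1 / 2 : ℂ) •
        (M 1 0 * Ring.inverse (M 0 0) * (M 0 1 * Ring.inverse (M 1 1))))) (sdet M)
      (M 1 0 * Ring.inverse (M 0 0)) (M 0 1 * Ring.inverse (M 1 1)) := by
  obtain ⟨⟨h0, h1, hd, hc⟩, u0, u1⟩ := h
  unfold sdet
  set A := M 0 0 with hA
  set D := M 1 1 with hD
  set d := M 0 1 with hd'
  set c := M 1 0 with hc'
  have cA := fun z => (Grassmann.comm_of_even (inverse_mem_even h0) z).symm
  have cD := fun z => (Grassmann.comm_of_even (inverse_mem_even h1) z).symm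
  set A' := Ring.inverse A with hA'
  set D' := Ring.inverse D with hD'
  have iA : A * A' = 1 := Ring.mul_inverse_cancel _ u0
  have iA2 : A' * A = 1 := Ring.inverse_mul_cancel _ u0
  have iD : D * D' = 1 := Ring.mul_inverse_cancel _ u1
  have iD2 : D' * D = 1 := Ring.inverse_mul_cancel _ u1
  have oa : c * A' ∈ parityPart N 1 := odd_mul_even hc (inverse_mem_even h0)
  have ob : d * D' ∈ parityPart N 1 := odd_mul_even hd (inverse_mem_even h1)
  set a := c * A' with ha
  set b := d * D' with hb
  have hba : d * c * Ring.inverse (D * A) = -(a * b) := by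
    have : Ring.inverse (D * A) = A' * D' := by
      apply inverse_eq_of_mul_eq_one
      · rw [mul_assoc, ← mul_assoc A, iA, one_mul, iD]
      · rw [mul_assoc, ← mul_assoc D', iD2, one_mul, iA2]
    rw [this, ← odd_anticomm oa ob, mul_assoc, ← mul_assoc c, cD (c * A'), ← mul_assoc]
  rw [hba, sub_neg_eq_add]
  have e1 : a * (1 + a * b) = a := by
    rw [mul_add, ← mul_assoc, odd_sq oa]; simp
  have e2 : (1 - (1 / 2 : ℂ) • (a * b)) * b = b := by
    rw [sub_mul, smul_mul_assoc, mul_assoc, odd_sq ob]; simp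
  have e3 : (1 - (1 / 2 : ℂ) • (a * b)) * a = a := by
    rw [sub_mul, one_mul, smul_mul_assoc, mul_assoc a, odd_anticomm oa ob, mul_neg, ← mul_assoc a,
      odd_sq oa]
    simp
  have e4 : (1 - (1 / 2 : ℂ) • (a * b)) * (1 - (1 / 2 : ℂ) • (a * b)) * (1 + a * b) = 1 := by
    have := odd_mul_odd_sq oa ob
    simp only [mul_sub, sub_mul, mul_add, add_mul, smul_mul_assoc, mul_smul_comm, this, mul_one,
      one_mul, zero_mul, mul_zero, smul_zero]
    module
  have cD1 := Grassmann.comm_of_even h1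
  have cA1 := Grassmann.comm_of_even h0
  ext i j
  fin_cases i <;> fin_cases j
  · simp only [gauss, Fin.zero_eta, Matrix.of_apply, Matrix.cons_val_zero, Matrix.cons_val',
      Matrix.cons_val_fin_one]
    rw [← hA, mul_assoc D, cD1, mul_assoc A, cA1]
    rw [mul_assoc, mul_assoc D', ← mul_assoc D, iD, one_mul, ← mul_assoc, e4,
      one_mul]
  · simp only [gauss, Fin.zero_eta, Fin.mk_one, Matrix.of_apply, Matrix.cons_val_zero,
      Matrix.cons_val_one, Matrix.cons_val', Matrix.cons_val_fin_one]
    rw [← hd', mul_assoc D, e2, hb, cD1, mul_assoc, iD2, mul_one]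
  · simp only [gauss, Fin.zero_eta, Fin.mk_one, Matrix.of_apply, Matrix.cons_val_zero,
      Matrix.cons_val_one, Matrix.cons_val', Matrix.cons_val_fin_one]
    rw [← hc', mul_assoc D, e3, mul_assoc A D', cA1 (D' * _), cD1 a, mul_assoc a, mul_assoc D',
      ← mul_assoc D, iD, one_mul, ← mul_assoc a, e1, ha, mul_assoc, iA2, mul_one]
  · simp only [gauss, Fin.mk_one, Matrix.of_apply, Matrix.cons_val_one, Matrix.cons_val',
      Matrix.cons_val_fin_one]
    rw [mul_assoc, one_sub_mul_one_add _ oa ob, mul_one]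

theorem sdet_mem_even {M : Mat N} (h : IsGL11 M) : sdet M ∈ parityPart N 0 := by
  obtain ⟨⟨h0, h1, hd, hc⟩, u0, u1⟩ := h
  exact mul_mem_even (mul_mem_even h0 (inverse_mem_even h1)) (sub_mem (one_mem_even N)
    (mul_mem_even (odd_mul_odd hd hc) (inverse_mem_even (mul_mem_even h1 h0))))

theorem sdet_isUnit {M : Mat N} (h : IsGL11 M) : IsUnit (sdet M) := by
  obtain ⟨⟨h0, h1, hd, hc⟩, u0, u1⟩ := h
  refine (u0.mul (isUnit_inverse u1)).mul ?_
  have := isUnit_one_sub (a := M 0 1) (b := M 1 0 * Ring.inverse (M 1 1 * M 0 0)) 1 hd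
    (odd_mul_even hc (inverse_mem_even (mul_mem_even h1 h0)))
  rwa [one_smul, ← mul_assoc] at this

/-- Every element of `GL(1|1)` has a Gaussian parametrization. -/
theorem IsGL11.exists_gauss {M : Mat N} (h : IsGL11 M) :
    ∃ m a b, m ∈ parityPart N 0 ∧ IsUnit m ∧ a ∈ parityPart N 1 ∧ b ∈ parityPart N 1 ∧
      M = gauss m (sdet M) a b := by
  have h' := h.eq_gauss
  obtain ⟨⟨h0, h1, hd, hc⟩, u0, u1⟩ := h
  have oa := odd_mul_even hc (inverse_mem_even h0)
  have ob := odd_mul_even hd (inverse_mem_even h1)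
  exact ⟨_, _, _, mul_mem_even h1 (sub_mem (one_mem_even N) (smul_mem_parity _
    (odd_mul_odd oa ob))), u1.mul (isUnit_one_sub _ oa ob), oa, ob, h'⟩

/-- The products `a * b` and `c * d` commute and both have square zero. -/
theorem cube_eq_zero {a b c d : Grassmann N} (ha : a ∈ parityPart N 1) (hb : b ∈ parityPart N 1)
    (hc : c ∈ parityPart N 1) (hd : d ∈ parityPart N 1) :
    (a * b + c * d) * (a * b + c * d) * (a * b + c * d) = 0 := by
  have e1 := odd_mul_odd_sq ha hb
  have e2 := odd_mul_odd_sq hc hd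
  have e3 := Grassmann.comm_of_even (odd_mul_odd hc hd) (a * b)
  generalize a * b = x at *
  generalize c * d = y at *
  have h1 : ∀ z, x * (x * z) = 0 := fun z => by rw [← mul_assoc, e1, zero_mul]
  have h2 : ∀ z, y * (y * z) = 0 := fun z => by rw [← mul_assoc, e2, zero_mul]
  have h3 : ∀ z, y * (x * z) = x * (y * z) := fun z => by rw [← mul_assoc, e3, mul_assoc]
  simp only [mul_add, add_mul, mul_assoc, e1, e2, e3, h1, h2, h3, mul_zero, zero_add, add_zero]

theorem expE_mul_neg {Z : Grassmann N} (h : Z * Z * Z = 0) : expE Z * expE (-Z) = 1 := by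
  have h' : Z * (Z * Z) = 0 := by rw [← mul_assoc, h]
  simp only [expE, mul_add, add_mul, mul_one, one_mul, smul_mul_assoc, mul_smul_comm, mul_neg,
    neg_mul, neg_neg, mul_assoc, h', mul_zero, smul_zero, neg_zero]
  module

theorem expE_isUnit {Z : Grassmann N} (h : Z * Z * Z = 0) : IsUnit (expE Z) := by
  have h2 : expE (-Z) * expE Z = 1 := by
    have := expE_mul_neg (Z := -Z) (by simp [h])
    rwa [neg_neg] at this
  exact ⟨⟨_, _, expE_mul_neg h, h2⟩, rfl⟩

/-- The exponential is additive on commuting elements of the form occurring in `gauss_mul`. -/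
theorem expE_add {Z W : Grassmann N} (hZW : Z * W = W * Z) (h1 : Z * Z * W = 0) (h2 : Z * (W * W) = 0) :
    expE Z * expE W = expE (Z + W) := by
  have h3 : Z * (Z * W) = 0 := by rw [← mul_assoc, h1]
  have h4 : W * (Z * W) = 0 := by rw [← mul_assoc, ← hZW, mul_assoc, h2]
  simp only [expE, mul_add, add_mul, mul_one, one_mul, smul_mul_assoc, mul_smul_comm, mul_assoc,
    ← hZW, h2, h3, h4, mul_zero, smul_zero]
  module

/-- The exponent in `gauss_mul` is a combination of two products of odd elements, so the quadratic
polynomial `expE` is its full exponential series. -/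
theorem gauss_mul_mem {s₁ s₁' a₁ a₂ b₁ b₂ : Grassmann N}
    (hs : s₁ ∈ parityPart N 0) (hs' : s₁' ∈ parityPart N 0)
    (ha₁ : a₁ ∈ parityPart N 1) (hb₁ : b₁ ∈ parityPart N 1)
    (ha₂ : a₂ ∈ parityPart N 1) (hb₂ : b₂ ∈ parityPart N 1) :
    let Z := (1 / 2 : ℂ) • (a₁ * (s₁ * b₂) - s₁' * a₂ * b₁)
    Z ∈ parityPart N 0 ∧ Z * Z * Z = 0 := by
  intro Z
  have hc := even_mul_odd hs' ha₂
  have hd := even_mul_odd hs hb₂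
  refine ⟨smul_mem_parity _ (sub_mem (odd_mul_odd ha₁ hd) (odd_mul_odd hc hb₁)), ?_⟩
  have : Z = (1 / 2 : ℂ) • (a₁ * (s₁ * b₂) + -(s₁' * a₂) * b₁) := by
    simp only [Z, neg_mul, sub_eq_add_neg]
  rw [this, smul_mul_smul_comm, smul_mul_smul_comm, cube_eq_zero ha₁ hd (neg_mem hc) hb₁, smul_zero]

/-- Multiplicativity of the Berezinian is read off from the group law, since `sdet` is the
coordinate `s` and that coordinate is multiplicative. -/
theorem IsGL11.mul {A B : Mat N} (hA : IsGL11 A) (hB : IsGL11 B) :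
    IsGL11 (A * B) ∧ sdet (A * B) = sdet A * sdet B := by
  obtain ⟨m, a, b, hm, um, ha, hb, e⟩ := hA.exists_gauss
  obtain ⟨m', a', b', hm', um', ha', hb', e'⟩ := hB.exists_gauss
  have hs := sdet_mem_even hA
  have us := sdet_isUnit hA
  have ht := sdet_mem_even hB
  have ut := sdet_isUnit hB
  have hs' := inverse_mem_even hs
  have h := Ring.mul_inverse_cancel _ us
  have e2 := gauss_mul (m₁ := m) (s₂ := sdet B) hm' hs hs' h ha hb ha' hb'
  have hZ := gauss_mul_mem hs hs' ha hb ha' hb'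
  rw [← e, ← e'] at e2
  have m1 := mul_mem_even (mul_mem_even hm hm') (expE_mem hZ.1)
  have m2 := (um.mul um').mul (expE_isUnit hZ.2)
  have m3 := add_mem ha (even_mul_odd hs' ha')
  have m4 := add_mem hb (even_mul_odd hs hb')
  rw [e2]
  exact ⟨gauss_isGL11 m1 m2 (mul_mem_even hs ht) (us.mul ut) m3 m4,
    sdet_gauss m1 m2 (mul_mem_even hs ht) (us.mul ut) m3 m4⟩

theorem gauss_mul_inv {m m' s s' a b : Grassmann N}
    (hm' : m' ∈ parityPart N 0) (h1 : m * m' = 1)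
    (hs : s ∈ parityPart N 0) (hs' : s' ∈ parityPart N 0) (h : s * s' = 1)
    (ha : a ∈ parityPart N 1) (hb : b ∈ parityPart N 1) :
    gauss m s a b * gauss m' s' (-(s * a)) (-(s' * b)) = 1 := by
  have h' : s' * s = 1 := by rw [Grassmann.comm_of_even hs', h]
  rw [gauss_mul hm' hs hs' h ha hb (neg_mem (even_mul_odd hs ha)) (neg_mem (even_mul_odd hs' hb)),
    h1, h, one_mul]
  have e1 : s' * -(s * a) = -a := by rw [mul_neg, ← mul_assoc, h', one_mul]
  have e2 : s * -(s' * b) = -b := by rw [mul_neg, ← mul_assoc, h, one_mul]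
  rw [e1, e2, add_neg_cancel, add_neg_cancel]
  simp [expE, gauss_one_zero]

theorem isUnit_gauss {m s a b : Grassmann N} (hm : m ∈ parityPart N 0) (um : IsUnit m)
    (hs : s ∈ parityPart N 0) (us : IsUnit s)
    (ha : a ∈ parityPart N 1) (hb : b ∈ parityPart N 1) : IsUnit (gauss m s a b) := by
  have i1 := inverse_mem_even hm
  have i2 := inverse_mem_even hs
  have c1 := Ring.mul_inverse_cancel _ um
  have c2 := Ring.mul_inverse_cancel _ us
  have e := gauss_mul_inv i1 c1 hs i2 c2 ha hb
  have e' := gauss_mul_inv hm (Ring.inverse_mul_cancel _ um) i2 hs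
    (Ring.inverse_mul_cancel _ us) (neg_mem (even_mul_odd hs ha)) (neg_mem (even_mul_odd i2 hb))
  have k1 : -(Ring.inverse s * -(s * a)) = a := by
    rw [mul_neg, neg_neg, ← mul_assoc, Ring.inverse_mul_cancel _ us, one_mul]
  have k2 : -(s * -(Ring.inverse s * b)) = b := by
    rw [mul_neg, neg_neg, ← mul_assoc, c2, one_mul]
  rw [k1, k2] at e'
  exact ⟨⟨_, _, e, e'⟩, rfl⟩

theorem IsGL11.isUnit {M : Mat N} (h : IsGL11 M) : IsUnit M := by
  obtain ⟨m, a, b, hm, um, ha, hb, e⟩ := h.exists_gauss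
  rw [e]
  exact isUnit_gauss hm um (sdet_mem_even h) (sdet_isUnit h) ha hb

end Gauss

/-! ### Higgs fields in Gaussian coordinates -/

variable {N : ℕ}

/-- The adjoint action of the exponential of an odd matrix on even matrices. -/
theorem expOdd_conj {a b c d A B : Grassmann N} (ha : a ∈ parityPart N 1) (hb : b ∈ parityPart N 1)
    (hc : c ∈ parityPart N 1) (hd : d ∈ parityPart N 1) (hA : A ∈ parityPart N 0)
    (hB : B ∈ parityPart N 0) :
    gauss 1 1 a b * !![A, d; c, A - B] =
      !![A + (b * c - d * a + b * a * B), d - b * B;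
         c + a * B, A + (b * c - d * a + b * a * B) - B] * gauss 1 1 a b := by
  have h2 : ∀ {x y : Grassmann N}, y * x = -(x * y) → ∀ z, y * (x * z) = -(x * (y * z)) := by
    intro x y h z; rw [← mul_assoc, h, neg_mul, mul_assoc]
  have h3 : ∀ {x : Grassmann N}, x * x = 0 → ∀ z, x * (x * z) = 0 := by
    intro x h z; rw [← mul_assoc, h, zero_mul]
  have h4 : ∀ {x y : Grassmann N}, y * x = x * y → ∀ z, y * (x * z) = x * (y * z) := by
    intro x y h z; rw [← mul_assoc, h, mul_assoc]
  have sa := odd_sq ha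
  have sb := odd_sq hb
  have ab := odd_anticomm ha hb
  have ac := odd_anticomm ha hc
  have ad := odd_anticomm ha hd
  have bc := odd_anticomm hb hc
  have bd := odd_anticomm hb hd
  have aA := (Grassmann.comm_of_even hA a).symm
  have bA := (Grassmann.comm_of_even hA b).symm
  have cA := (Grassmann.comm_of_even hA c).symm
  have dA := (Grassmann.comm_of_even hA d).symm
  have BA := (Grassmann.comm_of_even hA B).symm
  have aB := (Grassmann.comm_of_even hB a).symm
  have bB := (Grassmann.comm_of_even hB b).symm
  have cB := (Grassmann.comm_of_even hB c).symm
  have dB := (Grassmann.comm_of_even hB d).symm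
  rw [gauss_one_one, Matrix.mul_fin_two, Matrix.mul_fin_two]
  refine congrArg _ (funext fun i => ?_)
  fin_cases i <;> (refine funext fun j => ?_; fin_cases j) <;>
  · simp only [Matrix.cons_val_zero, Matrix.cons_val_one, Matrix.cons_val', Matrix.cons_val_fin_one,
      Fin.zero_eta, Fin.mk_one, mul_add, add_mul, mul_sub, sub_mul, smul_mul_assoc, mul_smul_comm,
      mul_assoc, sa, sb, ab, ac, ad, bc, bd, aA, bA, cA, dA, BA, aB, bB, cB, dB,
      h2 ab, h2 ac, h2 ad, h2 bc, h2 bd, h3 sa, h3 sb, h4 aA, h4 bA, h4 cA, h4 dA, h4 BA, h4 aB,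
      h4 bB, h4 cB, h4 dB, mul_neg, neg_mul, neg_neg, mul_zero, zero_mul,
      mul_one, one_mul, smul_zero, smul_neg, smul_add, smul_sub, neg_zero]
    module

/-- The compatibility of matrices of Higgs fields in two frames, in terms of their entries. -/
theorem higgs_compat_iff {m s s' a b B : Grassmann N} {X Y : Mat N} (hm : m ∈ parityPart N 0)
    (um : IsUnit m) (hs : s ∈ parityPart N 0) (hs' : s' ∈ parityPart N 0) (h : s * s' = 1)
    (ha : a ∈ parityPart N 1) (hb : b ∈ parityPart N 1) (hY : IsEvenMat Y)
    (hB : B ∈ parityPart N 0) (hXB : str X = B) (hYB : str Y = B) :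
    gauss m s a b * Y = X * gauss m s a b ↔
      X 0 1 = s * Y 0 1 - b * B ∧ X 1 0 = s' * Y 1 0 + a * B ∧
      X 0 0 = Y 0 0 + (b * X 1 0 - X 0 1 * a - b * a * B) := by
  have h' : s' * s = 1 := by rw [Grassmann.comm_of_even hs', h]
  obtain ⟨hA, -, hd, hc⟩ := hY
  have hY1 : Y 1 1 = Y 0 0 - B := by rw [← hYB, str]; abel
  have hX1 : X 1 1 = X 0 0 - B := by rw [← hXB, str]; abel
  have od := even_mul_odd hs hd
  have oc := even_mul_odd hs' hc
  -- `Z` is `Y` conjugated by the torus part, so only conjugation by the exponential part is left.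
  set Z : Mat N := !![Y 0 0, s * Y 0 1; s' * Y 1 0, Y 0 0 - B] with hZ
  set D : Mat N := !![s, 0; 0, 1] with hD
  have hDY : D * Y = Z * D := by
    rw [Matrix.eta_fin_two Y, hD, hZ, Matrix.mul_fin_two, Matrix.mul_fin_two, hY1]
    have : s' * Y 1 0 * s = Y 1 0 := by rw [← Grassmann.comm_of_even hs, ← mul_assoc, h, one_mul]
    simp [this, Grassmann.comm_of_even hs]
  have hu : IsUnit (gauss 1 1 a b * D) := by
    have e := gauss_eq 1 s a b
    rw [map_one, one_mul] at e
    rw [← e]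
    exact isUnit_gauss (one_mem_even N) isUnit_one hs ⟨⟨_, _, h, h'⟩, rfl⟩ ha hb
  have hS : IsUnit (Matrix.scalar (Fin 2) m) := um.map _
  have e := expOdd_conj ha hb oc od hA hB
  rw [← hZ] at e
  set W : Mat N := _ with hW
  change _ = W * _ at e
  -- The central factor `m` cancels, so the compatibility says that `X` is the conjugate `W` of `Y`.
  have h1 : gauss m s a b * Y = X * gauss m s a b ↔ X = W := by
    rw [gauss_eq m, ← mul_assoc X, ← (Matrix.scalar_commute (n := Fin 2) m (commute_even hm) X).eq,
      ← hD, mul_assoc, mul_assoc, mul_assoc, hDY, ← mul_assoc _ Z, e, hS.mul_right_inj, mul_assoc W,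
      hu.mul_left_inj, eq_comm]
  rw [h1, hW]
  -- Expressing the diagonal shift through the off-diagonal entries of `X` instead of `Y` flips the
  -- sign of `b * a * B`; this produces exactly the cochain `c`.
  have key : ∀ {x y : Grassmann N}, x = s * Y 0 1 - b * B → y = s' * Y 1 0 + a * B →
      b * (s' * Y 1 0) - s * Y 0 1 * a + b * a * B = b * y - x * a - b * a * B := by
    rintro x y rfl rfl
    rw [mul_add, sub_mul, mul_assoc b B, Grassmann.comm_of_even hB a, mul_assoc b a]
    abel
  constructor
  · intro hX
    have e01 : X 0 1 = s * Y 0 1 - b * B := by rw [hX]; rfl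
    have e10 : X 1 0 = s' * Y 1 0 + a * B := by rw [hX]; rfl
    refine ⟨e01, e10, ?_⟩
    rw [← key e01 e10, hX]
    rfl
  · rintro ⟨e01, e10, e00⟩
    rw [← key e01 e10] at e00
    rw [Matrix.eta_fin_two X, hX1, e00, e01, e10]

/-! ### Calculus of holomorphic vector-valued functions -/

section HolFun

variable {C : Type*} [TopologicalSpace C] [ChartedSpace ℂ C]
variable {V W : Type*} [AddCommGroup V] [Module ℂ V] [AddCommGroup W] [Module ℂ W]

theorem HolFun.linear {U : Set C} {f : C → V} (hf : HolFun U f) (T : V →ₗ[ℂ] W) :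
    HolFun U (fun p => T (f p)) := fun φ => hf (φ ∘ₗ T)

theorem HolFun.congr {U : Set C} {f g : C → V} (hf : HolFun U f) (h : ∀ p ∈ U, g p = f p) :
    HolFun U g := fun φ => (hf φ).congr fun p hp => by rw [h p hp]

theorem HolFun.smul {U : Set C} {f : C → V} (hf : HolFun U f) (c : ℂ) :
    HolFun U (fun p => c • f p) := hf.linear (c • LinearMap.id)

theorem HolFun.sub {U : Set C} {f g : C → V} (hf : HolFun U f) (hg : HolFun U g) :
    HolFun U (fun p => f p - g p) := by
  simpa only [sub_eq_add_neg] using hf.add hg.neg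

theorem HolFun.sum {ι : Type*} (s : Finset ι) {U : Set C} {f : ι → C → V}
    (hf : ∀ i ∈ s, HolFun U (f i)) : HolFun U (fun p => ∑ i ∈ s, f i p) := by
  classical
  induction s using Finset.induction_on with
  | empty => simpa using HolFun.const U (0 : V)
  | insert i s hi ih =>
    simp only [Finset.sum_insert hi]
    exact (hf i (Finset.mem_insert_self i s)).add
      (ih fun j hj => hf j (Finset.mem_insert_of_mem hj))

theorem HolFun.of_local {U : Set C} {f : C → V}
    (h : ∀ p ∈ U, ∃ O : Set C, IsOpen O ∧ p ∈ O ∧ ∃ g : C → V, HolFun O g ∧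
      ∀ q ∈ O, q ∈ U → f q = g q) : HolFun U f := by
  intro φ p hp
  obtain ⟨O, hO, hpO, g, hg, e⟩ := h p hp
  have h1 : MDifferentiableWithinAt 𝓘(ℂ, ℂ) 𝓘(ℂ, ℂ) (fun p => φ (g p)) U p :=
    ((hg φ p hpO).mdifferentiableAt (hO.mem_nhds hpO)).mdifferentiableWithinAt
  refine h1.congr_of_eventuallyEq ?_ (by rw [e p hpO hp])
  filter_upwards [self_mem_nhdsWithin, mem_nhdsWithin_of_mem_nhds (hO.mem_nhds hpO)] with q h1 h2
  rw [e q h2 h1]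

/-- The argument for `Λ` works in any finite-dimensional algebra; it is needed for supermatrices. -/
theorem HolFun.mul' {R : Type*} [Ring R] [Algebra ℂ R] [Module.Finite ℂ R] {U : Set C}
    {f g : C → R} (hf : HolFun U f) (hg : HolFun U g) : HolFun U (fun p => f p * g p) := by
  intro φ
  let b := Module.finBasis ℂ R
  have h : ∀ p, φ (f p * g p) =
      ∑ i, b.coord i (f p) * (φ ∘ₗ LinearMap.mulLeft ℂ (b i)) (g p) := by
    intro p
    conv_lhs => rw [← b.sum_repr (f p)]
    rw [Finset.sum_mul, map_sum]
    refine Finset.sum_congr rfl fun i _ => ?_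
    rw [smul_mul_assoc, map_smul, smul_eq_mul]
    rfl
  simp only [h]
  intro p hp
  have := fun i => ((hf (b.coord i)).mul (hg (φ ∘ₗ LinearMap.mulLeft ℂ (b i)))) p hp
  have h2 := MDifferentiableWithinAt.sum (t := Finset.univ) fun i _ => this i
  have e : (fun q => ∑ i, b.coord i (f q) * (φ ∘ₗ LinearMap.mulLeft ℂ (b i)) (g q)) =
      ∑ i, (fun q => b.coord i (f q)) * fun q => (φ ∘ₗ LinearMap.mulLeft ℂ (b i)) (g q) := by
    funext q
    rw [Finset.sum_apply]
    rfl
  rw [e]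
  exact h2

theorem HolFun.pow {R : Type*} [Ring R] [Algebra ℂ R] [Module.Finite ℂ R] {U : Set C}
    {f : C → R} (hf : HolFun U f) (n : ℕ) : HolFun U (fun p => f p ^ n) := by
  induction n with
  | zero => simpa using HolFun.const U (1 : R)
  | succ n ih => simpa only [pow_succ] using ih.mul' hf

theorem HolFun.prod {ι : Type*} (s : Finset ι) {U : Set C} {f : ι → C → ℂ}
    (hf : ∀ i ∈ s, HolFun U (f i)) : HolFun U (fun p => ∏ i ∈ s, f i p) := by
  classical
  induction s using Finset.induction_on with
  | empty => simpa using HolFun.const U (1 : ℂ)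
  | insert i s hi ih =>
    simp only [Finset.prod_insert hi]
    exact (hf i (Finset.mem_insert_self i s)).mul'
      (ih fun j hj => hf j (Finset.mem_insert_of_mem hj))

theorem HolFun.det {n : Type*} [Fintype n] [DecidableEq n] {U : Set C}
    {f : C → Matrix n n ℂ} (hf : ∀ i j, HolFun U fun p => f p i j) :
    HolFun U (fun p => (f p).det) := by
  simp only [Matrix.det_apply, Units.smul_def, zsmul_eq_mul]
  exact HolFun.sum _ fun σ _ => (HolFun.const U _).mul' (HolFun.prod _ fun i _ => hf _ _)

theorem HolFun.inv {U : Set C} {f : C → ℂ} (hf : HolFun U f) (h : ∀ p ∈ U, f p ≠ 0) :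
    HolFun U (fun p => (f p)⁻¹) := by
  intro φ
  have h1 : MDifferentiableOn 𝓘(ℂ, ℂ) 𝓘(ℂ, ℂ) f U := hf LinearMap.id
  have h2 : MDifferentiableOn 𝓘(ℂ, ℂ) 𝓘(ℂ, ℂ) (fun p => (f p)⁻¹) U := by
    intro p hp
    have h3 : MDifferentiableAt 𝓘(ℂ, ℂ) 𝓘(ℂ, ℂ) (fun z : ℂ => z⁻¹) (f p) :=
      (differentiableAt_inv (h p hp)).mdifferentiableAt
    exact h3.comp_mdifferentiableWithinAt p (h1 p hp)
  have e : (fun p => φ ((f p)⁻¹)) = fun p => φ 1 * (f p)⁻¹ := by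
    funext p
    conv_lhs => rw [← mul_one ((f p)⁻¹), ← smul_eq_mul, map_smul, smul_eq_mul, mul_comm]
  rw [e]
  exact mdifferentiableOn_const.mul h2

/-- Inverses of holomorphic functions with values in the units of a finite-dimensional algebra are
holomorphic. -/
theorem HolFun.ringInverse {R : Type*} [Ring R] [Algebra ℂ R] [Module.Finite ℂ R] {U : Set C}
    {f : C → R} (hf : HolFun U f) (hu : ∀ p ∈ U, IsUnit (f p)) :
    HolFun U (fun p => Ring.inverse (f p)) := by
  classical
  -- The matrix of left multiplication by `f p` has holomorphic entries, and so has its inverse by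
  -- Cramer's rule. Applied to the coordinates of `1` it gives the coordinates of the inverse of `f
  -- p`.
  let b := Module.finBasis ℂ R
  let A := fun p => Algebra.leftMulMatrix b (f p)
  have hA : ∀ i j, HolFun U fun p => A p i j := fun i j => by
    have : (fun p => A p i j) = fun p => (b.coord i ∘ₗ LinearMap.mulRight ℂ (b j)) (f p) := by
      funext p
      simp only [A, Algebra.leftMulMatrix_eq_repr_mul]
      rfl
    rw [this]
    exact hf.linear _
  have hdet : ∀ p ∈ U, (A p).det ≠ 0 := fun p hp =>
    ((Matrix.isUnit_iff_isUnit_det _).1 ((hu p hp).map (Algebra.leftMulMatrix b))).ne_zero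
  have hadj : ∀ i j, HolFun U fun p => (A p).adjugate i j := by
    intro i j
    simp only [Matrix.adjugate_apply]
    refine HolFun.det fun k m => ?_
    by_cases hk : k = j
    · subst hk
      simpa only [Matrix.updateRow_self] using HolFun.const U _
    · simpa only [Matrix.updateRow_ne hk] using hA k m
  have key : HolFun U fun p => ∑ i, (∑ j, (((A p).det)⁻¹ * (A p).adjugate i j) * b.repr 1 j) • b i := by
    refine HolFun.sum _ fun i _ => ?_
    have h1 : HolFun U fun p => ∑ j, (((A p).det)⁻¹ * (A p).adjugate i j) * b.repr 1 j :=
      HolFun.sum _ fun j _ => (((HolFun.det hA).inv hdet).mul' (hadj i j)).mul' (HolFun.const U _)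
    exact h1.linear (LinearMap.toSpanSingleton ℂ R (b i))
  refine key.congr fun p hp => ?_
  have h1 : Matrix.mulVec (A p) (b.repr (Ring.inverse (f p))) = b.repr 1 := by
    rw [Algebra.leftMulMatrix_mulVec_repr, Ring.mul_inverse_cancel _ (hu p hp)]
  have h2 : b.repr (Ring.inverse (f p)) = Matrix.mulVec ((A p)⁻¹) (b.repr 1) := by
    rw [← h1, Matrix.mulVec_mulVec, Matrix.nonsing_inv_mul _ (hdet p hp).isUnit, Matrix.one_mulVec]
  conv_lhs => rw [← b.sum_repr (Ring.inverse (f p)), h2]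
  refine Finset.sum_congr rfl fun i _ => ?_
  rw [Matrix.inv_def]
  simp [Matrix.mulVec, dotProduct, Ring.inverse_eq_inv']

variable {N : ℕ}

instance : Module.Finite ℂ (Mat N) := Module.Finite.matrix

theorem HolFun.of_entries {U : Set C} {f : C → Mat N} (h : ∀ i j, HolFun U fun p => f p i j) :
    HolFun U f := by
  have e : f = fun p => ∑ i, ∑ j, Matrix.singleLinearMap ℂ i j (f p i j) := by
    funext p
    exact Matrix.matrix_eq_sum_single (f p)
  rw [e]
  exact HolFun.sum _ fun i _ => HolFun.sum _ fun j _ => (h i j).linear _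

theorem HolFun.entry {U : Set C} {f : C → Mat N} (h : HolFun U f) (i j : Fin 2) :
    HolFun U fun p => f p i j := h.linear (Matrix.entryLinearMap ℂ (Grassmann N) i j)

theorem HolFun.gauss {U : Set C} {m s a b : C → Grassmann N} (hm : HolFun U m) (hs : HolFun U s)
    (ha : HolFun U a) (hb : HolFun U b) : HolFun U fun p => gauss (m p) (s p) (a p) (b p) := by
  have hab := (ha.mul hb).smul (1 / 2)
  refine HolFun.of_entries fun i j => ?_
  fin_cases i <;> fin_cases j
  · exact (hm.mul ((HolFun.const U 1).sub hab)).mul hs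
  · exact hm.mul hb
  · exact (hm.mul ha).mul hs
  · exact hm.mul ((HolFun.const U 1).add hab)

/-- A matrix of one-forms with the given entries. -/
noncomputable def matForm (a d c e : OneForm C (Grassmann N)) : OneForm C (Mat N) := fun p =>
  Matrix.singleLinearMap ℂ 0 0 ∘ₗ a p + Matrix.singleLinearMap ℂ 0 1 ∘ₗ d p +
    (Matrix.singleLinearMap ℂ 1 0 ∘ₗ c p + Matrix.singleLinearMap ℂ 1 1 ∘ₗ e p)

theorem matForm_apply (a d c e : OneForm C (Grassmann N)) (p : C) (v : TangentSpace 𝓘(ℂ, ℂ) p) :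
    matForm a d c e p v = !![a p v, d p v; c p v, e p v] := by
  ext i j
  fin_cases i <;> fin_cases j <;> simp [matForm]

end HolFun

/-! ### Calculus of holomorphic vector-valued one-forms -/

section HolForm

variable {C : Type*} [TopologicalSpace C] [ChartedSpace ℂ C] [IsManifold 𝓘(ℂ, ℂ) ω C]
variable {V W : Type*} [AddCommGroup V] [Module ℂ V] [AddCommGroup W] [Module ℂ W]

theorem HolForm.linear {U : Set C} {η : OneForm C V} (h : HolForm U η) (T : V →ₗ[ℂ] W) :
    HolForm U (fun p => T ∘ₗ η p) := fun φ => h (φ ∘ₗ T)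

theorem HolForm.mono {U U' : Set C} {η : OneForm C V} (h : HolForm U η) (hU : U' ⊆ U) :
    HolForm U' η := fun φ => (h φ).mono hU

theorem HolForm.congr {U : Set C} {η θ : OneForm C V} (h : HolForm U η)
    (e : ∀ p ∈ U, θ p = η p) : HolForm U θ := fun φ => (h φ).congr fun p hp => by rw [e p hp]

theorem HolForm.of_local {U : Set C} {η : OneForm C V}
    (h : ∀ p ∈ U, ∃ O : Set C, IsOpen O ∧ p ∈ O ∧ ∃ θ : OneForm C V, HolForm O θ ∧
      ∀ q ∈ O, q ∈ U → η q = θ q) : HolForm U η := by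
  intro φ p hp
  obtain ⟨O, hO, hpO, g, hg, e⟩ := h p hp
  have h1 := ((hg φ p hpO).mdifferentiableAt (hO.mem_nhds hpO)).mdifferentiableWithinAt (s := U)
  refine h1.congr_of_eventuallyEq ?_ (by rw [e p hpO hp])
  filter_upwards [self_mem_nhdsWithin, mem_nhdsWithin_of_mem_nhds (hO.mem_nhds hpO)] with q h1 h2
  rw [e q h2 h1]

theorem HolForm.add {U : Set C} {η θ : OneForm C V} (h : HolForm U η) (h' : HolForm U θ) :
    HolForm U (fun p => η p + θ p) := by
  intro φ
  have e : ∀ p, toCotangent (φ ∘ₗ (η p + θ p)) =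
      toCotangent (φ ∘ₗ η p) + toCotangent (φ ∘ₗ θ p) := by
    intro p
    ext
    exact map_add φ _ _
  simp only [e]
  exact mdifferentiableOn_add_section (h φ) (h' φ)

theorem HolForm.zero (U : Set C) : HolForm U (fun _ => 0 : OneForm C V) := by
  intro φ
  have e : ∀ p : C, toCotangent (φ ∘ₗ (0 : TangentSpace 𝓘(ℂ, ℂ) p →ₗ[ℂ] V)) = 0 := by
    intro p
    ext
    exact map_zero φ
  simp only [e]
  exact ((Bundle.contMDiff_zeroSection ℂ (n := 1) _).mdifferentiable one_ne_zero).mdifferentiableOn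

theorem HolForm.neg {U : Set C} {η : OneForm C V} (h : HolForm U η) :
    HolForm U (fun p => -η p) := by
  have := h.linear (-LinearMap.id)
  refine this.congr fun p _ => ?_
  refine LinearMap.ext fun v => ?_
  simp

theorem HolForm.sub {U : Set C} {η θ : OneForm C V} (h : HolForm U η) (h' : HolForm U θ) :
    HolForm U (fun p => η p - θ p) := by
  simpa only [sub_eq_add_neg] using h.add h'.neg

theorem HolForm.sum {ι : Type*} (s : Finset ι) {U : Set C} {f : ι → OneForm C V}
    (hf : ∀ i ∈ s, HolForm U (f i)) : HolForm U (fun p => ∑ i ∈ s, f i p) := by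
  classical
  induction s using Finset.induction_on with
  | empty => simpa using HolForm.zero U
  | insert i s hi ih =>
    simp only [Finset.sum_insert hi]
    exact (hf i (Finset.mem_insert_self i s)).add
      (ih fun j hj => hf j (Finset.mem_insert_of_mem hj))

theorem HolForm.smulFun {U : Set C} {f : C → ℂ} {η : OneForm C V} (hf : HolFun U f)
    (h : HolForm U η) : HolForm U (fun p => f p • η p) := by
  intro φ
  have e : ∀ p, toCotangent (φ ∘ₗ (f p • η p)) = f p • toCotangent (φ ∘ₗ η p) := by
    intro p
    ext
    exact map_smul φ _ _
  simp only [e]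
  exact (hf LinearMap.id).smul_section (h φ)

section Mul

variable {R : Type*} [Ring R] [Algebra ℂ R] [Module.Finite ℂ R]

theorem HolForm.mulLeft {U : Set C} {f : C → R} {η : OneForm C R} (hf : HolFun U f)
    (h : HolForm U η) : HolForm U (fun p => LinearMap.mulLeft ℂ (f p) ∘ₗ η p) := by
  let b := Module.finBasis ℂ R
  have e : (fun p => LinearMap.mulLeft ℂ (f p) ∘ₗ η p : OneForm C R) =
      fun p => ∑ i, b.coord i (f p) • (LinearMap.mulLeft ℂ (b i) ∘ₗ η p) := by
    funext p
    refine LinearMap.ext fun v => ?_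
    simp only [LinearMap.comp_apply, LinearMap.mulLeft_apply, LinearMap.sum_apply,
      LinearMap.smul_apply]
    conv_lhs => rw [← b.sum_repr (f p), Finset.sum_mul]
    refine Finset.sum_congr rfl fun i _ => ?_
    rw [smul_mul_assoc]
    rfl
  rw [e]
  exact HolForm.sum _ fun i _ => HolForm.smulFun (hf.linear (b.coord i)) (h.linear _)

theorem HolForm.mulRight {U : Set C} {f : C → R} {η : OneForm C R} (hf : HolFun U f)
    (h : HolForm U η) : HolForm U (fun p => LinearMap.mulRight ℂ (f p) ∘ₗ η p) := by
  let b := Module.finBasis ℂ R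
  have e : (fun p => LinearMap.mulRight ℂ (f p) ∘ₗ η p : OneForm C R) =
      fun p => ∑ i, b.coord i (f p) • (LinearMap.mulRight ℂ (b i) ∘ₗ η p) := by
    funext p
    refine LinearMap.ext fun v => ?_
    simp only [LinearMap.comp_apply, LinearMap.mulRight_apply, LinearMap.sum_apply,
      LinearMap.smul_apply]
    conv_lhs => rw [← b.sum_repr (f p), Finset.mul_sum]
    refine Finset.sum_congr rfl fun i _ => ?_
    rw [mul_smul_comm]
    rfl
  rw [e]
  exact HolForm.sum _ fun i _ => HolForm.smulFun (hf.linear (b.coord i)) (h.linear _)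

end Mul

variable {N : ℕ}

theorem HolForm.matForm {U : Set C} {a d c e : OneForm C (Grassmann N)} (ha : HolForm U a)
    (hd : HolForm U d) (hc : HolForm U c) (he : HolForm U e) : HolForm U (matForm a d c e) :=
  ((ha.linear _).add (hd.linear _)).add ((hc.linear _).add (he.linear _))

end HolForm

/-! ### Solution of the `∂̄`-equation in the plane -/

section Cauchy

open MeasureTheory Complex Set Filter Topology

/-- The Cauchy–Pompeiu formula at the origin for compactly supported functions. -/
theorem integral_inv_mul_dbar {g : ℂ → ℂ} (hg : ContDiff ℝ 1 g) (hc : HasCompactSupport g) :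
    ∫ ζ : ℂ, ζ⁻¹ * (fderiv ℝ g ζ 1 + I * fderiv ℝ g ζ I) = -(2 * Real.pi * g 0) := by
  obtain ⟨R, hR⟩ := (hc.fderiv ℝ).isCompact.isBounded.subset_closedBall 0
  obtain ⟨R', hR'⟩ := hc.isCompact.isBounded.subset_closedBall 0
  have hD : ∀ ζ : ℂ, R < ‖ζ‖ → fderiv ℝ g ζ = 0 := fun ζ hζ =>
    image_eq_zero_of_notMem_tsupport fun h => by simpa using (hζ.trans_le (by simpa using hR h) : R < R)
  have hg0 : ∀ ζ : ℂ, R' < ‖ζ‖ → g ζ = 0 := fun ζ hζ =>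
    image_eq_zero_of_notMem_tsupport fun h => by simpa using (hζ.trans_le (by simpa using hR' h) : R' < R')
  have hcD : Continuous (fderiv ℝ g) := hg.continuous_fderiv one_ne_zero
  let e : ℝ → ℂ := fun θ => Real.cos θ + Real.sin θ * I
  have he : Continuous e := by fun_prop
  have hne : ∀ θ, ‖e θ‖ = 1 := fun θ => by
    have : e θ = exp (θ * I) := by simp [e, exp_mul_I]
    rw [this, norm_exp_ofReal_mul_I]
  -- In polar coordinates `∂₁ + i ∂₂ = e^{iθ} (∂ᵣ + (i / r) ∂_θ)`. Here `A` is the radial derivative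
  -- and `B` is `1 / r` times the angular derivative; the kernel `ζ⁻¹` and the Jacobian `r` cancel
  -- `e^{iθ}`, so that the integrand becomes `A + i B`.
  let A : ℝ × ℝ → ℂ := fun p => fderiv ℝ g (p.1 * e p.2) (e p.2)
  let B : ℝ × ℝ → ℂ := fun p => fderiv ℝ g (p.1 * e p.2) (I * e p.2)
  have hAc : Continuous A := by
    have h1 : Continuous fun p : ℝ × ℝ => fderiv ℝ g (p.1 * e p.2) := by fun_prop
    exact h1.clm_apply (by fun_prop)
  have hBc : Continuous B := by
    have h1 : Continuous fun p : ℝ × ℝ => fderiv ℝ g (p.1 * e p.2) := by fun_prop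
    exact h1.clm_apply (by fun_prop)
  have hint : ∀ F : ℝ × ℝ → ℂ, Continuous F → (∀ p : ℝ × ℝ, R < p.1 → 0 < p.1 → F p = 0) →
      IntegrableOn F (Ioi 0 ×ˢ Ioo (-Real.pi) Real.pi) := by
    intro F hF h0
    refine IntegrableOn.of_forall_sdiff_eq_zero (s := Icc 0 R ×ˢ Icc (-Real.pi) Real.pi)
      (hF.continuousOn.integrableOn_compact (isCompact_Icc.prod isCompact_Icc))
      (measurableSet_Ioi.prod measurableSet_Ioo) ?_
    rintro ⟨r, θ⟩ ⟨⟨h1, h2⟩, h3⟩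
    refine h0 _ ?_ h1
    by_contra h
    exact h3 ⟨⟨le_of_lt h1, not_lt.1 h⟩, ⟨h2.1.le, h2.2.le⟩⟩
  have hz : ∀ p : ℝ × ℝ, R < p.1 → 0 < p.1 → fderiv ℝ g (p.1 * e p.2) = 0 := by
    intro p h1 h2
    apply hD
    rwa [norm_mul, hne, mul_one, norm_real, Real.norm_of_nonneg h2.le]
  have hA := hint A hAc fun p h1 h2 => by simp [A, hz p h1 h2]
  have hB := hint B hBc fun p h1 h2 => by simp [B, hz p h1 h2]
  have hAi : ∫ p in Ioi 0 ×ˢ Ioo (-Real.pi) Real.pi, A p = -(2 * Real.pi * g 0) := by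
    have hsw := setIntegral_prod_swap (μ := volume) (ν := volume) (Ioi (0 : ℝ))
      (Ioo (-Real.pi) Real.pi) A
    change _ = ∫ p in Ioi 0 ×ˢ Ioo (-Real.pi) Real.pi, A p ∂(volume.prod volume) at hsw
    change ∫ p in Ioi 0 ×ˢ Ioo (-Real.pi) Real.pi, A p ∂(volume.prod volume) = _
    rw [← hsw, setIntegral_prod]
    -- With the radial integral inside, the fundamental theorem of calculus gives the same value for
    -- every angle.
    · have h1 : ∀ θ : ℝ, ∫ r in Ioi (0 : ℝ), A (Prod.swap (θ, r)) = -g 0 := by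
        intro θ
        have hd : ∀ r : ℝ, HasDerivAt (fun r : ℝ => g (r * e θ)) (A (r, θ)) r := by
          intro r
          have h2 : HasDerivAt (fun r : ℝ => (r : ℂ) * e θ) (e θ) r := by
            simpa using (hasDerivAt_id r).ofReal_comp.mul_const (e θ)
          exact ((hg.differentiable one_ne_zero _).hasFDerivAt).comp_hasDerivAt r h2
        have h3 : ContDiff ℝ 1 fun r : ℝ => g (r * e θ) :=
          hg.comp (ofRealCLM.contDiff.mul contDiff_const)
        have h4 : HasCompactSupport fun r : ℝ => g (r * e θ) := by
          refine HasCompactSupport.intro (isCompact_Icc (a := -R') (b := R')) fun r hr => ?_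
          apply hg0
          rw [norm_mul, hne, mul_one, norm_real, Real.norm_eq_abs]
          by_contra h
          exact hr (abs_le.1 (not_lt.1 h))
        have h5 := h4.integral_Ioi_deriv_eq h3 0
        simp only [fun r => (hd r).deriv, ofReal_zero, zero_mul] at h5
        exact h5
      simp only [h1]
      rw [setIntegral_const, Real.volume_real_Ioo_of_le (by linarith [Real.pi_pos])]
      simp only [sub_neg_eq_add, real_smul, ofReal_add]
      ring
    · exact hA.swap
  have hBi : ∫ p in Ioi 0 ×ˢ Ioo (-Real.pi) Real.pi, B p = 0 := by
    change ∫ p in Ioi 0 ×ˢ Ioo (-Real.pi) Real.pi, B p ∂(volume.prod volume) = _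
    rw [setIntegral_prod _ hB]
    -- For fixed `r > 0` the function `B` is the `θ`-derivative of `r⁻¹ g(r e^{iθ})`, which has
    -- equal values at `-π` and `π`.
    refine setIntegral_eq_zero_of_forall_eq_zero fun r hr => ?_
    have hr' : (r : ℂ) ≠ 0 := ofReal_ne_zero.2 (ne_of_gt hr)
    have hd : ∀ θ : ℝ, HasDerivAt (fun θ : ℝ => (r : ℂ)⁻¹ * g (r * e θ)) (B (r, θ)) θ := by
      intro θ
      have h2 : HasDerivAt (fun θ : ℝ => (r : ℂ) * e θ) (r * (I * e θ)) θ := by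
        have h3 : HasDerivAt e (-Real.sin θ + Real.cos θ * I) θ := by
          have := (Real.hasDerivAt_cos θ).ofReal_comp.add
            ((Real.hasDerivAt_sin θ).ofReal_comp.mul_const I)
          rw [ofReal_neg] at this
          exact this
        have h4 : I * e θ = -Real.sin θ + Real.cos θ * I := by
          simp only [e]; ring_nf; rw [I_sq]; ring
        rw [h4]
        exact h3.const_mul (r : ℂ)
      have h5 := (((hg.differentiable one_ne_zero (r * e θ)).hasFDerivAt).comp_hasDerivAt θ
        h2).const_mul (r : ℂ)⁻¹
      have h6 : (r : ℂ)⁻¹ * fderiv ℝ g (r * e θ) (r * (I * e θ)) = B (r, θ) := by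
        rw [← real_smul (x := r) (z := I * e θ), map_smul, real_smul, ← mul_assoc, inv_mul_cancel₀ hr', one_mul]
      rw [h6] at h5
      exact h5
    rw [← integral_Ioc_eq_integral_Ioo, ← intervalIntegral.integral_of_le (by linarith [Real.pi_pos]),
      intervalIntegral.integral_eq_sub_of_hasDerivAt (fun θ _ => hd θ)
        ((hBc.comp (by fun_prop : Continuous fun θ : ℝ => (r, θ))).intervalIntegrable _ _)]
    simp [e]
  rw [← Complex.integral_comp_polarCoord_symm]
  change ∫ p in Ioi (0 : ℝ) ×ˢ Ioo (-Real.pi) Real.pi, _ = _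
  calc _ = ∫ p in Ioi 0 ×ˢ Ioo (-Real.pi) Real.pi, (A p + I * B p) := by
        refine setIntegral_congr_fun (measurableSet_Ioi.prod measurableSet_Ioo) ?_
        rintro ⟨r, θ⟩ ⟨hr, -⟩
        have hr' : (r : ℂ) ≠ 0 := ofReal_ne_zero.2 (ne_of_gt hr)
        have he0 : e θ ≠ 0 := norm_ne_zero_iff.1 (by rw [hne]; exact one_ne_zero)
        have hp : Complex.polarCoord.symm (r, θ) = r * e θ := by
          rw [Complex.polarCoord_symm_apply]
        simp only [hp, A, B]
        set L := fderiv ℝ g (r * e θ)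
        have h1 : L (e θ) = Real.cos θ * L 1 + Real.sin θ * L I := by
          have : e θ = Real.cos θ • (1 : ℂ) + Real.sin θ • I := by simp [e]
          rw [this, map_add, map_smul, map_smul]; simp
        have h2 : L (I * e θ) = -Real.sin θ * L 1 + Real.cos θ * L I := by
          have : I * e θ = (-Real.sin θ) • (1 : ℂ) + Real.cos θ • I := by
            simp only [e, real_smul]; push_cast; ring_nf; rw [I_sq]; ring
          rw [this, map_add, map_smul, map_smul]; simp
        have h3 : e θ * (L (e θ) + I * L (I * e θ)) = e θ * ((e θ)⁻¹ * (L 1 + I * L I)) := by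
          have hcs : (Real.cos θ : ℂ) ^ 2 + (Real.sin θ : ℂ) ^ 2 = 1 := by
            exact_mod_cast Real.cos_sq_add_sin_sq θ
          rw [mul_inv_cancel_left₀ he0, h1, h2]
          simp only [e]
          linear_combination (L 1 + I * L I) * hcs +
            (-(Real.sin θ : ℂ) ^ 2 * L 1 + Real.sin θ * Real.cos θ * L I) * I_sq
        rw [mul_left_cancel₀ he0 h3, real_smul, mul_inv]
        field_simp
    _ = _ := by
        rw [integral_add hA (hB.const_mul I), integral_const_mul, hAi, hBi, mul_zero, add_zero]

/-- Every compactly supported function is the `∂̄`-derivative of its Cauchy transform. -/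
theorem exists_dbar_eq {h : ℂ → ℂ} (hh : ContDiff ℝ 1 h) (hc : HasCompactSupport h) :
    ∃ w : ℂ → ℂ, Differentiable ℝ w ∧ ∀ z, fderiv ℝ w z 1 + I * fderiv ℝ w z I = h z := by
  -- The operator `∂₁ + i ∂₂` is `2 ∂̄`, whence `1 / (2 π ζ)` in place of `1 / (π ζ)`.
  let k : ℂ → ℂ := fun ζ => (2 * Real.pi : ℂ)⁻¹ * ζ⁻¹
  have hk : LocallyIntegrable k := by
    have h1 : LocallyIntegrable (fun ζ : ℂ => ζ⁻¹) := by
      refine locallyIntegrable_of_norm_le_rpow (C := 1) (α := 1) (by simp [Complex.finrank_real_complex])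
        (by simp [Complex.finrank_real_complex]) (Eventually.of_forall fun x => ?_)
        measurable_inv.aestronglyMeasurable
      rw [norm_inv, Real.rpow_neg_one, one_mul]
    exact h1.smul ((2 * Real.pi : ℂ)⁻¹)
  let L := ContinuousLinearMap.mul ℝ ℂ
  have hw := fun z => hc.hasFDerivAt_convolution_right L hk hh z
  have hval : ∀ z v, (MeasureTheory.convolution k (fderiv ℝ h) (L.precompR ℂ) volume) z v =
      ∫ ζ, k ζ * fderiv ℝ h (z - ζ) v := fun z v => by
    rw [convolution_precompR_apply L hk (hc.fderiv ℝ) (hh.continuous_fderiv one_ne_zero)]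
    rfl
  have hint : ∀ z v, Integrable fun ζ => k ζ * fderiv ℝ h (z - ζ) v := by
    intro z v
    have h1 : HasCompactSupport fun ζ => fderiv ℝ h ζ v :=
      (hc.fderiv ℝ).comp_left (g := fun T : ℂ →L[ℝ] ℂ => T v) rfl
    exact h1.convolutionExists_right L hk
      ((hh.continuous_fderiv one_ne_zero).clm_apply continuous_const) z
  refine ⟨_, fun z => (hw z).differentiableAt, fun z => ?_⟩
  rw [(hw z).fderiv, hval, hval, ← integral_const_mul, ← integral_add (hint z 1)
    ((hint z I).const_mul I)]
  -- The reflection about `z` turns the convolution at `z` into the formula at the origin; its sign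
  -- is the one in `integral_inv_mul_dbar`.
  let g : ℂ → ℂ := fun ζ => h (z - ζ)
  have hg : ContDiff ℝ 1 g := hh.comp (contDiff_const.sub contDiff_id)
  have hgc : HasCompactSupport g := hc.comp_homeomorph (Homeomorph.subLeft z)
  have hd : ∀ ζ v, fderiv ℝ g ζ v = -fderiv ℝ h (z - ζ) v := by
    intro ζ v
    have h1 : HasFDerivAt (fun ζ : ℂ => z - ζ) (-ContinuousLinearMap.id ℝ ℂ) ζ := by
      simpa using (hasFDerivAt_id ζ).const_sub z
    have h2 := (hh.differentiable one_ne_zero (z - ζ)).hasFDerivAt.comp ζ h1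
    have h3 : fderiv ℝ g ζ = _ := h2.fderiv
    rw [h3]
    simp
  have key := integral_inv_mul_dbar hg hgc
  have e : (fun ζ => k ζ * fderiv ℝ h (z - ζ) 1 + I * (k ζ * fderiv ℝ h (z - ζ) I)) =
      fun ζ => (-(2 * Real.pi : ℂ)⁻¹) * (ζ⁻¹ * (fderiv ℝ g ζ 1 + I * fderiv ℝ g ζ I)) := by
    funext ζ
    rw [hd, hd]
    simp only [k]
    ring
  rw [e, integral_const_mul, key]
  have : (2 * Real.pi : ℂ) ≠ 0 := by
    simp [Real.pi_ne_zero]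
  simp only [g, sub_zero]
  field_simp

/-- Local solvability of `∂̄ w = (∂̄ u) v`: the function `w - u * v z` is complex differentiable at
`z`. -/
theorem exists_dbar_product {u v : ℂ → ℂ} {z₀ : ℂ} (hu : ContDiffAt ℝ ∞ u z₀)
    (hv : ContDiffAt ℝ ∞ v z₀) :
    ∃ w : ℂ → ℂ, ∀ᶠ z in 𝓝 z₀, DifferentiableAt ℂ (fun ζ => w ζ - u ζ * v z) z := by
  have hu2 : ∀ᶠ z in 𝓝 z₀, ContDiffAt ℝ 2 u z :=
    (hu.of_le (WithTop.coe_le_coe.2 le_top) : ContDiffAt ℝ 2 u z₀).eventually (by simp)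
  have hv2 : ∀ᶠ z in 𝓝 z₀, ContDiffAt ℝ 1 v z :=
    (hv.of_le (mod_cast le_top) : ContDiffAt ℝ 1 v z₀).eventually (by simp)
  obtain ⟨ε, hε, hball⟩ := Metric.eventually_nhds_iff_ball.1 (hu2.and hv2)
  -- The cut-off makes the right-hand side compactly supported on the whole plane. It is `1` only on
  -- the ball of radius `ε / 4`, which is where the solution is used.
  let χ : ContDiffBump z₀ := ⟨ε / 4, ε / 2, by positivity, by linarith⟩
  let h : ℂ → ℂ := fun z => (χ z : ℂ) * ((fderiv ℝ u z 1 + I * fderiv ℝ u z I) * v z)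
  have hsupp : tsupport (fun z => (χ z : ℂ)) ⊆ Metric.closedBall z₀ (ε / 2) := by
    refine (tsupport_comp_subset (g := fun x : ℝ => (x : ℂ)) rfl χ).trans ?_
    rw [χ.tsupport_eq]
  have hh : ContDiff ℝ 1 h := by
    rw [contDiff_iff_contDiffAt]
    intro z
    by_cases hz : z ∈ Metric.ball z₀ ε
    · obtain ⟨h1, h2⟩ := hball z hz
      have h3 : ContDiffAt ℝ 1 (fderiv ℝ u) z := h1.fderiv_right (by norm_num)
      exact (ofRealCLM.contDiff.contDiffAt.comp z χ.contDiffAt).mul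
        (((h3.clm_apply contDiffAt_const).add (contDiffAt_const.mul
          (h3.clm_apply contDiffAt_const))).mul h2)
    · have h1 : z ∉ tsupport (fun z => (χ z : ℂ)) := fun h' => hz
        (Metric.closedBall_subset_ball (by linarith) (hsupp h'))
      have h2 : h =ᶠ[𝓝 z] fun _ => 0 := by
        filter_upwards [notMem_tsupport_iff_eventuallyEq.1 h1] with y hy
        simp only [h, hy, Pi.zero_apply, zero_mul]
      exact contDiffAt_const.congr_of_eventuallyEq h2
  have hc : HasCompactSupport h := by
    have : HasCompactSupport fun z => (χ z : ℂ) := χ.hasCompactSupport.comp_left (g := fun x : ℝ => (x : ℂ)) rfl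
    exact this.mul_right
  obtain ⟨w, hw, hw'⟩ := exists_dbar_eq hh hc
  refine ⟨w, ?_⟩
  filter_upwards [Metric.ball_mem_nhds z₀ (show 0 < ε / 4 by positivity)] with z hz
  have h1 := (hball z (Metric.ball_subset_ball (by linarith) hz)).1
  have hud : DifferentiableAt ℝ u z := h1.differentiableAt (by norm_num)
  have hχ : χ z = 1 := χ.one_of_mem_closedBall (Metric.ball_subset_closedBall hz)
  have h2 := hw' z
  simp only [h, hχ, ofReal_one, one_mul] at h2
  -- With the value `v z` frozen, the equation for `w` is the Cauchy–Riemann equation at the single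
  -- point `z`.
  rw [differentiableAt_complex_iff_differentiableAt_real]
  have hd : HasFDerivAt (fun ζ => w ζ - u ζ * v z) (fderiv ℝ w z - (v z) • fderiv ℝ u z) z := by
    exact (hw z).hasFDerivAt.sub (hud.hasFDerivAt.mul_const (v z))
  refine ⟨hd.differentiableAt, ?_⟩
  rw [hd.fderiv]
  simp only [sub_apply, smul_apply, smul_eq_mul]
  linear_combination (-I) * h2 + (fderiv ℝ w z I - v z * fderiv ℝ u z I) * I_sq

end Cauchy

/-! ### Smooth and holomorphic functions on the surface -/

section RealStructure

open Filter Topology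

variable {C : Type*} [TopologicalSpace C] [ChartedSpace ℂ C] [IsManifold 𝓘(ℂ, ℂ) ω C]

variable (C) in
/-- The smooth surface underlying a Riemann surface. -/
theorem isManifold_real : IsManifold 𝓘(ℝ, ℂ) ∞ C := by
  refine isManifold_of_contDiffOn _ _ _ fun e e' he he' => ?_
  have h := (contDiffGroupoid ω 𝓘(ℂ, ℂ)).compatible he he'
  have h1 := (mem_groupoid_of_pregroupoid.1 h).1
  simp only [contDiffPregroupoid, mfld_simps] at h1 ⊢
  exact (h1.restrict_scalars ℝ).of_le le_top

/-- The chart belongs to a point `x` that may differ from `p`, so that one chart serves all points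
near `x`. -/
theorem mdifferentiableAt_iff_chart {f : C → ℂ} {x p : C} (hp : p ∈ (chartAt ℂ x).source) :
    MDifferentiableAt 𝓘(ℂ, ℂ) 𝓘(ℂ, ℂ) f p ↔
      DifferentiableAt ℂ (f ∘ (chartAt ℂ x).symm) (chartAt ℂ x p) := by
  have : IsManifold 𝓘(ℂ, ℂ) 1 C := IsManifold.of_le (n := ω) le_top
  rw [mdifferentiableAt_iff_source_of_mem_source hp]
  simp only [mfld_simps, mdifferentiableWithinAt_univ, mdifferentiableAt_iff_differentiableAt]

theorem contMDiffAt_iff_chart {C : Type*} [TopologicalSpace C] [ChartedSpace ℂ C] {f : C → ℂ}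
    {p : C} :
    ContMDiffAt 𝓘(ℝ, ℂ) 𝓘(ℝ, ℂ) ∞ f p ↔
      ContDiffAt ℝ ∞ (f ∘ (chartAt ℂ p).symm) (chartAt ℂ p p) := by
  rw [contMDiffAt_iff_source]
  simp only [mfld_simps, contMDiffWithinAt_univ, contMDiffAt_iff_contDiffAt]

/-- Complex differentiability on a neighbourhood gives analyticity in a chart, hence smoothness in
the real sense. -/
theorem contMDiffAt_of_mdifferentiable {f : C → ℂ} {p : C}
    (h : ∀ᶠ q in 𝓝 p, MDifferentiableAt 𝓘(ℂ, ℂ) 𝓘(ℂ, ℂ) f q) :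
    ContMDiffAt 𝓘(ℝ, ℂ) 𝓘(ℝ, ℂ) ∞ f p := by
  rw [contMDiffAt_iff_chart]
  set χ := chartAt ℂ p with hχ
  have hp : p ∈ χ.source := mem_chart_source ℂ p
  have h1 : ∀ᶠ z in 𝓝 (χ p), DifferentiableAt ℂ (f ∘ χ.symm) z := by
    have h2 : Tendsto χ.symm (𝓝 (χ p)) (𝓝 p) := by
      have := χ.continuousAt_symm (χ.map_source hp)
      rwa [ContinuousAt, χ.left_inv hp] at this
    filter_upwards [h2.eventually h, χ.open_target.mem_nhds (χ.map_source hp)] with z hz hzt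
    have := (mdifferentiableAt_iff_chart (x := p) (χ.map_target hzt)).1 hz
    rwa [← hχ, χ.right_inv hzt] at this
  have h3 : AnalyticAt ℂ (f ∘ χ.symm) (χ p) := Complex.analyticAt_iff_eventually_differentiableAt.2 h1
  exact (h3.contDiffAt (n := ∞)).restrict_scalars ℝ

theorem exists_dbar_product_surface {u v : C → ℂ} {x : C}
    (hu : ContMDiffAt 𝓘(ℝ, ℂ) 𝓘(ℝ, ℂ) ∞ u x) (hv : ContMDiffAt 𝓘(ℝ, ℂ) 𝓘(ℝ, ℂ) ∞ v x) :
    ∃ w : C → ℂ, ∀ᶠ p in 𝓝 x,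
      MDifferentiableAt 𝓘(ℂ, ℂ) 𝓘(ℂ, ℂ) (fun q => w q - u q * v p) p := by
  set χ := chartAt ℂ x with hχ
  have hx : x ∈ χ.source := mem_chart_source ℂ x
  obtain ⟨w, hw⟩ := exists_dbar_product (contMDiffAt_iff_chart.1 hu) (contMDiffAt_iff_chart.1 hv)
  refine ⟨w ∘ χ, ?_⟩
  filter_upwards [(χ.continuousAt hx).eventually hw, χ.open_source.mem_nhds hx] with p hp hps
  rw [mdifferentiableAt_iff_chart hps, ← hχ]
  refine hp.congr_of_eventuallyEq ?_
  filter_upwards [χ.open_target.mem_nhds (χ.map_source hps)] with z hz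
  simp only [Function.comp_apply, χ.right_inv hz, ← hχ, χ.left_inv hps]

/-- The product of a continuous function with a holomorphic function vanishing at `p` is complex
differentiable at `p`. -/
theorem mdifferentiableAt_mul_of_eq_zero {u g : C → ℂ} {p : C} (hu : ContinuousAt u p)
    (hg : MDifferentiableAt 𝓘(ℂ, ℂ) 𝓘(ℂ, ℂ) g p) (h0 : g p = 0) :
    MDifferentiableAt 𝓘(ℂ, ℂ) 𝓘(ℂ, ℂ) (fun q => u q * g q) p := by
  set χ := chartAt ℂ p with hχ
  have hp : p ∈ χ.source := mem_chart_source ℂ p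
  rw [mdifferentiableAt_iff_chart hp, ← hχ] at hg ⊢
  have hs : ContinuousAt χ.symm (χ p) := χ.continuousAt_symm (χ.map_source hp)
  have hu' : ContinuousAt (u ∘ χ.symm) (χ p) :=
    ContinuousAt.comp (by rwa [χ.left_inv hp]) hs
  have h0' : (g ∘ χ.symm) (χ p) = 0 := by simp [χ.left_inv hp, h0]
  have hd := hg.hasDerivAt
  refine HasDerivAt.differentiableAt (f' := (u ∘ χ.symm) (χ p) * deriv (g ∘ χ.symm) (χ p)) ?_
  -- As `g p = 0`, the difference quotient of `u * g` at `p` is `u` times that of `g`, so continuity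
  -- of `u` suffices.
  rw [hasDerivAt_iff_tendsto_slope] at hd ⊢
  refine ((hu'.tendsto.mono_left nhdsWithin_le_nhds).mul hd).congr fun z => ?_
  simp only [slope_def_field, h0', Function.comp_apply, χ.left_inv hp, h0]
  ring

end RealStructure

/-! ### The exponential of nilpotent even elements -/

section Nilpotent

variable {N : ℕ}

variable (N) in
/-- The span of the products of two odd elements. -/
def oddSq : Submodule ℂ (Grassmann N) := parityPart N 1 * parityPart N 1

theorem mul_mem_oddSq {a b : Grassmann N} (ha : a ∈ parityPart N 1) (hb : b ∈ parityPart N 1) :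
    a * b ∈ oddSq N := Submodule.mul_mem_mul ha hb

theorem oddSq_even {x : Grassmann N} (hx : x ∈ oddSq N) : x ∈ parityPart N 0 := by
  induction hx using Submodule.mul_induction_on' with
  | mem_mul_mem a ha b hb => exact odd_mul_odd ha hb
  | add x _ y _ hx hy => exact add_mem hx hy

/-- Products of two odd elements have square zero and are central, so their sums are nilpotent. The
full even part would not do, as it contains the constants. -/
theorem oddSq_isNilpotent {x : Grassmann N} (hx : x ∈ oddSq N) : IsNilpotent x := by
  induction hx using Submodule.mul_induction_on' with
  | mem_mul_mem a ha b hb => exact ⟨2, by rw [sq, odd_mul_odd_sq ha hb]⟩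
  | add x hx' y _ hx hy => exact (commute_even (oddSq_even hx') y).isNilpotent_add hx hy

/-- A single exponent for all elements makes the exponential one fixed polynomial, which therefore
preserves holomorphy. It exists because the kernels of the powers of a left multiplication are
exhausted within the dimension. -/
theorem oddSq_pow (N : ℕ) : ∃ K : ℕ, ∀ x ∈ oddSq N, x ^ K = 0 := by
  refine ⟨Module.finrank ℂ (Grassmann N), fun x hx => ?_⟩
  obtain ⟨n, hn⟩ := oddSq_isNilpotent hx
  have h1 : (LinearMap.mulLeft ℂ x) ^ n = 0 := by
    rw [LinearMap.pow_mulLeft, hn, LinearMap.mulLeft_zero_eq_zero]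
  have h2 : (LinearMap.mulLeft ℂ x) ^ Module.finrank ℂ (Grassmann N) = 0 := by
    have := Module.End.ker_pow_le_ker_pow_finrank (LinearMap.mulLeft ℂ x) n
    rw [h1, LinearMap.ker_zero, top_le_iff, LinearMap.ker_eq_top] at this
    exact this
  rw [LinearMap.pow_mulLeft] at h2
  simpa using LinearMap.congr_fun h2 1

/-- The exponential function on nilpotent even elements. -/
theorem exists_exp (N : ℕ) : ∃ E : Grassmann N → Grassmann N,
    (∀ x ∈ oddSq N, ∀ y ∈ oddSq N, E (x + y) = E x * E y) ∧ E 0 = 1 ∧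
    (∀ x ∈ oddSq N, x * x * x = 0 → E x = expE x) ∧
    ∃ (c : ℕ → ℂ) (K : ℕ), ∀ x ∈ oddSq N, E x = ∑ k ∈ Finset.range K, c k • x ^ k := by
  obtain ⟨K, hK⟩ := oddSq_pow N
  refine ⟨IsNilpotent.exp, fun x hx y hy => IsNilpotent.exp_add_of_commute
    (commute_even (oddSq_even hx) y) (oddSq_isNilpotent hx) (oddSq_isNilpotent hy), ?_, ?_,
    fun k => ((k.factorial : ℚ)⁻¹ : ℚ), K, fun x hx => ?_⟩
  · rw [IsNilpotent.exp_eq_sum (k := 1) (by simp)]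
    simp
  · intro x _ h
    rw [IsNilpotent.exp_eq_sum (k := 3) (by rw [pow_succ, sq, h])]
    simp only [Finset.sum_range_succ, Finset.sum_range_zero, expE]
    simp only [sq, Nat.factorial, ← Rat.cast_smul_eq_qsmul ℂ]
    simp
  · rw [IsNilpotent.exp_eq_sum (hK x hx)]
    simp only [← Rat.cast_smul_eq_qsmul ℂ]

end Nilpotent

/-! ### Holomorphy and smoothness at a point -/

section Pointwise

open Filter Topology

variable {C : Type*} [TopologicalSpace C] [ChartedSpace ℂ C]
variable {V W : Type*} [AddCommGroup V] [Module ℂ V] [AddCommGroup W] [Module ℂ W]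

/-- Complex differentiability at a point of a function with values in a finite-dimensional space. -/
def HolAt (f : C → V) (p : C) : Prop :=
  ∀ φ : V →ₗ[ℂ] ℂ, MDifferentiableAt 𝓘(ℂ, ℂ) 𝓘(ℂ, ℂ) (fun q => φ (f q)) p

/-- Smoothness at a point, in the real sense, of a function with values in a finite-dimensional
complex vector space. -/
def SmoothAt (f : C → V) (p : C) : Prop :=
  ∀ φ : V →ₗ[ℂ] ℂ, ContMDiffAt 𝓘(ℝ, ℂ) 𝓘(ℝ, ℂ) ∞ (fun q => φ (f q)) p

theorem HolFun.holAt {U : Set C} (hU : IsOpen U) {f : C → V} (hf : HolFun U f) {p : C}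
    (hp : p ∈ U) : HolAt f p := fun φ => (hf φ p hp).mdifferentiableAt (hU.mem_nhds hp)

theorem HolFun.of_holAt {U : Set C} {f : C → V} (h : ∀ p ∈ U, HolAt f p) : HolFun U f :=
  fun φ p hp => (h p hp φ).mdifferentiableWithinAt

theorem HolAt.linear {f : C → V} {p : C} (h : HolAt f p) (T : V →ₗ[ℂ] W) :
    HolAt (fun q => T (f q)) p := fun φ => h (φ ∘ₗ T)

theorem HolAt.congr {f g : C → V} {p : C} (h : HolAt f p) (e : ∀ᶠ q in 𝓝 p, g q = f q) :
    HolAt g p := fun φ => (h φ).congr_of_eventuallyEq (by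
      filter_upwards [e] with q hq
      rw [hq])

theorem HolAt.const (c : V) (p : C) : HolAt (fun _ => c) p := fun _ => mdifferentiableAt_const

theorem HolAt.add {f g : C → V} {p : C} (hf : HolAt f p) (hg : HolAt g p) :
    HolAt (fun q => f q + g q) p := by
  intro φ
  simpa only [map_add] using! (hf φ).add (hg φ)

theorem HolAt.neg {f : C → V} {p : C} (hf : HolAt f p) : HolAt (fun q => -f q) p :=
  hf.linear (-LinearMap.id)

theorem HolAt.sub {f g : C → V} {p : C} (hf : HolAt f p) (hg : HolAt g p) :
    HolAt (fun q => f q - g q) p := by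
  simpa only [sub_eq_add_neg] using hf.add hg.neg

theorem HolAt.sum {ι : Type*} (s : Finset ι) {f : ι → C → V} {p : C}
    (hf : ∀ i ∈ s, HolAt (f i) p) : HolAt (fun q => ∑ i ∈ s, f i q) p := by
  classical
  induction s using Finset.induction_on with
  | empty => simpa using HolAt.const (0 : V) p
  | insert i s hi ih =>
    simp only [Finset.sum_insert hi]
    exact (hf i (Finset.mem_insert_self i s)).add
      (ih fun j hj => hf j (Finset.mem_insert_of_mem hj))

theorem SmoothAt.add {f g : C → V} {p : C} (hf : SmoothAt f p) (hg : SmoothAt g p) :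
    SmoothAt (fun q => f q + g q) p := by
  intro φ
  simpa only [map_add] using! (hf φ).add (hg φ)

theorem SmoothAt.const (c : V) (p : C) : SmoothAt (fun _ => c) p := fun _ => contMDiffAt_const

theorem SmoothAt.sum {ι : Type*} (s : Finset ι) {f : ι → C → V} {p : C}
    (hf : ∀ i ∈ s, SmoothAt (f i) p) : SmoothAt (fun q => ∑ i ∈ s, f i q) p := by
  classical
  induction s using Finset.induction_on with
  | empty => simpa using SmoothAt.const (0 : V) p
  | insert i s hi ih =>
    simp only [Finset.sum_insert hi]
    exact (hf i (Finset.mem_insert_self i s)).add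
      (ih fun j hj => hf j (Finset.mem_insert_of_mem hj))

theorem SmoothAt.smul {χ : C → ℂ} {f : C → V} {p : C}
    (hχ : ContMDiffAt 𝓘(ℝ, ℂ) 𝓘(ℝ, ℂ) ∞ χ p) (hf : SmoothAt f p) :
    SmoothAt (fun q => χ q • f q) p := by
  intro φ
  simp only [map_smul, smul_eq_mul]
  exact contMDiffAt_iff_chart.2 ((contMDiffAt_iff_chart.1 hχ).mul (contMDiffAt_iff_chart.1 (hf φ)))

theorem SmoothAt.congr {f g : C → V} {p : C} (h : SmoothAt f p) (e : ∀ᶠ q in 𝓝 p, g q = f q) :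
    SmoothAt g p := fun φ => (h φ).congr_of_eventuallyEq (by
      filter_upwards [e] with q hq
      rw [hq])

variable [IsManifold 𝓘(ℂ, ℂ) ω C]

theorem HolFun.smoothAt {U : Set C} (hU : IsOpen U) {f : C → V} (hf : HolFun U f) {p : C}
    (hp : p ∈ U) : SmoothAt f p := fun φ => contMDiffAt_of_mdifferentiable (by
      filter_upwards [hU.mem_nhds hp] with q hq
      exact hf.holAt hU hq φ)

/-- The product of a smooth function with a holomorphic function vanishing at `p` is complex
differentiable at `p`. -/
theorem SmoothAt.mul_holAt {R : Type*} [Ring R] [Algebra ℂ R] [Module.Finite ℂ R] {u g : C → R}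
    {p : C} (hu : SmoothAt u p) (hg : HolAt g p) (h0 : g p = 0) : HolAt (fun q => u q * g q) p := by
  let b := Module.finBasis ℂ R
  have e : (fun q => u q * g q) = fun q => ∑ i, b.coord i (u q) • (b i * g q) := by
    funext q
    conv_lhs => rw [← b.sum_repr (u q), Finset.sum_mul]
    refine Finset.sum_congr rfl fun i _ => ?_
    rw [smul_mul_assoc]
    rfl
  rw [e]
  refine HolAt.sum _ fun i _ φ => ?_
  simp only [map_smul, smul_eq_mul]
  exact mdifferentiableAt_mul_of_eq_zero (hu (b.coord i)).continuousAt
    ((hg.linear (LinearMap.mulLeft ℂ (b i))) φ) (by simp [h0])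

variable {N : ℕ}

/-- Local solvability of `∂̄ w = (∂̄ u) v` for odd functions `u` and `v`. -/
theorem exists_dbar_odd {u v : C → Grassmann N} {x : C} (hu : SmoothAt u x) (hv : SmoothAt v x)
    (ou : ∀ᶠ q in 𝓝 x, u q ∈ parityPart N 1) (ov : ∀ᶠ q in 𝓝 x, v q ∈ parityPart N 1) :
    ∃ w : C → Grassmann N, (∀ q, w q ∈ oddSq N) ∧
      ∀ᶠ p in 𝓝 x, HolAt (fun q => w q - u q * v p) p := by
  let b := Module.finBasis ℂ (parityPart N 1)
  -- A linear projection onto the odd part extends the odd coordinates to functionals on all of `Λ`,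
  -- to which `SmoothAt` applies; the equation is then solved for each pair of coordinates.
  obtain ⟨π, hπ⟩ := (parityPart N 1).subtype.exists_leftInverse_of_injective
    (Submodule.ker_subtype _)
  have hrep : ∀ z ∈ parityPart N 1, z = ∑ i, (b.coord i ∘ₗ π) z • (b i : Grassmann N) := by
    intro z hz
    have h1 : π z = ⟨z, hz⟩ := LinearMap.congr_fun hπ ⟨z, hz⟩
    have h2 := congrArg Subtype.val (b.sum_repr ⟨z, hz⟩)
    rw [Submodule.coe_sum] at h2
    conv_lhs => rw [show z = ((⟨z, hz⟩ : parityPart N 1) : Grassmann N) from rfl, ← h2]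
    simp only [LinearMap.comp_apply, h1, Submodule.coe_smul]
    rfl
  choose w hw using fun i j => exists_dbar_product_surface (hu (b.coord i ∘ₗ π))
    (hv (b.coord j ∘ₗ π))
  refine ⟨fun q => ∑ i, ∑ j, w i j q • ((b i : Grassmann N) * b j), fun q =>
    Submodule.sum_mem _ fun i _ => Submodule.sum_mem _ fun j _ =>
      Submodule.smul_mem _ _ (mul_mem_oddSq (b i).2 (b j).2), ?_⟩
  have hw' : ∀ᶠ p in 𝓝 x, ∀ i j, MDifferentiableAt 𝓘(ℂ, ℂ) 𝓘(ℂ, ℂ)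
      (fun q => w i j q - (b.coord i ∘ₗ π) (u q) * (b.coord j ∘ₗ π) (v p)) p :=
    eventually_all.2 fun i => eventually_all.2 fun j => hw i j
  filter_upwards [hw', ou.eventually_nhds, ov] with p hp hpu hpv
  have key : HolAt (fun q => ∑ i, ∑ j, (w i j q - (b.coord i ∘ₗ π) (u q) * (b.coord j ∘ₗ π) (v p)) •
      ((b i : Grassmann N) * b j)) p := by
    refine HolAt.sum _ fun i _ => HolAt.sum _ fun j _ => fun φ => ?_
    simp only [map_smul, smul_eq_mul]
    exact (hp i j).mul mdifferentiableAt_const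
  refine key.congr ?_
  filter_upwards [hpu] with q hq
  simp only [sub_smul, Finset.sum_sub_distrib]
  congr 1
  conv_lhs => rw [hrep _ hq, hrep _ hpv]
  rw [Finset.sum_mul_sum]
  exact Finset.sum_congr rfl fun i _ => Finset.sum_congr rfl fun j _ => by
    rw [smul_mul_smul_comm]

end Pointwise

/-! ### Transition functions of a line bundle -/

section Transition

variable {C : Type*} [TopologicalSpace C] [ChartedSpace ℂ C] {N : ℕ} {l : LineCocycle C N}

theorem LineCocycle.tr_self (l : LineCocycle C N) {x p : C} (hp : p ∈ l.cov.set x) :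
    l.tr x x p = 1 :=
  (l.unit x x p ⟨hp, hp⟩).mul_left_cancel (by rw [← l.cocycle x x x p hp hp hp, mul_one])

theorem LineCocycle.tr_mul_tr (l : LineCocycle C N) {x y p : C} (hx : p ∈ l.cov.set x)
    (hy : p ∈ l.cov.set y) : l.tr x y p * l.tr y x p = 1 := by
  rw [← l.cocycle x y x p hx hy hx, l.tr_self hx]

end Transition

/-! ### Vanishing of the cup product in second cohomology -/

section Vanishing

open Filter Topology

variable {C : Type*} [TopologicalSpace C] [T2Space C] [CompactSpace C] [ChartedSpace ℂ C]
  [IsManifold 𝓘(ℂ, ℂ) ω C] {N : ℕ} {l : LineCocycle C N}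

/-- Odd cocycles are coboundaries of smooth cochains. -/
theorem OddCocycle.exists_smooth (a : OddCocycle l) : ∃ u : C → C → Grassmann N,
    (∀ x, ∀ p ∈ a.cov.set x, SmoothAt (u x) p) ∧ (∀ x, ∀ p ∈ a.cov.set x, u x p ∈ parityPart N 1) ∧
    ∀ x y, ∀ p ∈ a.cov.inter x y, a.f x y p = u x p - l.tr x y p * u y p := by
  have := isManifold_real C
  obtain ⟨ρ, hρ⟩ := SmoothPartitionOfUnity.exists_isSubordinate 𝓘(ℝ, ℂ) (isClosed_univ (X := C))
    (fun x => (a.cov.set x : Set C)) (fun x => (a.cov.set x).2)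
    (fun x _ => Set.mem_iUnion.2 ⟨x, a.cov.mem x⟩)
  -- By compactness only finitely many members of the partition of unity are nonzero, so its sums
  -- are finite.
  have hfin := ρ.locallyFinite.finite_nonempty_of_compact
  let t := hfin.toFinset
  have ht : ∀ z p, ρ z p ≠ 0 → z ∈ t := fun z p h => hfin.mem_toFinset.2 ⟨p, h⟩
  have hsum : ∀ p, ∑ z ∈ t, (ρ z p : ℂ) = 1 := by
    intro p
    have h1 := ρ.sum_eq_one (Set.mem_univ p)
    rw [finsum_eq_sum_of_support_subset (s := t) _ fun z hz => ht z p hz] at h1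
    exact_mod_cast h1
  have hmem : ∀ z p, (ρ z p : ℂ) ≠ 0 → p ∈ a.cov.set z := fun z p h =>
    hρ z (subset_tsupport _ (by simpa using h))
  -- Averaging the cocycle over its second index splits it smoothly. Where `a.f x z` is not
  -- controlled, near points outside the neighbourhood of `z`, its weight vanishes.
  refine ⟨fun x p => ∑ z ∈ t, (ρ z p : ℂ) • a.f x z p, ?_, ?_, ?_⟩
  · intro x p hp
    refine SmoothAt.sum _ fun z _ => ?_
    by_cases hz : p ∈ a.cov.set z
    · have h1 : ContMDiffAt 𝓘(ℝ, ℂ) 𝓘(ℝ, ℂ) ∞ (fun q => (ρ z q : ℂ)) p :=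
        (Complex.ofRealCLM.contDiff.contMDiff (n := ∞)).contMDiffAt.comp p (ρ z).contMDiff.contMDiffAt
      refine SmoothAt.smul h1 ((a.hol x z).smoothAt ?_ ⟨hp, hz⟩)
      exact (a.cov.set x).2.inter (a.cov.set z).2
    · refine (SmoothAt.const (0 : Grassmann N) p).congr ?_
      have h2 : p ∉ tsupport (ρ z) := fun h => hz (hρ z h)
      filter_upwards [notMem_tsupport_iff_eventuallyEq.1 h2] with q hq
      rw [hq]
      simp
  · intro x p hp
    refine Submodule.sum_mem _ fun z _ => ?_
    by_cases h : (ρ z p : ℂ) = 0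
    · rw [h, zero_smul]
      exact zero_mem _
    · exact smul_mem_parity _ (a.odd x z p ⟨hp, hmem z p h⟩)
  · intro x y p hp
    rw [Finset.mul_sum, ← Finset.sum_sub_distrib]
    have h1 : a.f x y p = ∑ z ∈ t, (ρ z p : ℂ) • a.f x y p := by
      rw [← Finset.sum_smul, hsum, one_smul]
    rw [h1]
    refine Finset.sum_congr rfl fun z _ => ?_
    by_cases h : (ρ z p : ℂ) = 0
    · simp [h]
    · rw [a.cocycle x y z p hp.1 hp.2 (hmem z p h), mul_smul_comm, ← smul_sub, add_sub_cancel_right]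

/-- The cup product of `H¹(L⁻¹ ⊗ Λ₁)` and `H¹(L ⊗ Λ₁)` vanishes in `H²`. -/
theorem cup_vanish (a : OddCocycle l.inv) (b : OddCocycle l) :
    ∃ (W : Cover C) (F : C → C → C → Grassmann N), W ≤ a.cov ∧ W ≤ b.cov ∧
      (∀ x y, HolFun (W.inter x y) (F x y)) ∧ (∀ x y, ∀ p ∈ W.inter x y, F x y p ∈ oddSq N) ∧
      ∀ x y z p, p ∈ W.set x → p ∈ W.set y → p ∈ W.set z →
        F x z p = F x y p + F y z p + a.f x y p * (l.tr x y p * b.f y z p) := by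
  obtain ⟨u, hu, ou, eu⟩ := a.exists_smooth
  obtain ⟨v, hv, ov, ev⟩ := b.exists_smooth
  -- `w x` solves `∂̄ (w x) = ∂̄ (u x) * v x` near `x`, stated pointwise with the value of `v x`
  -- frozen.
  have hloc : ∀ x, ∃ w : C → Grassmann N, (∀ q, w q ∈ oddSq N) ∧
      ∀ᶠ p in 𝓝 x, HolAt (fun q => w q - u x q * v x p) p := fun x => by
    refine exists_dbar_odd (hu x x (a.cov.mem x)) (hv x x (b.cov.mem x)) ?_ ?_
    · filter_upwards [(a.cov.set x).2.mem_nhds (a.cov.mem x)] with q hq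
      exact ou x q hq
    · filter_upwards [(b.cov.set x).2.mem_nhds (b.cov.mem x)] with q hq
      exact ov x q hq
  choose w hwJ hw using hloc
  choose O hO hOo hOx using fun x => eventually_nhds_iff.1 (hw x)
  let W : Cover C := ⟨fun x => a.cov.set x ⊓ b.cov.set x ⊓ ⟨O x, hOo x⟩,
    fun x => ⟨⟨a.cov.mem x, b.cov.mem x⟩, hOx x⟩⟩
  have hWa : W ≤ a.cov := fun x p hp => hp.1.1
  have hWb : W ≤ b.cov := fun x p hp => hp.1.2
  have hWl : W ≤ l.cov := Cover.le_trans hWb b.le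
  have hWo : ∀ x y, IsOpen (W.inter x y) := fun x y => (W.set x).2.inter (W.set y).2
  -- The left-hand side is holomorphic, so this relation gives `∂̄ (u x) * l.tr x y = ∂̄ (u y)`.
  have hlin : ∀ {x y q}, q ∈ W.set x → q ∈ W.set y →
      a.f x y q * l.tr x y q = u x q * l.tr x y q - u y q := by
    intro x y q hx hy
    have e : a.f x y q = u x q - l.tr y x q * u y q := eu x y q ⟨hWa x hx, hWa y hy⟩
    rw [e, sub_mul, ← Grassmann.comm_of_even (l.even x y q ⟨hWl x hx, hWl y hy⟩) (l.tr y x q * _),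
      ← mul_assoc, l.tr_mul_tr (hWl x hx) (hWl y hy), one_mul]
  -- Formally, `∂̄` of this function is `∂̄ (u x) * (b.f x y - v x) + ∂̄ (u y) * v y`, which
  -- vanishes because `b.f x y - v x = -l.tr x y * v y`. The terms in `w` drop out of the
  -- coboundary.
  refine ⟨W, fun x y q => u x q * b.f x y q - w x q + w y q, hWa, hWb, ?_, ?_, ?_⟩
  · refine fun x y => HolFun.of_holAt fun p hp => ?_
    have hb := ((b.hol x y).mono (Cover.inter_mono hWb x y)).holAt (hWo x y) hp
    have hs := ((l.hol x y).mono (Cover.inter_mono hWl x y)).holAt (hWo x y) hp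
    have has : HolAt (fun q => a.f x y q * l.tr x y q) p :=
      (((a.hol x y).mono (Cover.inter_mono hWa x y)).mul
        ((l.hol x y).mono (Cover.inter_mono hWl x y))).holAt (hWo x y) hp
    have hux := hu x p (hWa x hp.1)
    -- Near `p` the function is a combination of five terms complex differentiable at `p`. In `k1`
    -- and `k2` a merely smooth factor is multiplied by a holomorphic one vanishing at `p`; the
    -- constants left over cancel by the splitting of `b` at `p`.
    have k1 := hux.mul_holAt (hb.sub (HolAt.const (b.f x y p) p)) (sub_self _)
    have k2 := (hux.mul_holAt (hs.sub (HolAt.const (l.tr x y p) p)) (sub_self _)).linear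
      (LinearMap.mulRight ℂ (v y p))
    have k3 := has.linear (LinearMap.mulRight ℂ (v y p))
    have k4 : HolAt (fun q => w x q - u x q * v x p) p := hO x p hp.1.2
    have k5 : HolAt (fun q => w y q - u y q * v y p) p := hO y p hp.2.2
    refine ((((k1.add k2).sub k3).sub k4).add k5).congr ?_
    filter_upwards [(hWo x y).mem_nhds hp] with q hq
    have e1 := ev x y p (Cover.inter_mono hWb x y hp)
    have e4 := hlin hq.1 hq.2
    simp only [LinearMap.mulRight_apply, e4, e1]
    noncomm_ring
  · exact fun x y p hp => add_mem (sub_mem (mul_mem_oddSq (ou x p (hWa x hp.1))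
      (b.odd x y p (Cover.inter_mono hWb x y hp))) (hwJ x p)) (hwJ y p)
  · intro x y z p hx hy hz
    beta_reduce
    rw [← mul_assoc, hlin hx hy, b.cocycle x y z p (hWb x hx) (hWb y hy) (hWb z hz)]
    noncomm_ring

end Vanishing

/-! ### Construction of bundles in normal form -/

section NormalForms

variable {C : Type*} [TopologicalSpace C] [T2Space C] [CompactSpace C] [ChartedSpace ℂ C]
  [IsManifold 𝓘(ℂ, ℂ) ω C] {N : ℕ} {l : LineCocycle C N}

/-- The failure of the parametrized matrices to satisfy the cocycle condition can be corrected by a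
central factor. -/
theorem exists_correction (a : OddCocycle l.inv) (b : OddCocycle l) :
    ∃ (W : Cover C) (f : C → C → C → Grassmann N), W ≤ a.cov ∧ W ≤ b.cov ∧
      (∀ x y, HolFun (W.inter x y) (f x y)) ∧
      (∀ x y, ∀ p ∈ W.inter x y, f x y p ∈ parityPart N 0 ∧ IsUnit (f x y p)) ∧
      ∀ x y z p, p ∈ W.set x → p ∈ W.set y → p ∈ W.set z →
        f x z p = f x y p * f y z p * expE ((1 / 2 : ℂ) •
          (a.f x y p * (l.tr x y p * b.f y z p) - l.tr y x p * a.f y z p * b.f x y p)) := by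
  obtain ⟨W, F, hWa, hWb, hF, hFJ, hFc⟩ := cup_vanish a b
  obtain ⟨E, hadd, h0, hexp, c, K, hc⟩ := exists_exp N
  have hWl : W ≤ l.cov := Cover.le_trans hWb b.le
  -- `F` bounds the one-sided cup product. The coboundary of half of `α β` contains both mixed
  -- terms, so subtracting it antisymmetrizes the product to the exponent in `gauss_mul`.
  let G : C → C → C → Grassmann N := fun x y p => F x y p - (1 / 2 : ℂ) • (a.f x y p * b.f x y p)
  have hGJ : ∀ x y, ∀ p ∈ W.inter x y, G x y p ∈ oddSq N := fun x y p hp =>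
    sub_mem (hFJ x y p hp) (Submodule.smul_mem _ _ (mul_mem_oddSq
      (a.odd x y p (Cover.inter_mono hWa x y hp)) (b.odd x y p (Cover.inter_mono hWb x y hp))))
  have hG : ∀ x y, HolFun (W.inter x y) (G x y) := fun x y =>
    (hF x y).sub ((((a.hol x y).mono (Cover.inter_mono hWa x y)).mul
      ((b.hol x y).mono (Cover.inter_mono hWb x y))).smul _)
  refine ⟨W, fun x y p => E (G x y p), hWa, hWb, fun x y => ?_, fun x y p hp => ⟨?_, ?_⟩, ?_⟩
  · have : HolFun (W.inter x y) fun p => ∑ k ∈ Finset.range K, c k • (G x y p) ^ k :=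
      HolFun.sum _ fun k _ => ((hG x y).pow k).smul _
    exact this.congr fun p hp => hc _ (hGJ x y p hp)
  · beta_reduce
    rw [hc _ (hGJ x y p hp)]
    exact Submodule.sum_mem _ fun k _ => Submodule.smul_mem _ _
      ((CliffordAlgebra.even (0 : QuadraticForm ℂ (Fin N → ℂ))).pow_mem
        (oddSq_even (hGJ x y p hp)) k)
  · have hJ := hGJ x y p hp
    have e1 := hadd _ hJ _ (neg_mem hJ)
    have e2 := hadd _ (neg_mem hJ) _ hJ
    rw [add_neg_cancel, h0] at e1
    rw [neg_add_cancel, h0] at e2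
    exact ⟨⟨_, _, e1.symm, e2.symm⟩, rfl⟩
  · intro x y z p hx hy hz
    have sxy := l.even x y p ⟨hWl x hx, hWl y hy⟩
    have syx := l.even y x p ⟨hWl y hy, hWl x hx⟩
    have axy := a.odd x y p ⟨hWa x hx, hWa y hy⟩
    have ayz := a.odd y z p ⟨hWa y hy, hWa z hz⟩
    have bxy := b.odd x y p ⟨hWb x hx, hWb y hy⟩
    have byz := b.odd y z p ⟨hWb y hy, hWb z hz⟩
    set Z := (1 / 2 : ℂ) •
      (a.f x y p * (l.tr x y p * b.f y z p) - l.tr y x p * a.f y z p * b.f x y p) with hZ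
    have hZm := gauss_mul_mem sxy syx axy bxy ayz byz
    have hZJ : Z ∈ oddSq N := Submodule.smul_mem _ _ (sub_mem
      (mul_mem_oddSq axy (even_mul_odd sxy byz)) (mul_mem_oddSq (even_mul_odd syx ayz) bxy))
    rw [← hexp Z hZJ hZm.2, ← hadd _ (hGJ x y p ⟨hx, hy⟩) _ (hGJ y z p ⟨hy, hz⟩),
      ← hadd _ (add_mem (hGJ x y p ⟨hx, hy⟩) (hGJ y z p ⟨hy, hz⟩)) _ hZJ]
    refine congrArg E ?_
    have e3 : l.tr y x p * a.f y z p * (l.tr x y p * b.f y z p) = a.f y z p * b.f y z p := by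
      rw [← mul_assoc, mul_assoc _ (a.f y z p), ← Grassmann.comm_of_even sxy (a.f y z p),
        ← mul_assoc, l.tr_mul_tr (hWl y hy) (hWl x hx), one_mul]
    have e4 : a.f x z p * b.f x z p = a.f x y p * b.f x y p +
        a.f x y p * (l.tr x y p * b.f y z p) + l.tr y x p * a.f y z p * b.f x y p +
        a.f y z p * b.f y z p := by
      rw [a.cocycle x y z p (hWa x hx) (hWa y hy) (hWa z hz),
        b.cocycle x y z p (hWb x hx) (hWb y hy) (hWb z hz), ← e3]
      change (_ + l.tr y x p * _) * _ = _
      noncomm_ring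
    change F x z p - (1 / 2 : ℂ) • (a.f x z p * b.f x z p) = F x y p -
      (1 / 2 : ℂ) • (a.f x y p * b.f x y p) +
      (F y z p - (1 / 2 : ℂ) • (a.f y z p * b.f y z p)) + Z
    rw [hFc x y z p hx hy hz, e4, hZ]
    module

variable (l) in
/-- The bundles in normal form exist. -/
theorem nonempty_normalForms : Nonempty (NormalForms l) := by
  choose W f hWa hWb hf hfu hfc using fun (A : H1Odd l.inv) (B : H1Odd l) =>
    exists_correction (Quotient.out A) (Quotient.out B)
  refine ⟨{
    k := Quotient.out
    k_cls := Quotient.out_eq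
    α := Quotient.out
    α_cls := Quotient.out_eq
    β := Quotient.out
    β_cls := Quotient.out_eq
    f := f
    E := fun P A B =>
      { cov := (Quotient.out P).cov.inf (W A B)
        le := Cover.le_trans (Cover.inf_le_right _ _)
          (Cover.le_trans (hWb A B) (Quotient.out B).le)
        g := fun x y p => gauss ((Quotient.out P).tr x y p * f A B x y p) (l.tr x y p)
          ((Quotient.out A).f x y p) ((Quotient.out B).f x y p)
        hol := ?_
        gl := ?_
        cocycle := ?_
        t := fun _ _ => 1
        t_hol := fun _ => HolFun.const _ _
        t_even := fun _ _ _ => one_mem_even N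
        t_unit := fun _ _ _ => isUnit_one
        sdet_eq := ?_ }
    le_k := fun P A B => Cover.inf_le_left _ _
    le_α := fun P A B => Cover.le_trans (Cover.inf_le_right _ _) (hWa A B)
    le_β := fun P A B => Cover.le_trans (Cover.inf_le_right _ _) (hWb A B)
    g_eq := fun _ _ _ _ _ _ _ => rfl
    t_eq := fun _ _ _ _ _ _ => rfl }⟩
  all_goals
    set k : LineCocycle C N := Quotient.out P
    have hk : k.cov.inf (W A B) ≤ k.cov := Cover.inf_le_left _ _
    have hW : k.cov.inf (W A B) ≤ W A B := Cover.inf_le_right _ _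
    have ha := Cover.le_trans hW (hWa A B)
    have hb := Cover.le_trans hW (hWb A B)
    have hl : k.cov.inf (W A B) ≤ l.cov := Cover.le_trans hb (Quotient.out B).le
  · exact fun x y => HolFun.gauss
      (((k.hol x y).mono (Cover.inter_mono hk x y)).mul
        ((hf A B x y).mono (Cover.inter_mono hW x y)))
      ((l.hol x y).mono (Cover.inter_mono hl x y))
      (((Quotient.out A).hol x y).mono (Cover.inter_mono ha x y))
      (((Quotient.out B).hol x y).mono (Cover.inter_mono hb x y))
  · intro x y p hp
    obtain ⟨h1, h2⟩ := hfu A B x y p (Cover.inter_mono hW x y hp)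
    exact gauss_isGL11 (mul_mem_even (k.even x y p (Cover.inter_mono hk x y hp)) h1)
      ((k.unit x y p (Cover.inter_mono hk x y hp)).mul h2)
      (l.even x y p (Cover.inter_mono hl x y hp)) (l.unit x y p (Cover.inter_mono hl x y hp))
      ((Quotient.out A).odd x y p (Cover.inter_mono ha x y hp))
      ((Quotient.out B).odd x y p (Cover.inter_mono hb x y hp))
  · intro x y z p hx hy hz
    obtain ⟨h1, -⟩ := hfu A B y z p ⟨hW y hy, hW z hz⟩
    obtain ⟨h3, -⟩ := hfu A B x y p ⟨hW x hx, hW y hy⟩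
    have k1 := k.even y z p ⟨hk y hy, hk z hz⟩
    -- The exponential factor produced by the group law is the one by which `f` fails to be a
    -- cocycle.
    rw [gauss_mul (mul_mem_even k1 h1) (l.even x y p ⟨hl x hx, hl y hy⟩)
      (l.even y x p ⟨hl y hy, hl x hx⟩) (l.tr_mul_tr (hl x hx) (hl y hy))
      ((Quotient.out A).odd x y p ⟨ha x hx, ha y hy⟩)
      ((Quotient.out B).odd x y p ⟨hb x hx, hb y hy⟩)
      ((Quotient.out A).odd y z p ⟨ha y hy, ha z hz⟩)
      ((Quotient.out B).odd y z p ⟨hb y hy, hb z hz⟩),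
      hfc A B x y z p (hW x hx) (hW y hy) (hW z hz),
      k.cocycle x y z p (hk x hx) (hk y hy) (hk z hz),
      l.cocycle x y z p (hl x hx) (hl y hy) (hl z hz),
      (Quotient.out A).cocycle x y z p (ha x hx) (ha y hy) (ha z hz),
      (Quotient.out B).cocycle x y z p (hb x hx) (hb y hy) (hb z hz)]
    congr 1
    rw [mul_assoc (k.tr x y p) (f A B x y p), ← mul_assoc (f A B x y p) (k.tr y z p),
      Grassmann.comm_of_even h3 (k.tr y z p)]
    simp only [mul_assoc]
  · intro x y p hp
    obtain ⟨h1, h2⟩ := hfu A B x y p (Cover.inter_mono hW x y hp)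
    rw [sdet_gauss (mul_mem_even (k.even x y p (Cover.inter_mono hk x y hp)) h1)
      ((k.unit x y p (Cover.inter_mono hk x y hp)).mul h2)
      (l.even x y p (Cover.inter_mono hl x y hp)) (l.unit x y p (Cover.inter_mono hl x y hp))
      ((Quotient.out A).odd x y p (Cover.inter_mono ha x y hp))
      ((Quotient.out B).odd x y p (Cover.inter_mono hb x y hp)), mul_one, one_mul]

end NormalForms

/-! ### Conjugation of supermatrices -/

section Conj

variable {N : ℕ}

theorem IsEvenMat.ringInverse {M : Mat N} (h : IsEvenMat M) : IsEvenMat (Ring.inverse M) :=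
  Subalgebra.ringInverse_mem (evenMat N) h

theorem conj_isEvenMat {M X : Mat N} (hM : IsEvenMat M) (hX : IsEvenMat X) :
    IsEvenMat (M * X * Ring.inverse M) := (hM.mul hX).mul hM.ringInverse

theorem str_conj {M X : Mat N} (hM : IsGL11 M) (hX : IsEvenMat X) :
    str (M * X * Ring.inverse M) = str X := by
  rw [str_mul_comm (hM.1.mul hX) hM.1.ringInverse, ← mul_assoc,
    Ring.inverse_mul_cancel _ hM.isUnit, one_mul]

theorem eq_conj_iff {R : Type*} [Ring R] {M X Y : R} (hM : IsUnit M) :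
    M * Y = X * M ↔ X = M * Y * Ring.inverse M := by
  constructor
  · intro h
    rw [h, mul_assoc, Ring.mul_inverse_cancel _ hM, mul_one]
  · rintro rfl
    rw [mul_assoc (M * Y), Ring.inverse_mul_cancel _ hM, mul_one]

theorem ringInverse_mul {R : Type*} [Ring R] {M M' : R} (hM : IsUnit M) (hM' : IsUnit M') :
    Ring.inverse (M * M') = Ring.inverse M' * Ring.inverse M := by
  refine inverse_eq_of_mul_eq_one ?_ ?_
  · rw [mul_assoc, ← mul_assoc M', Ring.mul_inverse_cancel _ hM', one_mul,
      Ring.mul_inverse_cancel _ hM]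
  · rw [mul_assoc, ← mul_assoc _ M, Ring.inverse_mul_cancel _ hM, one_mul,
      Ring.inverse_mul_cancel _ hM']

theorem conj_conj {R : Type*} [Ring R] {M M' X : R} (hM : IsUnit M) (hM' : IsUnit M') :
    M * M' * X * Ring.inverse (M * M') = M * (M' * X * Ring.inverse M') * Ring.inverse M := by
  rw [ringInverse_mul hM hM']
  simp only [mul_assoc]

end Conj

/-! ### Conjugation of matrices of one-forms -/

section Conj

variable {C : Type*} [TopologicalSpace C] [ChartedSpace ℂ C] {N : ℕ} {l : LineCocycle C N}

/-- Conjugation of a matrix of one-forms. -/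
noncomputable def conjForm (r : C → Mat N) (η : OneForm C (Mat N)) : OneForm C (Mat N) := fun p =>
  LinearMap.mulRight ℂ (Ring.inverse (r p)) ∘ₗ (LinearMap.mulLeft ℂ (r p) ∘ₗ η p)

theorem conjForm_apply (r : C → Mat N) (η : OneForm C (Mat N)) (p : C)
    (v : TangentSpace 𝓘(ℂ, ℂ) p) : conjForm r η p v = r p * η p v * Ring.inverse (r p) := rfl

theorem FramedBundle.g_unit (E : FramedBundle l) {x y p : C} (hx : p ∈ E.cov.set x)
    (hy : p ∈ E.cov.set y) : IsUnit (E.g x y p) := (E.gl x y p ⟨hx, hy⟩).isUnit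

end Conj

/-! ### Extension of Higgs fields and sections from a refinement -/

section Local

variable {C : Type*} [TopologicalSpace C] [ChartedSpace ℂ C] [IsManifold 𝓘(ℂ, ℂ) ω C] {N : ℕ}
  {l : LineCocycle C N} {b : EvenForm C N}

/-- Matrices of a Higgs field with supertrace `b`, for the transition functions `g`, on a cover. -/
structure IsLocalHiggs (W : Cover C) (g : C → C → C → Mat N) (b : EvenForm C N)
    (Φ : C → OneForm C (Mat N)) : Prop where
  hol : ∀ x, HolForm (W.set x : Set C) (Φ x)
  even : ∀ x, ∀ p ∈ W.set x, ∀ v, IsEvenMat (Φ x p v)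
  compat : ∀ x y, ∀ p ∈ W.inter x y, ∀ v, g x y p * Φ y p v = Φ x p v * g x y p
  str_eq : ∀ x, ∀ p ∈ W.set x, ∀ v, str (Φ x p v) = b.form p v

theorem HiggsField.isLocalHiggs {E : FramedBundle l} (φ : HiggsField E b) {W : Cover C}
    (hW : W ≤ E.cov) : IsLocalHiggs W E.g b φ.form where
  hol x := (φ.hol x).mono (hW x)
  even x p hp := φ.even x p (hW x hp)
  compat x y p hp := φ.compat x y p (Cover.inter_mono hW x y hp)
  str_eq x p hp := φ.str_eq x p (hW x hp)

theorem HolForm.conjForm {U : Set C} {r : C → Mat N} {η : OneForm C (Mat N)} (hr : HolFun U r)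
    (hu : ∀ p ∈ U, IsUnit (r p)) (h : HolForm U η) : HolForm U (conjForm r η) :=
  HolForm.mulRight (hr.ringInverse hu) (HolForm.mulLeft hr h)

/-- Higgs fields can be transported along gauge transformations, up to central factors. -/
theorem IsLocalHiggs.conj {W : Cover C} {g g' : C → C → C → Mat N} {Φ : C → OneForm C (Mat N)}
    (h : IsLocalHiggs W g b Φ) {r : C → C → Mat N} (hr : ∀ x, HolFun (W.set x : Set C) (r x))
    (hgl : ∀ x, ∀ p ∈ W.set x, IsGL11 (r x p))
    (hrel : ∀ x y, ∀ p ∈ W.inter x y, ∃ c ∈ parityPart N 0, IsUnit c ∧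
      r x p * g x y p = Matrix.scalar (Fin 2) c * (g' x y p * r y p)) :
    IsLocalHiggs W g' b (fun x => conjForm (r x) (Φ x)) where
  hol x := (h.hol x).conjForm (hr x) fun p hp => (hgl x p hp).isUnit
  even x p hp v := conj_isEvenMat (hgl x p hp).1 (h.even x p hp v)
  str_eq x p hp v := by
    rw [conjForm_apply, str_conj (hgl x p hp) (h.even x p hp v), h.str_eq x p hp]
  compat x y p hp v := by
    obtain ⟨c, hc, uc, e⟩ := hrel x y p hp
    have ux := (hgl x p hp.1).isUnit
    have uy := (hgl y p hp.2).isUnit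
    have hS := Matrix.scalar_commute (n := Fin 2) c (commute_even hc)
    have uS : IsUnit (Matrix.scalar (Fin 2) c) := uc.map _
    refine uS.mul_left_cancel (uy.mul_right_cancel ?_)
    simp only [conjForm_apply]
    calc Matrix.scalar (Fin 2) c * (g' x y p * (r y p * Φ y p v * Ring.inverse (r y p))) * r y p
        = Matrix.scalar (Fin 2) c * (g' x y p * r y p) * Φ y p v := by
          simp only [mul_assoc, Ring.inverse_mul_cancel _ uy, mul_one]
      _ = r x p * Φ x p v * g x y p := by
          rw [← e, mul_assoc, h.compat x y p hp v, mul_assoc]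
      _ = r x p * Φ x p v * Ring.inverse (r x p) * (r x p * g x y p) := by
          rw [mul_assoc _ (Ring.inverse _), ← mul_assoc (Ring.inverse _) (r x p),
            Ring.inverse_mul_cancel _ ux, one_mul]
      _ = _ := by
          rw [e, ← mul_assoc, ← (hS _).eq]
          simp only [mul_assoc]

open Classical in
/-- A Higgs field given on a refinement extends to the original cover. -/
theorem IsLocalHiggs.extend {E : FramedBundle l} {W : Cover C} (hW : W ≤ E.cov)
    {Φ : C → OneForm C (Mat N)} (h : IsLocalHiggs W E.g b Φ) :
    ∃ φ : HiggsField E b, ∀ x, ∀ p ∈ W.set x, φ.form x p = Φ x p := by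
  have key : ∀ x y p, p ∈ E.cov.set x → p ∈ W.set y → ∀ v,
      E.g x p p * Φ p p v * Ring.inverse (E.g x p p) =
        E.g x y p * Φ y p v * Ring.inverse (E.g x y p) := by
    intro x y p hx hy v
    have hp := W.mem p
    have e1 := (eq_conj_iff (E.g_unit (hW y hy) (hW p hp))).1 (h.compat y p p ⟨hy, hp⟩ v)
    rw [E.cocycle x y p p hx (hW y hy) (hW p hp),
      conj_conj (E.g_unit hx (hW y hy)) (E.g_unit (hW y hy) (hW p hp)), ← e1]
  -- The member of the cover with index `p` contains `p`, so the value at `p` can be transported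
  -- from the frame with index `p`. By `key` any other frame over the refinement gives the same
  -- result.
  let F : C → OneForm C (Mat N) := fun x p =>
    if p ∈ E.cov.set x then conjForm (E.g x p) (Φ p) p else 0
  have hF : ∀ x p, p ∈ E.cov.set x → ∀ v,
      F x p v = E.g x p p * Φ p p v * Ring.inverse (E.g x p p) := by
    intro x p hp v
    simp only [F, if_pos hp]
    rfl
  refine ⟨⟨F, ?_, ?_, ?_, ?_, ?_⟩, ?_⟩
  · intro x
    refine HolForm.of_local fun p hp => ⟨E.cov.set x ∩ W.set p,
      (E.cov.set x).2.inter (W.set p).2, ⟨hp, W.mem p⟩, conjForm (E.g x p) (Φ p), ?_, ?_⟩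
    · exact HolForm.conjForm ((E.hol x p).mono fun q hq => ⟨hq.1, hW p hq.2⟩)
        (fun q hq => E.g_unit hq.1 (hW p hq.2)) ((h.hol p).mono fun q hq => hq.2)
    · intro q hq _
      refine LinearMap.ext fun v => ?_
      rw [hF x q hq.1, conjForm_apply, key x p q hq.1 hq.2]
  · intro x p hp v
    rw [hF x p hp]
    exact conj_isEvenMat (E.gl x p p ⟨hp, hW p (W.mem p)⟩).1 (h.even p p (W.mem p) v)
  · intro x y p hp v
    have hpp := hW p (W.mem p)
    rw [eq_conj_iff (E.g_unit hp.1 hp.2), hF x p hp.1, hF y p hp.2,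
      E.cocycle x y p p hp.1 hp.2 hpp, conj_conj (E.g_unit hp.1 hp.2) (E.g_unit hp.2 hpp)]
  · intro x p hp v
    rw [hF x p hp, str_conj (E.gl x p p ⟨hp, hW p (W.mem p)⟩) (h.even p p (W.mem p) v),
      h.str_eq p p (W.mem p)]
  · intro x p hp
    simp only [F, if_neg hp]
  · intro x p hp
    refine LinearMap.ext fun v => ?_
    rw [hF x p (hW x hp), key x x p (hW x hp) hp, eq_comm,
      ← eq_conj_iff (E.g_unit (hW x hp) (hW x hp)), h.compat x x p ⟨hp, hp⟩]

open Classical in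
/-- Sections of `L ⊗ K` given on a refinement extend. -/
theorem exists_oddFormSection {W : Cover C} (hW : W ≤ l.cov) {δ : C → OneForm C (Grassmann N)}
    (hol : ∀ x, HolForm (W.set x : Set C) (δ x))
    (odd : ∀ x, ∀ p ∈ W.set x, ∀ v, δ x p v ∈ parityPart N 1)
    (compat : ∀ x y, ∀ p ∈ W.inter x y, ∀ v, δ x p v = l.tr x y p * δ y p v) :
    ∃ s : OddFormSection l, ∀ x, ∀ p ∈ W.set x, s.s x p = δ x p := by
  have key : ∀ x y p, p ∈ l.cov.set x → p ∈ W.set y → ∀ v,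
      l.tr x p p * δ p p v = l.tr x y p * δ y p v := by
    intro x y p hx hy v
    have hp := W.mem p
    rw [l.cocycle x y p p hx (hW y hy) (hW p hp), mul_assoc, ← compat y p p ⟨hy, hp⟩]
  let F : C → OneForm C (Grassmann N) := fun x p =>
    if p ∈ l.cov.set x then LinearMap.mulLeft ℂ (l.tr x p p) ∘ₗ δ p p else 0
  have hF : ∀ x p, p ∈ l.cov.set x → ∀ v, F x p v = l.tr x p p * δ p p v := by
    intro x p hp v
    simp only [F, if_pos hp]
    rfl
  refine ⟨⟨F, ?_, ?_, ?_, ?_⟩, ?_⟩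
  · intro x
    refine HolForm.of_local fun p hp => ⟨l.cov.set x ∩ W.set p,
      (l.cov.set x).2.inter (W.set p).2, ⟨hp, W.mem p⟩,
      fun q => LinearMap.mulLeft ℂ (l.tr x p q) ∘ₗ δ p q, ?_, ?_⟩
    · exact HolForm.mulLeft ((l.hol x p).mono fun q hq => ⟨hq.1, hW p hq.2⟩)
        ((hol p).mono fun q hq => hq.2)
    · intro q hq _
      refine LinearMap.ext fun v => ?_
      rw [hF x q hq.1, key x p q hq.1 hq.2]
      rfl
  · intro x p hp v
    rw [hF x p hp]
    exact even_mul_odd (l.even x p p ⟨hp, hW p (W.mem p)⟩) (odd p p (W.mem p) v)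
  · intro x y p hp v
    rw [hF x p hp.1, hF y p hp.2, l.cocycle x y p p hp.1 hp.2 (hW p (W.mem p)), mul_assoc]
  · intro x p hp
    simp only [F, if_neg hp]
  · intro x p hp
    refine LinearMap.ext fun v => ?_
    rw [hF x p (hW x hp), key x x p (hW x hp) hp, l.tr_self (hW x hp), one_mul]

open Classical in
/-- Sections of `L` given on a refinement extend. -/
theorem exists_oddSection {C : Type*} [TopologicalSpace C] [ChartedSpace ℂ C] {N : ℕ}
    {l : LineCocycle C N} {W : Cover C} (hW : W ≤ l.cov) {u : C → C → Grassmann N}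
    (hol : ∀ x, HolFun (W.set x : Set C) (u x)) (odd : ∀ x, ∀ p ∈ W.set x, u x p ∈ parityPart N 1)
    (compat : ∀ x y, ∀ p ∈ W.inter x y, u x p = l.tr x y p * u y p) :
    ∃ s : OddSection l, ∀ x, ∀ p ∈ W.set x, s.s x p = u x p := by
  have key : ∀ x y p, p ∈ l.cov.set x → p ∈ W.set y → l.tr x p p * u p p = l.tr x y p * u y p := by
    intro x y p hx hy
    have hp := W.mem p
    rw [l.cocycle x y p p hx (hW y hy) (hW p hp), mul_assoc, ← compat y p p ⟨hy, hp⟩]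
  let F : C → C → Grassmann N := fun x p => if p ∈ l.cov.set x then l.tr x p p * u p p else 0
  have hF : ∀ x p, p ∈ l.cov.set x → F x p = l.tr x p p * u p p := fun x p hp => if_pos hp
  refine ⟨⟨F, ?_, ?_, ?_, ?_⟩, ?_⟩
  · intro x
    refine HolFun.of_local fun p hp => ⟨l.cov.set x ∩ W.set p,
      (l.cov.set x).2.inter (W.set p).2, ⟨hp, W.mem p⟩, fun q => l.tr x p q * u p q, ?_, ?_⟩
    · exact ((l.hol x p).mono fun q hq => ⟨hq.1, hW p hq.2⟩).mul ((hol p).mono fun q hq => hq.2)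
    · intro q hq _
      rw [hF x q hq.1, key x p q hq.1 hq.2]
  · intro x p hp
    rw [hF x p hp]
    exact even_mul_odd (l.even x p p ⟨hp, hW p (W.mem p)⟩) (odd p p (W.mem p))
  · intro x y p hp
    rw [hF x p hp.1, hF y p hp.2, l.cocycle x y p p hp.1 hp.2 (hW p (W.mem p)), mul_assoc]
  · intro x p hp
    exact if_neg hp
  · intro x p hp
    change F x p = u x p
    rw [hF x p (hW x hp), key x x p (hW x hp) hp, l.tr_self (hW x hp), one_mul]

/-- The value at `p` in any frame is determined by that in the frame with index `p`, whose refined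
neighbourhood contains `p`; outside the domain of a frame both sections are zero by convention. -/
theorem OddFormSection.ext_of_refinement {W : Cover C} (hW : W ≤ l.cov) {s t : OddFormSection l}
    (h : ∀ x, ∀ p ∈ W.set x, ∀ v, s.s x p v = t.s x p v) : s = t := by
  have e : s.s = t.s := by
    funext x p
    by_cases hp : p ∈ l.cov.set x
    · have hpp := hW p (W.mem p)
      refine LinearMap.ext fun v => ?_
      rw [s.compat x p p ⟨hp, hpp⟩, t.compat x p p ⟨hp, hpp⟩, h p p (W.mem p)]
    · rw [s.outside x p hp, t.outside x p hp]
  cases s; cases t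
  congr

theorem EvenForm.ext' {s t : EvenForm C N} (h : ∀ p v, s.form p v = t.form p v) : s = t := by
  have e : s.form = t.form := funext fun p => LinearMap.ext fun v => h p v
  cases s; cases t
  congr

end Local

/-! ### Gauge transformations with Berezinian one -/

section Gauge

variable {N : ℕ}

theorem scalar_mul_gauss (c m s a b : Grassmann N) :
    Matrix.scalar (Fin 2) c * gauss m s a b = gauss (c * m) s a b := by
  rw [gauss_eq m, gauss_eq (c * m), ← mul_assoc, ← map_mul]

theorem expE_mul_self {Z : Grassmann N} (h : Z * Z * Z = 0) : expE Z * expE Z = expE (Z + Z) :=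
  expE_add rfl h (by rw [← mul_assoc, h])

/-- Gauge transformations with Berezinian one in the Gaussian parametrization. -/
theorem gauge_iff {q m m' q' s s' u v α β α' β' u' v' : Grassmann N}
    (hm : m ∈ parityPart N 0) (um' : IsUnit m') (hq' : q' ∈ parityPart N 0)
    (uq' : IsUnit q') (hs : s ∈ parityPart N 0) (us : IsUnit s) (hs' : s' ∈ parityPart N 0)
    (h : s * s' = 1) (hu : u ∈ parityPart N 1) (hv : v ∈ parityPart N 1)
    (hα : α ∈ parityPart N 1) (hβ : β ∈ parityPart N 1) (hα' : α' ∈ parityPart N 1)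
    (hβ' : β' ∈ parityPart N 1) (hu' : u' ∈ parityPart N 1) (hv' : v' ∈ parityPart N 1) :
    gauss q 1 u v * gauss m s α β = gauss m' s α' β' * gauss q' 1 u' v' ↔
      u + α = α' + s' * u' ∧ v + β = β' + s * v' ∧
      q * m * expE ((1 / 2 : ℂ) • (u * β - α * v)) =
        m' * q' * expE ((1 / 2 : ℂ) • (α' * (s * v') - s' * u' * β')) := by
  have h1 := one_mem_even N
  rw [gauss_mul hm h1 h1 (mul_one 1) hu hv hα hβ, gauss_mul hq' hs hs' h hα' hβ' hu' hv']
  simp only [one_mul, mul_one]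
  constructor
  · intro e
    obtain ⟨e1, e2, e3⟩ := gauss_injective ((um'.mul uq').mul
      (expE_isUnit (gauss_mul_mem hs hs' hα' hβ' hu' hv').2)) us (add_mem hu hα) (add_mem hv hβ)
      (add_mem hα' (even_mul_odd hs' hu')) (add_mem hβ' (even_mul_odd hs hv')) e
    exact ⟨e2, e3, e1⟩
  · rintro ⟨e1, e2, e3⟩
    rw [e1, e2, e3]

/-- Cohomologous data are gauge equivalent up to a central factor. -/
theorem exists_gauge {q m m' q' s s' u v α β α' β' u' v' : Grassmann N}
    (hq : q ∈ parityPart N 0) (uq : IsUnit q) (hm : m ∈ parityPart N 0) (um : IsUnit m)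
    (hm' : m' ∈ parityPart N 0) (um' : IsUnit m') (hq' : q' ∈ parityPart N 0)
    (uq' : IsUnit q') (hs : s ∈ parityPart N 0) (hs' : s' ∈ parityPart N 0)
    (h : s * s' = 1) (hu : u ∈ parityPart N 1) (hv : v ∈ parityPart N 1)
    (hα : α ∈ parityPart N 1) (hβ : β ∈ parityPart N 1) (hα' : α' ∈ parityPart N 1)
    (hβ' : β' ∈ parityPart N 1) (hu' : u' ∈ parityPart N 1) (hv' : v' ∈ parityPart N 1)
    (e1 : u + α = α' + s' * u') (e2 : v + β = β' + s * v') :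
    ∃ c ∈ parityPart N 0, IsUnit c ∧ gauss q 1 u v * gauss m s α β =
      Matrix.scalar (Fin 2) c * (gauss m' s α' β' * gauss q' 1 u' v') := by
  have h1 := one_mem_even N
  obtain ⟨hZ, zZ⟩ := gauss_mul_mem h1 h1 hu hv hα hβ
  obtain ⟨hZ', zZ'⟩ := gauss_mul_mem hs hs' hα' hβ' hu' hv'
  simp only [one_mul] at hZ zZ
  set Z := (1 / 2 : ℂ) • (u * β - α * v)
  set Z' := (1 / 2 : ℂ) • (α' * (s * v') - s' * u' * β')
  have x1 := mul_mem_even (mul_mem_even hq hm) (expE_mem hZ)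
  have u1 : IsUnit (q * m * expE Z) := (uq.mul um).mul (expE_isUnit zZ)
  have x2 := mul_mem_even (mul_mem_even hm' hq') (expE_mem hZ')
  have u2 : IsUnit (m' * q' * expE Z') := (um'.mul uq').mul (expE_isUnit zZ')
  set X := q * m * expE Z
  set X' := m' * q' * expE Z'
  -- All Gaussian coordinates but the central one agree by hypothesis, so the discrepancy is the
  -- quotient of the central coordinates.
  refine ⟨X * Ring.inverse X', mul_mem_even x1 (inverse_mem_even x2), u1.mul (isUnit_inverse u2), ?_⟩
  rw [gauss_mul hm h1 h1 (mul_one 1) hu hv hα hβ, gauss_mul hq' hs hs' h hα' hβ' hu' hv',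
    scalar_mul_gauss]
  simp only [one_mul, mul_one]
  rw [e1, e2]
  change gauss X _ _ _ = gauss (X * Ring.inverse X' * X') _ _ _
  rw [mul_assoc, Ring.inverse_mul_cancel _ u2, mul_one]

end Gauge

/-! ### Properties of the chosen normal forms -/

section Spec

variable {C : Type*} [TopologicalSpace C] [ChartedSpace ℂ C] {N : ℕ} {l : LineCocycle C N}

theorem OddCocycle.exists_of_cls_eq {a b : OddCocycle l} (h : a.cls = b.cls) :
    ∃ W : Cover C, W ≤ a.cov ∧ W ≤ b.cov ∧ ∃ u : C → C → Grassmann N,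
    (∀ x, HolFun (W.set x : Set C) (u x)) ∧ (∀ x, ∀ p ∈ W.set x, u x p ∈ parityPart N 1) ∧
    ∀ x y, ∀ p ∈ W.inter x y, b.f x y p = a.f x y p + (u x p - l.tr x y p * u y p) :=
  Quotient.exact h

variable (S : NormalForms l) (P : Pic C N) (A : H1Odd l.inv) (B : H1Odd l)

/-- The central factor of the transition functions of a bundle in normal form. -/
noncomputable def NormalForms.m (x y p : C) : Grassmann N := (S.k P).tr x y p * S.f A B x y p

theorem NormalForms.le_l : (S.E P A B).cov ≤ l.cov := (S.E P A B).le

variable {x y z p : C}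

theorem NormalForms.odd_α (hp : p ∈ (S.E P A B).cov.inter x y) :
    (S.α A).f x y p ∈ parityPart N 1 := (S.α A).odd x y p (Cover.inter_mono (S.le_α P A B) x y hp)

theorem NormalForms.odd_β (hp : p ∈ (S.E P A B).cov.inter x y) :
    (S.β B).f x y p ∈ parityPart N 1 := (S.β B).odd x y p (Cover.inter_mono (S.le_β P A B) x y hp)

theorem NormalForms.g_eq_gauss (hp : p ∈ (S.E P A B).cov.inter x y) : (S.E P A B).g x y p =
    gauss (S.m P A B x y p) (l.tr x y p) ((S.α A).f x y p) ((S.β B).f x y p) :=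
  S.g_eq P A B x y p hp

/-- The choices in `NormalForms` impose no holomorphy, parity or invertibility on `f`. These
properties of the central factor are recovered from the lower right entry of the transition matrices
by this formula, and those of `f` by dividing by `k`. -/
theorem NormalForms.m_eq (hp : p ∈ (S.E P A B).cov.inter x y) : S.m P A B x y p =
    (S.E P A B).g x y p 1 1 * (1 - (1 / 2 : ℂ) • ((S.α A).f x y p * (S.β B).f x y p)) := by
  rw [S.g_eq P A B x y p hp]
  change _ = S.m P A B x y p * (1 + (1 / 2 : ℂ) • _) * _
  rw [mul_assoc, one_add_mul_one_sub _ (S.odd_α P A B hp) (S.odd_β P A B hp), mul_one]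

theorem NormalForms.m_even (hp : p ∈ (S.E P A B).cov.inter x y) :
    S.m P A B x y p ∈ parityPart N 0 := by
  rw [S.m_eq P A B hp]
  exact mul_mem_even ((S.E P A B).gl x y p hp).1.2.1 (sub_mem (one_mem_even N)
    (smul_mem_parity _ (odd_mul_odd (S.odd_α P A B hp) (S.odd_β P A B hp))))

theorem NormalForms.m_unit (hp : p ∈ (S.E P A B).cov.inter x y) : IsUnit (S.m P A B x y p) := by
  rw [S.m_eq P A B hp]
  exact ((S.E P A B).gl x y p hp).2.2.mul
    (isUnit_one_sub _ (S.odd_α P A B hp) (S.odd_β P A B hp))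

theorem NormalForms.m_hol : HolFun ((S.E P A B).cov.inter x y) (S.m P A B x y) := by
  have ha := ((S.α A).hol x y).mono (Cover.inter_mono (S.le_α P A B) x y)
  have hb := ((S.β B).hol x y).mono (Cover.inter_mono (S.le_β P A B) x y)
  exact ((((S.E P A B).hol x y).entry 1 1).mul ((HolFun.const _ 1).sub
    ((ha.mul hb).smul (1 / 2)))).congr fun p hp => S.m_eq P A B hp

theorem NormalForms.k_even (hp : p ∈ (S.E P A B).cov.inter x y) :
    (S.k P).tr x y p ∈ parityPart N 0 := (S.k P).even x y p (Cover.inter_mono (S.le_k P A B) x y hp)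

theorem NormalForms.k_unit (hp : p ∈ (S.E P A B).cov.inter x y) : IsUnit ((S.k P).tr x y p) :=
  (S.k P).unit x y p (Cover.inter_mono (S.le_k P A B) x y hp)

theorem NormalForms.f_eq (hp : p ∈ (S.E P A B).cov.inter x y) :
    S.f A B x y p = Ring.inverse ((S.k P).tr x y p) * S.m P A B x y p :=
  (inverse_mul_mul (S.k_unit P A B hp) _).symm

theorem NormalForms.f_even (hp : p ∈ (S.E P A B).cov.inter x y) :
    S.f A B x y p ∈ parityPart N 0 := by
  rw [S.f_eq P A B hp]
  exact mul_mem_even (inverse_mem_even (S.k_even P A B hp)) (S.m_even P A B hp)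

theorem NormalForms.f_unit (hp : p ∈ (S.E P A B).cov.inter x y) : IsUnit (S.f A B x y p) := by
  rw [S.f_eq P A B hp]
  exact (isUnit_inverse (S.k_unit P A B hp)).mul (S.m_unit P A B hp)

theorem NormalForms.f_hol : HolFun ((S.E P A B).cov.inter x y) (S.f A B x y) :=
  (((((S.k P).hol x y).mono (Cover.inter_mono (S.le_k P A B) x y)).ringInverse
    fun _ hp => S.k_unit P A B hp).mul (S.m_hol P A B)).congr fun _ hp => S.f_eq P A B hp

theorem NormalForms.tr_even (hp : p ∈ (S.E P A B).cov.inter x y) : l.tr x y p ∈ parityPart N 0 :=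
  l.even x y p (Cover.inter_mono (S.le_l P A B) x y hp)

theorem NormalForms.tr_unit (hp : p ∈ (S.E P A B).cov.inter x y) : IsUnit (l.tr x y p) :=
  l.unit x y p (Cover.inter_mono (S.le_l P A B) x y hp)

theorem NormalForms.tr_mul_tr (hp : p ∈ (S.E P A B).cov.inter x y) :
    l.tr x y p * l.tr y x p = 1 := l.tr_mul_tr (S.le_l P A B x hp.1) (S.le_l P A B y hp.2)

end Spec

/-! ### Existence of Higgs fields on normal forms -/

section Existence

variable {C : Type*} [TopologicalSpace C] [ChartedSpace ℂ C] [IsManifold 𝓘(ℂ, ℂ) ω C] {N : ℕ}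
  {l : LineCocycle C N} {b : EvenForm C N} (S : NormalForms l) {P : Pic C N} {A : H1Odd l.inv}
  {B : H1Odd l}

/-- The relations between the entries of a Higgs field in two frames. -/
theorem NormalForms.higgs_entries {W : Cover C} {Φ : C → OneForm C (Mat N)}
    (hW : W ≤ (S.E P A B).cov) (h : IsLocalHiggs W (S.E P A B).g b Φ) {x y p : C}
    (hp : p ∈ W.inter x y) (v : TangentSpace 𝓘(ℂ, ℂ) p) :
    Φ x p v 0 1 = l.tr x y p * Φ y p v 0 1 - (S.β B).f x y p * b.form p v ∧
    Φ x p v 1 0 = l.tr y x p * Φ y p v 1 0 + (S.α A).f x y p * b.form p v ∧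
    Φ x p v 0 0 = Φ y p v 0 0 + ((S.β B).f x y p * Φ x p v 1 0 - Φ x p v 0 1 * (S.α A).f x y p -
      (S.β B).f x y p * (S.α A).f x y p * b.form p v) := by
  have hq := Cover.inter_mono hW x y hp
  have := h.compat x y p hp v
  rw [S.g_eq P A B x y p hq] at this
  exact (higgs_compat_iff (S.m_even P A B hq) (S.m_unit P A B hq) (S.tr_even P A B hq)
    (S.tr_even P A B hq.symm) (S.tr_mul_tr P A B hq) (S.odd_α P A B hq) (S.odd_β P A B hq)
    (h.even y p hp.2 v) (b.even p v) (h.str_eq x p hp.1 v) (h.str_eq y p hp.2 v)).1 this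

/-- Addition of a matrix of one-forms with vanishing supertrace to a Higgs field. -/
theorem NormalForms.isLocalHiggs_add {W : Cover C} {Φ : C → OneForm C (Mat N)}
    (hW : W ≤ (S.E P A B).cov) (h : IsLocalHiggs W (S.E P A B).g b Φ)
    {k δ γ : C → OneForm C (Grassmann N)} (hk : ∀ x, HolForm (W.set x : Set C) (k x))
    (hδ : ∀ x, HolForm (W.set x : Set C) (δ x)) (hγ : ∀ x, HolForm (W.set x : Set C) (γ x))
    (ek : ∀ x, ∀ p ∈ W.set x, ∀ v, k x p v ∈ parityPart N 0)
    (oδ : ∀ x, ∀ p ∈ W.set x, ∀ v, δ x p v ∈ parityPart N 1)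
    (oγ : ∀ x, ∀ p ∈ W.set x, ∀ v, γ x p v ∈ parityPart N 1)
    (cδ : ∀ x y, ∀ p ∈ W.inter x y, ∀ v, δ x p v = l.tr x y p * δ y p v)
    (cγ : ∀ x y, ∀ p ∈ W.inter x y, ∀ v, γ x p v = l.tr y x p * γ y p v)
    (ck : ∀ x y, ∀ p ∈ W.inter x y, ∀ v, k x p v = k y p v +
      ((S.β B).f x y p * γ x p v - δ x p v * (S.α A).f x y p)) :
    IsLocalHiggs W (S.E P A B).g b fun x p => Φ x p + matForm (k x) (δ x) (γ x) (k x) p where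
  hol x := (h.hol x).add ((hk x).matForm (hδ x) (hγ x) (hk x))
  even x p hp v := by
    obtain ⟨h1, h2, h3, h4⟩ := h.even x p hp v
    rw [LinearMap.add_apply, matForm_apply]
    exact ⟨add_mem h1 (ek x p hp v), add_mem h2 (ek x p hp v), add_mem h3 (oδ x p hp v),
      add_mem h4 (oγ x p hp v)⟩
  str_eq x p hp v := by
    rw [← h.str_eq x p hp v, LinearMap.add_apply, matForm_apply]
    simp [str]
  compat x y p hp v := by
    have hq := Cover.inter_mono hW x y hp
    rw [LinearMap.add_apply, LinearMap.add_apply, mul_add, add_mul, h.compat x y p hp v,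
      S.g_eq P A B x y p hq, matForm_apply, matForm_apply]
    congr 1
    -- The added matrix has supertrace zero, so it satisfies the homogeneous relations.
    refine (higgs_compat_iff (B := 0) (S.m_even P A B hq) (S.m_unit P A B hq) (S.tr_even P A B hq)
      (S.tr_even P A B hq.symm) (S.tr_mul_tr P A B hq) (S.odd_α P A B hq) (S.odd_β P A B hq)
      ⟨ek y p hp.2 v, ek y p hp.2 v, oδ y p hp.2 v, oγ y p hp.2 v⟩ (zero_mem _) (by simp [str])
      (by simp [str])).2 ?_
    simpa using ⟨cδ x y p hp v, cγ x y p hp v, ck x y p hp v⟩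

variable (P A B) in
/-- If `[b] · [α] = [b] · [β] = 0` and `[c] = 0` then there is a Higgs field. -/
theorem NormalForms.exists_higgsField (hc : CZero b A B) :
    Nonempty (HiggsField (S.E P A B) b) := by
  obtain ⟨α, β, hA, hB, U, hUα, hUβ, δ, γ, hδ, hγ, odd, eγ, eδ, W₀, hW₀, -, a, ha, ea, ca⟩ := hc
  obtain ⟨W₁, -, -, u, hu, ou, eu⟩ := OddCocycle.exists_of_cls_eq (hA.trans (S.α_cls A).symm)
  obtain ⟨W₂, -, -, w, hw, ow, ew⟩ := OddCocycle.exists_of_cls_eq (hB.trans (S.β_cls B).symm)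
  let W := ((S.E P A B).cov.inf W₀).inf (W₁.inf W₂)
  have hE : W ≤ (S.E P A B).cov := fun x p hp => hp.1.1
  have h0 : W ≤ W₀ := fun x p hp => hp.1.2
  have h1 : W ≤ W₁ := fun x p hp => hp.2.1
  have h2 : W ≤ W₂ := fun x p hp => hp.2.2
  have hU : W ≤ U := Cover.le_trans h0 hW₀
  have e1 := one_mem_even N
  -- The representatives in `CZero` need not be the chosen ones. With central factor `1` these
  -- matrices need not form a cocycle, which is harmless: `IsLocalHiggs` only involves conjugation,
  -- and the gauge change to the chosen representatives is needed only up to a central factor.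
  have key : IsLocalHiggs W (fun x y p => gauss 1 (l.tr x y p) (α.f x y p) (β.f x y p)) b
      fun x => matForm (a x) (δ x) (γ x) (fun p => a x p - b.form p) := by
    have ev : ∀ x, ∀ p ∈ W.set x, ∀ v,
        IsEvenMat !![a x p v, δ x p v; γ x p v, (a x p - b.form p) v] := fun x p hp v =>
      ⟨ea x p (h0 x hp) v, sub_mem (ea x p (h0 x hp) v) (b.even p v), (odd x p (hU x hp) v).1,
        (odd x p (hU x hp) v).2⟩
    refine ⟨fun x => ?_, fun x p hp v => ?_, fun x y p hp v => ?_, fun x p hp v => ?_⟩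
    · have hax := (ha x).mono (h0 x)
      exact hax.matForm ((hδ x).mono (hU x)) ((hγ x).mono (hU x))
        (hax.sub (b.hol.mono (Set.subset_univ _)))
    · rw [matForm_apply]
      exact ev x p hp v
    · have hl := Cover.inter_mono (Cover.le_trans hE (S.le_l P A B)) x y hp
      have hp0 := Cover.inter_mono h0 x y hp
      have hpU := Cover.inter_mono hU x y hp
      have f1 := eδ x y p hpU v
      have f2 := eγ x y p hpU v
      have f3 := ca x y p hp0 v
      rw [matForm_apply, matForm_apply]
      refine (higgs_compat_iff e1 isUnit_one (l.even x y p hl) (l.even y x p hl.symm)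
        (l.tr_mul_tr hl.1 hl.2) (α.odd x y p (Cover.inter_mono hUα x y hpU))
        (β.odd x y p (Cover.inter_mono hUβ x y hpU)) (ev y p hp.2 v) (b.even p v)
        (by simp [str]) (by simp [str])).2 ⟨?_, ?_, ?_⟩
      · simp [f1]
      · simp [f2]
      · have f4 : a x p v = a y p v + cForm b α.f β.f δ γ x y p v := by
          rw [f3]; simp [LineCocycle.trivial]
        simpa [cForm] using f4
    · rw [matForm_apply]
      simp [str]
  have key2 := key.conj (r := fun x p => gauss 1 1 (u x p) (w x p)) (g' := (S.E P A B).g)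
    (fun x => HolFun.gauss (HolFun.const _ 1) (HolFun.const _ 1) ((hu x).mono (h1 x))
      ((hw x).mono (h2 x)))
    (fun x p hp => gauss_isGL11 e1 isUnit_one e1 isUnit_one (ou x p (h1 x hp)) (ow x p (h2 x hp)))
    (fun x y p hp => by
      have hq := Cover.inter_mono hE x y hp
      have hpU := Cover.inter_mono hU x y hp
      rw [S.g_eq P A B x y p hq]
      refine exists_gauge e1 isUnit_one e1 isUnit_one (S.m_even P A B hq) (S.m_unit P A B hq) e1
        isUnit_one (S.tr_even P A B hq)
        (S.tr_even P A B hq.symm) (S.tr_mul_tr P A B hq) (ou x p (h1 x hp.1)) (ow x p (h2 x hp.1))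
        (α.odd x y p (Cover.inter_mono hUα x y hpU)) (β.odd x y p (Cover.inter_mono hUβ x y hpU))
        (S.odd_α P A B hq) (S.odd_β P A B hq) (ou y p (h1 y hp.2)) (ow y p (h2 y hp.2)) ?_ ?_
      · rw [eu x y p (Cover.inter_mono h1 x y hp)]
        change _ = _ + (_ - l.tr y x p * _) + _
        abel
      · rw [ew x y p (Cover.inter_mono h2 x y hp)]
        abel)
  obtain ⟨φ, -⟩ := key2.extend hE
  exact ⟨φ⟩

/-- The relations between the differences of the entries of two Higgs fields. -/
theorem NormalForms.higgs_diff (φ ψ : HiggsField (S.E P A B) b) {x y p : C}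
    (hp : p ∈ (S.E P A B).cov.inter x y) (v : TangentSpace 𝓘(ℂ, ℂ) p) :
    φ.form x p v 0 1 - ψ.form x p v 0 1 =
      l.tr x y p * (φ.form y p v 0 1 - ψ.form y p v 0 1) ∧
    φ.form x p v 1 0 - ψ.form x p v 1 0 =
      l.tr y x p * (φ.form y p v 1 0 - ψ.form y p v 1 0) ∧
    φ.form x p v 0 0 - ψ.form x p v 0 0 = φ.form y p v 0 0 - ψ.form y p v 0 0 +
      ((S.β B).f x y p * (φ.form x p v 1 0 - ψ.form x p v 1 0) -
        (φ.form x p v 0 1 - ψ.form x p v 0 1) * (S.α A).f x y p) := by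
  obtain ⟨a1, a2, a3⟩ := S.higgs_entries (fun _ _ h => h) (φ.isLocalHiggs fun _ _ h => h) hp v
  obtain ⟨b1, b2, b3⟩ := S.higgs_entries (fun _ _ h => h) (ψ.isLocalHiggs fun _ _ h => h) hp v
  refine ⟨?_, ?_, ?_⟩
  · rw [a1, b1, mul_sub]; abel
  · rw [a2, b2, mul_sub]; abel
  · rw [a3, b3, mul_sub, sub_mul]; abel

/-- The off-diagonal entries of a Higgs field can be changed by sections `δ`, `γ` with
`[δ] · [α] = [β] · [γ]`. -/
theorem NormalForms.exists_higgsField_add (φ : HiggsField (S.E P A B) b) {δ : OddFormSection l}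
    {γ : OddFormSection l.inv} (h : CupEq δ A B γ) : ∃ ψ : HiggsField (S.E P A B) b,
      ∀ x, ∀ p ∈ (S.E P A B).cov.set x, ∀ v,
        ψ.form x p v 0 1 - φ.form x p v 0 1 = δ.s x p v ∧
        ψ.form x p v 1 0 - φ.form x p v 1 0 = γ.s x p v := by
  obtain ⟨α, β, hA, hB, W₀, hW₀, -, k, hk, ek, ck⟩ := h
  obtain ⟨W₁, -, -, u, hu, ou, eu⟩ := OddCocycle.exists_of_cls_eq (hA.trans (S.α_cls A).symm)
  obtain ⟨W₂, -, -, w, hw, ow, ew⟩ := OddCocycle.exists_of_cls_eq (hB.trans (S.β_cls B).symm)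
  let W := ((S.E P A B).cov.inf W₀).inf (W₁.inf W₂)
  have hE : W ≤ (S.E P A B).cov := fun x p hp => hp.1.1
  have h0 : W ≤ W₀ := fun x p hp => hp.1.2
  have h1 : W ≤ W₁ := fun x p hp => hp.2.1
  have h2 : W ≤ W₂ := fun x p hp => hp.2.2
  have hl : W ≤ l.cov := Cover.le_trans hE (S.le_l P A B)
  -- `-k x` bounds `[β] · [γ] - [δ] · [α]` for the representatives given by `CupEq`. The terms with
  -- `w` and `u` account for the passage to the chosen representatives, as `δ` and `γ` are global
  -- sections.
  have := S.isLocalHiggs_add hE (φ.isLocalHiggs hE)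
    (k := fun x p => LinearMap.mulLeft ℂ (w x p) ∘ₗ γ.s x p -
      LinearMap.mulRight ℂ (u x p) ∘ₗ δ.s x p - k x p) (δ := δ.s) (γ := γ.s)
    (fun x => (((HolForm.mulLeft ((hw x).mono (h2 x)) ((γ.hol x).mono (hl x))).sub
      (HolForm.mulRight ((hu x).mono (h1 x)) ((δ.hol x).mono (hl x)))).sub ((hk x).mono (h0 x))))
    (fun x => (δ.hol x).mono (hl x)) (fun x => (γ.hol x).mono (hl x))
    (fun x p hp v => sub_mem (sub_mem (odd_mul_odd (ow x p (h2 x hp)) (γ.odd x p (hl x hp) v))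
      (odd_mul_odd (δ.odd x p (hl x hp) v) (ou x p (h1 x hp)))) (ek x p (h0 x hp) v))
    (fun x p hp v => δ.odd x p (hl x hp) v) (fun x p hp v => γ.odd x p (hl x hp) v)
    (fun x y p hp v => δ.compat x y p (Cover.inter_mono hl x y hp) v)
    (fun x y p hp v => γ.compat x y p (Cover.inter_mono hl x y hp) v)
    (fun x y p hp v => by
      have hp' := Cover.inter_mono hl x y hp
      have c1 := ck x y p (Cover.inter_mono h0 x y hp) v
      have d1 := δ.compat x y p hp' v
      have d2 : γ.s x p v = l.tr y x p * γ.s y p v := γ.compat x y p hp' v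
      have e1 := eu x y p (Cover.inter_mono h1 x y hp)
      change _ = _ + (_ - l.tr y x p * _) at e1
      have e2 := ew x y p (Cover.inter_mono h2 x y hp)
      have t1 := l.tr_mul_tr hp'.1 hp'.2
      have s1 := l.even x y p hp'
      have s2 := l.even y x p hp'.symm
      have c1' : δ.s x p v * α.f x y p - β.f x y p * γ.s x p v = k x p v - k y p v := by
        simpa [LineCocycle.trivial] using c1
      have g1 : l.tr x y p * w y p * γ.s x p v = w y p * γ.s y p v := by
        rw [d2, Grassmann.comm_of_even s1, mul_assoc, ← mul_assoc (l.tr x y p), t1, one_mul]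
      have g2 : δ.s x p v * (l.tr y x p * u y p) = δ.s y p v * u y p := by
        rw [d1, Grassmann.comm_of_even s1, mul_assoc, ← mul_assoc (l.tr x y p), t1, one_mul]
      change w x p * γ.s x p v - δ.s x p v * u x p - k x p v =
        w y p * γ.s y p v - δ.s y p v * u y p - k y p v + _
      rw [e1, e2, ← g1, ← g2, ← sub_add_cancel (k x p v) (k y p v), ← c1']
      simp only [mul_add, mul_sub, add_mul, sub_mul]
      abel)
  obtain ⟨ψ, hψ⟩ := this.extend hE
  -- The extension is known only on the refinement, which contains `p` in its member with index `p`;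
  -- the homogeneous relations carry the identity to all other frames.
  have hp : ∀ p v, ψ.form p p v 0 1 - φ.form p p v 0 1 = δ.s p p v ∧
      ψ.form p p v 1 0 - φ.form p p v 1 0 = γ.s p p v := by
    intro p v
    rw [hψ p p (W.mem p), LinearMap.add_apply, matForm_apply]
    simp
  refine ⟨ψ, fun x p hx v => ?_⟩
  have hq : p ∈ (S.E P A B).cov.inter x p := ⟨hx, hE p (W.mem p)⟩
  have hlx := Cover.inter_mono (S.le_l P A B) x p hq
  obtain ⟨d1, d2, -⟩ := S.higgs_diff ψ φ hq v
  rw [d1, d2, (hp p v).1, (hp p v).2]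
  exact ⟨(δ.compat x p p hlx v).symm, (γ.compat x p p hlx v).symm⟩

end Existence

/-! ### Parametrization of the Higgs fields on a fixed bundle -/

section Parametrization

variable {C : Type*} [TopologicalSpace C] [ChartedSpace ℂ C] [IsManifold 𝓘(ℂ, ℂ) ω C] {N : ℕ}
  {l : LineCocycle C N} {b : EvenForm C N} (S : NormalForms l) {P : Pic C N} {A : H1Odd l.inv}
  {B : H1Odd l}

theorem HolForm.entry {U : Set C} {η : OneForm C (Mat N)} (h : HolForm U η) (i j : Fin 2) :
    HolForm U fun p => Matrix.entryLinearMap ℂ (Grassmann N) i j ∘ₗ η p := h.linear _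

/-- Addition of a scalar one-form to a Higgs field. -/
theorem NormalForms.exists_higgsField_add_scalar (φ : HiggsField (S.E P A B) b) (a : EvenForm C N) :
    ∃ ψ : HiggsField (S.E P A B) b, ∀ x, ∀ p ∈ (S.E P A B).cov.set x, ∀ v,
      ψ.form x p v = φ.form x p v + !![a.form p v, 0; 0, a.form p v] := by
  have h := S.isLocalHiggs_add (fun _ _ h => h) (φ.isLocalHiggs fun _ _ h => h)
    (k := fun _ => a.form) (δ := fun _ _ => 0) (γ := fun _ _ => 0)
    (fun x => a.hol.mono (Set.subset_univ _)) (fun _ => HolForm.zero _) (fun _ => HolForm.zero _)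
    (fun _ p _ v => a.even p v) (fun _ _ _ _ => zero_mem _) (fun _ _ _ _ => zero_mem _)
    (by simp) (by simp) (by simp)
  obtain ⟨ψ, hψ⟩ := h.extend fun _ _ h => h
  refine ⟨ψ, fun x p hp v => ?_⟩
  rw [hψ x p hp, LinearMap.add_apply, matForm_apply]
  rfl

/-- Two Higgs fields with the same off-diagonal entries differ by a scalar one-form. -/
theorem NormalForms.exists_scalar_diff (φ ψ : HiggsField (S.E P A B) b)
    (h : ∀ x, ∀ p ∈ (S.E P A B).cov.set x, ∀ v,
      φ.form x p v 0 1 = ψ.form x p v 0 1 ∧ φ.form x p v 1 0 = ψ.form x p v 1 0) :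
    ∃ a : EvenForm C N, ∀ x, ∀ p ∈ (S.E P A B).cov.set x, ∀ v,
      φ.form x p v = ψ.form x p v + !![a.form p v, 0; 0, a.form p v] := by
  -- Without off-diagonal differences the homogeneous relation for the `(1,1)` entry says that the
  -- differences `D x` glue to a global form.
  let D : C → OneForm C (Grassmann N) := fun x p =>
    Matrix.entryLinearMap ℂ (Grassmann N) 0 0 ∘ₗ φ.form x p -
      Matrix.entryLinearMap ℂ (Grassmann N) 0 0 ∘ₗ ψ.form x p
  have hD : ∀ x p v, D x p v = φ.form x p v 0 0 - ψ.form x p v 0 0 := fun _ _ _ => rfl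
  have key : ∀ x y, ∀ p ∈ (S.E P A B).cov.inter x y, ∀ v, D x p v = D y p v := by
    intro x y p hp v
    obtain ⟨-, -, e⟩ := S.higgs_diff φ ψ hp v
    obtain ⟨h1, h2⟩ := h x p hp.1 v
    rw [hD, hD, e, h1, h2]
    simp
  have mem := (S.E P A B).cov.mem
  refine ⟨⟨fun p => D p p, HolForm.of_local fun p _ => ⟨(S.E P A B).cov.set p,
    ((S.E P A B).cov.set p).2, mem p, D p, ((φ.hol p).entry 0 0).sub ((ψ.hol p).entry 0 0),
    fun q hq _ => LinearMap.ext fun v => key q p q ⟨mem q, hq⟩ v⟩,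
    fun p v => sub_mem (φ.even p p (mem p) v).1 (ψ.even p p (mem p) v).1⟩, fun x p hp v => ?_⟩
  have e : D p p v = φ.form x p v 0 0 - ψ.form x p v 0 0 := key p x p ⟨mem p, hp⟩ v
  obtain ⟨h1, h2⟩ := h x p hp v
  have s1 := φ.str_eq x p hp v
  rw [← ψ.str_eq x p hp v, str, str] at s1
  change _ = _ + !![D p p v, 0; 0, D p p v]
  rw [e, Matrix.eta_fin_two (φ.form x p v), Matrix.eta_fin_two (ψ.form x p v), h1, h2]
  ext i j
  fin_cases i <;> fin_cases j
  · simp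
  · simp
  · simp
  -- The lower right entry is forced by the common supertrace.
  · change φ.form x p v 1 1 = ψ.form x p v 1 1 + (φ.form x p v 0 0 - ψ.form x p v 0 0)
    rw [sub_eq_sub_iff_add_eq_add] at s1
    rw [add_sub, eq_sub_iff_add_eq, add_comm, ← s1, add_comm]

/-- The invariants of the bundle of a Higgs field satisfy the relations. -/
theorem NormalForms.relations (φ : HiggsField (S.E P A B) b) :
    CupFormZero b A ∧ CupFormZero b B ∧ CZero b A B := by
  let U := (S.E P A B).cov
  have hα : U ≤ (S.α A).cov := S.le_α P A B
  have hβ : U ≤ (S.β B).cov := S.le_β P A B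
  have e := fun {x y p : C} (hp : p ∈ U.inter x y) (v : TangentSpace 𝓘(ℂ, ℂ) p) =>
    S.higgs_entries (fun _ _ h => h) (φ.isLocalHiggs fun _ _ h => h) hp v
  let ent (i j : Fin 2) : C → OneForm C (Grassmann N) := fun x p =>
    Matrix.entryLinearMap ℂ (Grassmann N) i j ∘ₗ φ.form x p
  have he : ∀ i j x p v, ent i j x p v = φ.form x p v i j := fun _ _ _ _ _ => rfl
  have hol : ∀ i j x, HolForm (U.set x : Set C) (ent i j x) := fun i j x => (φ.hol x).entry i j
  -- The entries of the Higgs field are themselves the primitives. For `β b` the sign is negative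
  -- because `β b = L δ y - δ x` is the coboundary of `-δ`.
  refine ⟨⟨S.α A, S.α_cls A, U, hα, S.le_l P A B, ent 1 0, hol 1 0,
    fun x p hp v => (φ.even x p hp v).2.2.2, fun x y p hp v => ?_⟩,
    ⟨S.β B, S.β_cls B, U, hβ, S.le_l P A B, fun x p => -ent 0 1 x p, fun x => (hol 0 1 x).neg,
    fun x p hp v => neg_mem (φ.even x p hp v).2.2.1, fun x y p hp v => ?_⟩,
    ⟨S.α A, S.β B, S.α_cls A, S.β_cls B, U, hα, hβ, ent 0 1, ent 1 0, hol 0 1, hol 1 0,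
    fun x p hp v => (φ.even x p hp v).2.2, fun x y p hp v => ?_, fun x y p hp v => ?_, U,
    fun _ _ h => h, fun _ _ _ => trivial, ent 0 0, hol 0 0, fun x p hp v => (φ.even x p hp v).1,
    fun x y p hp v => ?_⟩⟩
  · change _ = ent 1 0 x p v - l.tr y x p * ent 1 0 y p v
    rw [he, he, (e hp v).2.1]
    simp
  · change _ = -ent 0 1 x p v - l.tr x y p * -ent 0 1 y p v
    rw [he, he, (e hp v).1]
    simp
  · rw [he, he, (e hp v).2.1]
    simp
  · rw [he, he, (e hp v).1]
    simp
  · change (S.β B).f x y p * ent 1 0 x p v - ent 0 1 x p v * (S.α A).f x y p -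
      (S.β B).f x y p * (S.α A).f x y p * b.form p v = ent 0 0 x p v - 1 * ent 0 0 y p v
    simp only [he]
    rw [(e hp v).2.2]
    simp

/-- The off-diagonal entries of two Higgs fields differ by sections `δ`, `γ` with
`[δ] · [α] = [β] · [γ]`. -/
theorem NormalForms.exists_offDiag_diff (φ ψ : HiggsField (S.E P A B) b) :
    ∃ (δ : OddFormSection l) (γ : OddFormSection l.inv), CupEq δ A B γ ∧
      ∀ x, ∀ p ∈ (S.E P A B).cov.set x, ∀ v,
        φ.form x p v 0 1 - ψ.form x p v 0 1 = δ.s x p v ∧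
        φ.form x p v 1 0 - ψ.form x p v 1 0 = γ.s x p v := by
  let U := (S.E P A B).cov
  let ent (i j : Fin 2) : C → OneForm C (Grassmann N) := fun x p =>
    Matrix.entryLinearMap ℂ (Grassmann N) i j ∘ₗ φ.form x p -
    Matrix.entryLinearMap ℂ (Grassmann N) i j ∘ₗ ψ.form x p
  have he : ∀ i j x p v, ent i j x p v = φ.form x p v i j - ψ.form x p v i j :=
    fun _ _ _ _ _ => rfl
  have hol : ∀ i j x, HolForm (U.set x : Set C) (ent i j x) := fun i j x =>
    ((φ.hol x).entry i j).sub ((ψ.hol x).entry i j)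
  obtain ⟨δ, hδ⟩ := exists_oddFormSection (S.le_l P A B) (hol 0 1)
    (fun x p hp v => sub_mem (φ.even x p hp v).2.2.1 (ψ.even x p hp v).2.2.1)
    fun x y p hp v => (S.higgs_diff φ ψ hp v).1
  obtain ⟨γ, hγ⟩ := exists_oddFormSection (l := l.inv) (S.le_l P A B) (hol 1 0)
    (fun x p hp v => sub_mem (φ.even x p hp v).2.2.2 (ψ.even x p hp v).2.2.2)
    fun x y p hp v => (S.higgs_diff φ ψ hp v).2.1
  refine ⟨δ, γ, ⟨S.α A, S.β B, S.α_cls A, S.β_cls B, U,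
    fun x p hp => ⟨S.le_α P A B x hp, S.le_β P A B x hp⟩, fun _ _ _ => trivial,
    fun x p => -ent 0 0 x p, fun x => (hol 0 0 x).neg,
    fun x p hp v => neg_mem (sub_mem (φ.even x p hp v).1 (ψ.even x p hp v).1),
    fun x y p hp v => ?_⟩, fun x p hp v => ?_⟩
  · change δ.s x p v * (S.α A).f x y p - (S.β B).f x y p * γ.s x p v =
      -ent 0 0 x p v - 1 * -ent 0 0 y p v
    rw [hδ x p hp.1, hγ x p hp.1]
    simp only [he]
    rw [(S.higgs_diff φ ψ hp v).2.2, one_mul]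
    abel
  · rw [hδ x p hp, hγ x p hp]
    exact ⟨rfl, rfl⟩

theorem HiggsField.form_eq {E : FramedBundle l} {φ ψ : HiggsField E b}
    (h : ∀ x, ∀ p ∈ E.cov.set x, ∀ v, φ.form x p v = ψ.form x p v) : φ.form = ψ.form := by
  funext x p
  by_cases hp : p ∈ E.cov.set x
  · exact LinearMap.ext fun v => h x p hp v
  · rw [φ.outside x p hp, ψ.outside x p hp]

variable (b) in
/-- The Higgs fields on bundles in normal form are parametrized by the data. -/
theorem NormalForms.exists_parametrization :
    ∃ Φ : ∀ d : HiggsData l b, HiggsField (S.E d.pic d.A d.B) b,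
      (∀ d d' : HiggsData l b, d'.pic = d.pic → d'.A = d.A → d'.B = d.B →
        ∀ x, ∀ p ∈ (S.E d.pic d.A d.B).cov.set x, ∀ v,
          (Φ d').form x p v 0 1 - (Φ d).form x p v 0 1 = d'.δ.s x p v - d.δ.s x p v ∧
          (Φ d').form x p v 1 0 - (Φ d).form x p v 1 0 = d'.γ.s x p v - d.γ.s x p v) ∧
      (∀ d d' : HiggsData l b, d'.pic = d.pic → d'.A = d.A → d'.B = d.B →
        d'.δ = d.δ → d'.γ = d.γ → ∀ x, ∀ p ∈ (S.E d.pic d.A d.B).cov.set x, ∀ v,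
          (Φ d').form x p v 0 0 - (Φ d).form x p v 0 0 = d'.a.form p v - d.a.form p v) ∧
      (∀ P A B, ∀ φ : HiggsField (S.E P A B) b,
        ∃! d : HiggsData l b, d.pic = P ∧ d.A = A ∧ d.B = B ∧ (Φ d).form = φ.form) := by
  -- There is no canonical base point, so one is chosen for each bundle. It is moved by `δ`, `γ` to
  -- `ψ` and then by the scalar `a` to `Φ`; both choices are functions of the data, so that
  -- differences within one bundle do not see them.
  have φ₀ : ∀ P A B, CZero b A B → HiggsField (S.E P A B) b := fun P A B h =>
    Classical.choice (S.exists_higgsField P A B h)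
  choose ψ hψ using fun P A B (h : CZero b A B) δ γ (h' : CupEq δ A B γ) =>
    S.exists_higgsField_add (φ₀ P A B h) h'
  choose Φ hΦ using fun d : HiggsData l b =>
    S.exists_higgsField_add_scalar (ψ d.pic d.A d.B d.c d.δ d.γ d.rel) d.a
  -- The bundles of two data are only propositionally equal, but the matrices `form` have a type
  -- independent of the bundle and can be compared.
  have hφ : ∀ P P' A A' B B' h h', P' = P → A' = A → B' = B →
      (φ₀ P' A' B' h').form = (φ₀ P A B h).form := by
    rintro _ _ _ _ _ _ _ _ rfl rfl rfl
    rfl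
  have hψ' : ∀ P P' A A' B B' h h' δ δ' γ γ' r r', P' = P → A' = A → B' = B → δ' = δ → γ' = γ →
      (ψ P' A' B' h' δ' γ' r').form = (ψ P A B h δ γ r).form := by
    rintro _ _ _ _ _ _ _ _ _ _ _ _ _ _ rfl rfl rfl rfl rfl
    rfl
  have hΦ₁ : ∀ d : HiggsData l b, ∀ x, ∀ p ∈ (S.E d.pic d.A d.B).cov.set x, ∀ v,
      (Φ d).form x p v 0 1 = d.δ.s x p v + (φ₀ d.pic d.A d.B d.c).form x p v 0 1 ∧
      (Φ d).form x p v 1 0 = d.γ.s x p v + (φ₀ d.pic d.A d.B d.c).form x p v 1 0 ∧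
      (Φ d).form x p v 0 0 =
        (ψ d.pic d.A d.B d.c d.δ d.γ d.rel).form x p v 0 0 + d.a.form p v := by
    intro d x p hp v
    obtain ⟨e1, e2⟩ := hψ _ _ _ d.c d.δ d.γ d.rel x p hp v
    rw [hΦ d x p hp, ← e1, ← e2]
    simp
  have hcov : ∀ d d' : HiggsData l b, d'.pic = d.pic → d'.A = d.A → d'.B = d.B →
      (S.E d'.pic d'.A d'.B).cov = (S.E d.pic d.A d.B).cov := fun d d' hP hA hB => by
    rw [hP, hA, hB]
  have h1 : ∀ d d' : HiggsData l b, d'.pic = d.pic → d'.A = d.A → d'.B = d.B →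
      ∀ x, ∀ p ∈ (S.E d.pic d.A d.B).cov.set x, ∀ v,
        (Φ d').form x p v 0 1 - (Φ d).form x p v 0 1 = d'.δ.s x p v - d.δ.s x p v ∧
        (Φ d').form x p v 1 0 - (Φ d).form x p v 1 0 = d'.γ.s x p v - d.γ.s x p v := by
    intro d d' hP hA hB x p hp v
    obtain ⟨e1, e2, -⟩ := hΦ₁ d x p hp v
    obtain ⟨e3, e4, -⟩ := hΦ₁ d' x p (by rwa [hcov d d' hP hA hB]) v
    rw [e1, e2, e3, e4, hφ _ _ _ _ _ _ d.c d'.c hP hA hB]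
    simp
  have h2 : ∀ d d' : HiggsData l b, d'.pic = d.pic → d'.A = d.A → d'.B = d.B →
      d'.δ = d.δ → d'.γ = d.γ → ∀ x, ∀ p ∈ (S.E d.pic d.A d.B).cov.set x, ∀ v,
        (Φ d').form x p v 0 0 - (Φ d).form x p v 0 0 = d'.a.form p v - d.a.form p v := by
    intro d d' hP hA hB hδ hγ x p hp v
    obtain ⟨-, -, e1⟩ := hΦ₁ d x p hp v
    obtain ⟨-, -, e3⟩ := hΦ₁ d' x p (by rwa [hcov d d' hP hA hB]) v
    rw [e1, e3, hψ' _ _ _ _ _ _ d.c d'.c _ _ _ _ d.rel d'.rel hP hA hB hδ hγ]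
    simp
  refine ⟨Φ, h1, h2, fun P A B φ => ?_⟩
  refine existsUnique_of_exists_of_unique ?_ ?_
  · obtain ⟨bA, bB, c⟩ := S.relations φ
    -- The datum is found by comparison with the base point: the off-diagonal difference gives `δ`
    -- and `γ`, and the scalar remainder gives `a`.
    obtain ⟨δ, γ, rel, e⟩ := S.exists_offDiag_diff φ (φ₀ P A B c)
    obtain ⟨a, ha⟩ := S.exists_scalar_diff φ (ψ P A B c δ γ rel) fun x p hp v => by
      obtain ⟨e1, e2⟩ := e x p hp v
      obtain ⟨e3, e4⟩ := hψ P A B c δ γ rel x p hp v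
      exact ⟨sub_left_injective (e1.trans e3.symm), sub_left_injective (e2.trans e4.symm)⟩
    refine ⟨⟨P, a, A, B, δ, γ, bA, bB, c, rel⟩, rfl, rfl, rfl, ?_⟩
    refine HiggsField.form_eq (E := S.E P A B) fun x p hp v => ?_
    rw [ha x p hp v, hΦ _ x p hp]
  · intro d d' h h'
    have e : (Φ d').form = (Φ d).form := h'.2.2.2.trans h.2.2.2.symm
    have hP : d'.pic = d.pic := h'.1.trans h.1.symm
    have hA : d'.A = d.A := h'.2.1.trans h.2.1.symm
    have hB : d'.B = d.B := h'.2.2.1.trans h.2.2.1.symm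
    have hl := S.le_l d.pic d.A d.B
    have hδ : d'.δ = d.δ := OddFormSection.ext_of_refinement hl fun x p hp v => by
      have := (h1 d d' hP hA hB x p hp v).1
      rw [e, sub_self] at this
      exact sub_eq_zero.1 this.symm
    have hγ : d'.γ = d.γ := OddFormSection.ext_of_refinement (l := l.inv) hl fun x p hp v => by
      have := (h1 d d' hP hA hB x p hp v).2
      rw [e, sub_self] at this
      exact sub_eq_zero.1 this.symm
    have ha : d'.a = d.a := EvenForm.ext' fun p v => by
      have := h2 d d' hP hA hB hδ hγ p p ((S.E d.pic d.A d.B).cov.mem p) v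
      rw [e, sub_self] at this
      exact sub_eq_zero.1 this.symm
    obtain ⟨P, a, A, B, δ, γ, bA, bB, c, rel⟩ := d
    obtain ⟨P', a', A', B', δ', γ', bA', bB', c', rel'⟩ := d'
    obtain rfl : P' = P := hP
    obtain rfl : A' = A := hA
    obtain rfl : B' = B := hB
    obtain rfl : δ' = δ := hδ
    obtain rfl : γ' = γ := hγ
    obtain rfl : a' = a := ha
    rfl

end Parametrization

/-! ### Coboundary changes of multiplicative cocycles -/

section Twist

variable {C : Type*} [TopologicalSpace C] [ChartedSpace ℂ C] {N : ℕ}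

/-- A multiplicative cocycle can be changed by a coboundary. -/
theorem LineCocycle.exists_twist (k : LineCocycle C N) {W : Cover C} (hW : W ≤ k.cov)
    {q : C → C → Grassmann N} (hq : ∀ x, HolFun (W.set x : Set C) (q x))
    (eq : ∀ x, ∀ p ∈ W.set x, q x p ∈ parityPart N 0) (uq : ∀ x, ∀ p ∈ W.set x, IsUnit (q x p)) :
    ∃ k' : LineCocycle C N, k'.cls = k.cls ∧ k'.cov = W ∧
      ∀ x y p, k'.tr x y p = Ring.inverse (q x p) * (k.tr x y p * q y p) := by
  have hqi : ∀ x, HolFun (W.set x : Set C) fun p => Ring.inverse (q x p) := fun x =>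
    (hq x).ringInverse (uq x)
  refine ⟨{
    cov := W
    tr := fun x y p => Ring.inverse (q x p) * (k.tr x y p * q y p)
    hol := fun x y => ((hqi x).mono fun p hp => hp.1).mul
      (((k.hol x y).mono (Cover.inter_mono hW x y)).mul ((hq y).mono fun p hp => hp.2))
    even := fun x y p hp => mul_mem_even (inverse_mem_even (eq x p hp.1))
      (mul_mem_even (k.even x y p (Cover.inter_mono hW x y hp)) (eq y p hp.2))
    unit := fun x y p hp => (isUnit_inverse (uq x p hp.1)).mul
      ((k.unit x y p (Cover.inter_mono hW x y hp)).mul (uq y p hp.2))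
    cocycle := fun x y z p hx hy hz => by
      rw [k.cocycle x y z p (hW x hx) (hW y hy) (hW z hz)]
      simp only [mul_assoc]
      rw [mul_mul_inverse (uq y p hy)] }, Quotient.sound ?_, rfl, fun _ _ _ => rfl⟩
  refine ⟨W, fun _ _ h => h, hW, q, fun x p => Ring.inverse (q x p), hq, hqi, fun x p hp =>
    ⟨eq x p hp, inverse_mem_even (eq x p hp), Ring.mul_inverse_cancel _ (uq x p hp)⟩,
    fun x y p hp => ?_⟩
  exact (mul_mul_inverse (uq x p hp.1) _).symm

end Twist

/-! ### Isomorphisms between normal forms -/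

section Isomorphisms

variable {C : Type*} [TopologicalSpace C] [ChartedSpace ℂ C] {N : ℕ} {l : LineCocycle C N}
  (S : NormalForms l) {P P' : Pic C N} {A A' : H1Odd l.inv} {B B' : H1Odd l}

/-- Gauge transformations between bundles in normal form with the same odd invariants. -/
theorem NormalForms.gauge_iff {x y p : C} (hp : p ∈ (S.E P A B).cov.inter x y)
    (hp' : p ∈ (S.E P' A B).cov.inter x y) {q q' u v u' v' : Grassmann N}
    (hq' : q' ∈ parityPart N 0) (uq' : IsUnit q') (hu : u ∈ parityPart N 1)
    (hv : v ∈ parityPart N 1) (hu' : u' ∈ parityPart N 1) (hv' : v' ∈ parityPart N 1)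
    (e1 : u = l.tr y x p * u') (e2 : v = l.tr x y p * v') :
    gauss q 1 u v * (S.E P A B).g x y p = (S.E P' A B).g x y p * gauss q' 1 u' v' ↔
      (S.k P').tr x y p * q' = q * ((S.k P).tr x y p *
        expE (u * (S.β B).f x y p - (S.α A).f x y p * v)) := by
  have hα := S.odd_α P A B hp
  have hβ := S.odd_β P A B hp
  have h1 := one_mem_even N
  rw [S.g_eq_gauss P A B hp, S.g_eq_gauss P' A B hp', SuperHiggs.gauge_iff (S.m_even P A B hp)
    (S.m_unit P' A B hp') hq' uq' (S.tr_even P A B hp) (S.tr_unit P A B hp)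
    (S.tr_even P A B hp.symm) (S.tr_mul_tr P A B hp) hu hv hα hβ hα hβ hu' hv']
  obtain ⟨-, zZ⟩ := gauss_mul_mem h1 h1 hu hv hα hβ
  simp only [one_mul] at zZ
  rw [← e1, ← e2]
  simp only [NormalForms.m]
  set α := (S.α A).f x y p
  set β := (S.β B).f x y p
  -- The two sides of the gauge relation carry opposite half exponents, which combine to the full
  -- exponent `u β - α v`; the correction `f` is common to both sides and cancels.
  have hZ : (1 / 2 : ℂ) • (α * v - u * β) = -((1 / 2 : ℂ) • (u * β - α * v)) := by module
  have hY : u * β - α * v = (1 / 2 : ℂ) • (u * β - α * v) + (1 / 2 : ℂ) • (u * β - α * v) := by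
    module
  rw [hZ]
  conv_rhs => rw [hY]
  set Z := (1 / 2 : ℂ) • (u * β - α * v)
  rw [← expE_mul_self zZ]
  have uE := expE_isUnit zZ
  have hE : expE (-Z) * expE Z = 1 := by
    have := expE_mul_neg (Z := -Z) (by simp [zZ])
    rwa [neg_neg] at this
  have hf := S.f_even P A B hp
  have uf := S.f_unit P A B hp
  set f := S.f A B x y p
  set k := (S.k P).tr x y p
  set k' := (S.k P').tr x y p
  have hf' := fun z => Grassmann.comm_of_even hf z
  constructor
  · rintro ⟨-, -, e⟩
    refine uf.mul_right_cancel ?_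
    calc k' * q' * f = k' * f * q' * (expE (-Z) * expE Z) := by
          rw [hE, mul_one, mul_assoc, ← hf', mul_assoc]
      _ = q * (k * f) * expE Z * expE Z := by rw [← mul_assoc, ← e]
      _ = _ := by simp only [mul_assoc, hf']
  · intro e
    refine ⟨add_comm _ _, add_comm _ _, uE.mul_right_cancel ?_⟩
    calc q * (k * f) * expE Z * expE Z = q * (k * (expE Z * expE Z)) * f := by
          simp only [mul_assoc, hf']
      _ = k' * f * q' * (expE (-Z) * expE Z) := by
          rw [hE, mul_one, ← e, mul_assoc, ← hf', mul_assoc]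
      _ = _ := by rw [← mul_assoc]

/-- Carries an intertwining relation of two Higgs fields from one frame to another; the central
discrepancy `c` commutes with everything and drops out. -/
theorem conj_transfer {N : ℕ} {n n' g g' X X' Y Y' : Mat N} {c : Grassmann N}
    (hc : c ∈ parityPart N 0) (ug : IsUnit g) (hn : n * g = Matrix.scalar (Fin 2) c * (g' * n'))
    (h : g * Y = X * g) (h' : g' * Y' = X' * g') (e : n' * Y = Y' * n') : n * X = X' * n := by
  have hS := Matrix.scalar_commute (n := Fin 2) c (commute_even hc)
  refine ug.mul_right_cancel ?_
  calc n * X * g = Matrix.scalar (Fin 2) c * (g' * n') * Y := by rw [mul_assoc, ← h, ← hn, mul_assoc]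
    _ = Matrix.scalar (Fin 2) c * X' * (g' * n') := by
      rw [mul_assoc, mul_assoc g', e, ← mul_assoc g', h']
      simp only [mul_assoc]
    _ = X' * n * g := by rw [(hS X').eq, mul_assoc, ← hn, mul_assoc]

/-- The factor `q` is central and acts trivially on Higgs fields, so only the odd coordinates of an
isomorphism matter for them. -/
theorem gauss_comm_iff {N : ℕ} {q a b : Grassmann N} (hq : q ∈ parityPart N 0) (uq : IsUnit q)
    {X X' : Mat N} : gauss q 1 a b * X = X' * gauss q 1 a b ↔
      gauss 1 1 a b * X = X' * gauss 1 1 a b := by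
  have hS := Matrix.scalar_commute (n := Fin 2) q (commute_even hq)
  have uS : IsUnit (Matrix.scalar (Fin 2) q) := uq.map _
  have e := scalar_mul_gauss q 1 1 a b
  rw [mul_one] at e
  rw [← e, ← mul_assoc X', ← (hS X').eq, mul_assoc, mul_assoc, uS.mul_right_inj]

variable [IsManifold 𝓘(ℂ, ℂ) ω C] {b : EvenForm C N}

/-- Isomorphisms of Higgs bundles in normal form. -/
theorem NormalForms.iso_iff (φ : HiggsField (S.E P A B) b) (φ' : HiggsField (S.E P' A' B') b) :
    Iso ⟨S.E P A B, φ⟩ ⟨S.E P' A' B', φ'⟩ ↔ A' = A ∧ B' = B ∧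
      ∃ (lam : OddSection l.inv) (rho : OddSection l),
        PicShift (S.k P) (S.α A) (S.β B) lam rho P' ∧
        ∀ x, ∀ p ∈ (S.E P A B).cov.set x, p ∈ (S.E P' A' B').cov.set x → ∀ v,
          gauss 1 1 (lam.s x p) (rho.s x p) * φ.form x p v =
            φ'.form x p v * gauss 1 1 (lam.s x p) (rho.s x p) := by
  have h1 := one_mem_even N
  constructor
  · rintro ⟨W, hW, hW', r, hr, glr, hg, ht, hφ⟩
    change W ≤ (S.E P A B).cov at hW
    change W ≤ (S.E P' A' B').cov at hW'
    have hl : W ≤ l.cov := Cover.le_trans hW (S.le_l P A B)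
    -- These are the Gaussian coordinates of the isomorphism in the explicit form of
    -- `IsGL11.eq_gauss`, which makes them visibly holomorphic.
    let lam : C → C → Grassmann N := fun x p => r x p 1 0 * Ring.inverse (r x p 0 0)
    let rho : C → C → Grassmann N := fun x p => r x p 0 1 * Ring.inverse (r x p 1 1)
    let q : C → C → Grassmann N := fun x p =>
      r x p 1 1 * (1 - (1 / 2 : ℂ) • (lam x p * rho x p))
    have hlam : ∀ x, HolFun (W.set x : Set C) (lam x) := fun x =>
      ((hr x).entry 1 0).mul (((hr x).entry 0 0).ringInverse fun p hp => (glr x p hp).2.1)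
    have hrho : ∀ x, HolFun (W.set x : Set C) (rho x) := fun x =>
      ((hr x).entry 0 1).mul (((hr x).entry 1 1).ringInverse fun p hp => (glr x p hp).2.2)
    have hq : ∀ x, HolFun (W.set x : Set C) (q x) := fun x =>
      ((hr x).entry 1 1).mul ((HolFun.const _ 1).sub (((hlam x).mul (hrho x)).smul _))
    have olam : ∀ x, ∀ p ∈ W.set x, lam x p ∈ parityPart N 1 := fun x p hp =>
      odd_mul_even (glr x p hp).1.2.2.2 (inverse_mem_even (glr x p hp).1.1)
    have orho : ∀ x, ∀ p ∈ W.set x, rho x p ∈ parityPart N 1 := fun x p hp =>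
      odd_mul_even (glr x p hp).1.2.2.1 (inverse_mem_even (glr x p hp).1.2.1)
    have eq : ∀ x, ∀ p ∈ W.set x, q x p ∈ parityPart N 0 := fun x p hp =>
      mul_mem_even (glr x p hp).1.2.1
        (sub_mem h1 (smul_mem_parity _ (odd_mul_odd (olam x p hp) (orho x p hp))))
    have uq : ∀ x, ∀ p ∈ W.set x, IsUnit (q x p) := fun x p hp =>
      (glr x p hp).2.2.mul (isUnit_one_sub _ (olam x p hp) (orho x p hp))
    have er : ∀ x, ∀ p ∈ W.set x, r x p = gauss (q x p) 1 (lam x p) (rho x p) := by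
      intro x p hp
      -- Both Berezinian identifications are `1` in normal form.
      have e : sdet (r x p) = 1 := by
        have := ht x p hp
        change sdet (r x p) * (S.E P A B).t x p = (S.E P' A' B').t x p at this
        rwa [S.t_eq P A B x p (hW x hp), S.t_eq P' A' B' x p (hW' x hp), mul_one] at this
      have := (glr x p hp).eq_gauss
      rwa [e] at this
    have key : ∀ x y, ∀ p ∈ W.inter x y,
        lam x p + (S.α A).f x y p = (S.α A').f x y p + l.tr y x p * lam y p ∧
        rho x p + (S.β B).f x y p = (S.β B').f x y p + l.tr x y p * rho y p := by
      intro x y p hp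
      have hp1 := Cover.inter_mono hW x y hp
      have hp2 := Cover.inter_mono hW' x y hp
      have := hg x y p hp
      change r x p * (S.E P A B).g x y p = (S.E P' A' B').g x y p * r y p at this
      rw [er x p hp.1, er y p hp.2, S.g_eq_gauss P A B hp1, S.g_eq_gauss P' A' B' hp2,
        SuperHiggs.gauge_iff (S.m_even P A B hp1) (S.m_unit P' A' B' hp2) (eq y p hp.2)
        (uq y p hp.2) (S.tr_even P A B hp1) (S.tr_unit P A B hp1) (S.tr_even P A B hp1.symm)
        (S.tr_mul_tr P A B hp1) (olam x p hp.1) (orho x p hp.1) (S.odd_α P A B hp1)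
        (S.odd_β P A B hp1) (S.odd_α P' A' B' hp2) (S.odd_β P' A' B' hp2) (olam y p hp.2)
        (orho y p hp.2)] at this
      exact ⟨this.1, this.2.1⟩
    have hA : A' = A := by
      rw [← S.α_cls A, ← S.α_cls A', eq_comm]
      refine Quotient.sound ⟨W, Cover.le_trans hW (S.le_α P A B),
        Cover.le_trans hW' (S.le_α P' A' B'), lam, hlam, olam, fun x y p hp => ?_⟩
      change _ = _ + (_ - l.tr y x p * _)
      rw [add_sub, add_comm _ (lam x p), (key x y p hp).1, add_sub_cancel_right]
    have hB : B' = B := by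
      rw [← S.β_cls B, ← S.β_cls B', eq_comm]
      refine Quotient.sound ⟨W, Cover.le_trans hW (S.le_β P A B),
        Cover.le_trans hW' (S.le_β P' A' B'), rho, hrho, orho, fun x y p hp => ?_⟩
      rw [add_sub, add_comm _ (rho x p), (key x y p hp).2, add_sub_cancel_right]
    refine ⟨hA, hB, ?_⟩
    -- The representatives depend only on the classes, so they now coincide, and the additive
    -- relations say that `lam` and `rho` are global sections.
    subst hA hB
    have clam : ∀ x y, ∀ p ∈ W.inter x y, lam x p = l.tr y x p * lam y p := fun x y p hp =>
      add_right_cancel ((key x y p hp).1.trans (add_comm _ _))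
    have crho : ∀ x y, ∀ p ∈ W.inter x y, rho x p = l.tr x y p * rho y p := fun x y p hp =>
      add_right_cancel ((key x y p hp).2.trans (add_comm _ _))
    obtain ⟨lam', hlam'⟩ := exists_oddSection (l := l.inv) hl hlam olam clam
    obtain ⟨rho', hrho'⟩ := exists_oddSection hl hrho orho crho
    refine ⟨lam', rho', ?_, fun x p hx hx' v => ?_⟩
    -- Twisting the representative of `P'` by the central coordinate `q` turns equality up to a
    -- coboundary into the exact formula in `PicShift`.
    · obtain ⟨k', hk', hcov, htr⟩ := (S.k P').exists_twist
        (Cover.le_trans hW' (S.le_k P' A' B')) hq eq uq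
      refine ⟨k', hk'.trans (S.k_cls P'), hcov ▸ Cover.le_trans hW (S.le_k P A' B'),
        hcov ▸ Cover.le_trans hW (S.le_α P A' B'), hcov ▸ Cover.le_trans hW (S.le_β P A' B'), ?_⟩
      rw [hcov]
      intro x y p hp
      have := hg x y p hp
      change r x p * (S.E P A' B').g x y p = (S.E P' A' B').g x y p * r y p at this
      rw [er x p hp.1, er y p hp.2, S.gauge_iff (Cover.inter_mono hW x y hp)
        (Cover.inter_mono hW' x y hp) (eq y p hp.2) (uq y p hp.2) (olam x p hp.1)
        (orho x p hp.1) (olam y p hp.2) (orho y p hp.2) (clam x y p hp) (crho x y p hp)] at this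
      rw [htr, this, inverse_mul_mul (uq x p hp.1), hlam' x p hp.1, hrho' x p hp.1]
      rfl
    -- The isomorphism lives on the refinement `W` only; the relation at `p` is taken in the frame
    -- with index `p` and carried to the frame `x`.
    · have hp := W.mem p
      have hxp : p ∈ (S.E P A' B').cov.inter x p := ⟨hx, hW p hp⟩
      have hxp' : p ∈ (S.E P' A' B').cov.inter x p := ⟨hx', hW' p hp⟩
      have hlp := Cover.inter_mono (S.le_l P A' B') x p hxp
      have o1 := lam'.odd x p hlp.1
      have o2 := rho'.odd x p hlp.1
      have o3 := lam'.odd p p hlp.2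
      have o4 := rho'.odd p p hlp.2
      have e3 : lam'.s x p = l.tr p x p * lam'.s p p := lam'.compat x p p hlp
      obtain ⟨c, hc, -, e⟩ := SuperHiggs.exists_gauge h1 isUnit_one (S.m_even P A' B' hxp)
        (S.m_unit P A' B' hxp) (S.m_even P' A' B' hxp') (S.m_unit P' A' B' hxp') h1 isUnit_one
        (S.tr_even P A' B' hxp) (S.tr_even P A' B' hxp.symm) (S.tr_mul_tr P A' B' hxp)
        o1 o2 (S.odd_α P A' B' hxp) (S.odd_β P A' B' hxp) (S.odd_α P A' B' hxp)
        (S.odd_β P A' B' hxp) o3 o4 (by rw [e3, add_comm])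
        (by rw [rho'.compat x p p hlp, add_comm])
      rw [← S.g_eq_gauss P A' B' hxp, ← S.g_eq_gauss P' A' B' hxp'] at e
      refine conj_transfer hc ((S.E P A' B').g_unit hxp.1 hxp.2) e (φ.compat x p p hxp v)
        (φ'.compat x p p hxp' v) ?_
      have := hφ p p hp v
      rw [er p p hp, gauss_comm_iff (eq p p hp) (uq p p hp)] at this
      rw [hlam' p p hp, hrho' p p hp]
      exact this
  · rintro ⟨rfl, rfl, lam, rho, ⟨k', hk', -, -, -, htr⟩, hconj⟩
    -- Conversely, the coboundary between `k'` and the chosen representative of `P'` supplies the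
    -- central coordinate of the isomorphism.
    obtain ⟨W₀, hW₀, -, u, w, hu, -, huw, e⟩ : LineCocycle.Rel k' (S.k P') :=
      Quotient.exact (hk'.trans (S.k_cls P').symm)
    let W := ((S.E P A' B').cov.inf (S.E P' A' B').cov).inf W₀
    have hW : W ≤ (S.E P A' B').cov := fun x p hp => hp.1.1
    have hW' : W ≤ (S.E P' A' B').cov := fun x p hp => hp.1.2
    have h0 : W ≤ W₀ := fun x p hp => hp.2
    have hl : W ≤ l.cov := Cover.le_trans hW (S.le_l P A' B')
    have ou : ∀ x, ∀ p ∈ W.set x, u x p ∈ parityPart N 0 := fun x p hp => (huw x p (h0 x hp)).1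
    have uu : ∀ x, ∀ p ∈ W.set x, IsUnit (u x p) := fun x p hp => by
      obtain ⟨a1, a2, a3⟩ := huw x p (h0 x hp)
      exact ⟨⟨_, _, a3, by rw [Grassmann.comm_of_even a2, a3]⟩, rfl⟩
    have o1 : ∀ x, ∀ p ∈ W.set x, lam.s x p ∈ parityPart N 1 := fun x p hp =>
      lam.odd x p (hl x hp)
    have o2 : ∀ x, ∀ p ∈ W.set x, rho.s x p ∈ parityPart N 1 := fun x p hp =>
      rho.odd x p (hl x hp)
    refine ⟨W, hW, hW', fun x p => gauss (u x p) 1 (lam.s x p) (rho.s x p), fun x => ?_,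
      fun x p hp => ?_, fun x y p hp => ?_, fun x p hp => ?_, fun x p hp v => ?_⟩
    · exact HolFun.gauss ((hu x).mono (h0 x)) (HolFun.const _ 1) ((lam.hol x).mono (hl x))
        ((rho.hol x).mono (hl x))
    · exact gauss_isGL11 (ou x p hp) (uu x p hp) h1 isUnit_one (o1 x p hp) (o2 x p hp)
    · have hlp := Cover.inter_mono hl x y hp
      change _ * (S.E P A' B').g x y p = (S.E P' A' B').g x y p * _
      rw [S.gauge_iff (Cover.inter_mono hW x y hp) (Cover.inter_mono hW' x y hp)
        (ou y p hp.2) (uu y p hp.2) (o1 x p hp.1) (o2 x p hp.1) (o1 y p hp.2) (o2 y p hp.2)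
        (lam.compat x y p hlp) (rho.compat x y p hlp),
        e x y p (Cover.inter_mono h0 x y hp),
        htr x y p (Cover.inter_mono hW₀ x y (Cover.inter_mono h0 x y hp))]
      rfl
    · change _ * (S.E P A' B').t x p = (S.E P' A' B').t x p
      rw [S.t_eq P A' B' x p (hW x hp), S.t_eq P' A' B' x p (hW' x hp), mul_one,
        sdet_gauss (ou x p hp) (uu x p hp) h1 isUnit_one (o1 x p hp) (o2 x p hp)]
    · rw [gauss_comm_iff (ou x p hp) (uu x p hp)]
      exact hconj x p (hW x hp) (hW' x hp) v

end Isomorphisms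

/-! ### Inverses and cocycles in Gaussian coordinates -/

section Algebra

variable {N : ℕ}

theorem IsGL11.ringInverse {M : Mat N} (h : IsGL11 M) :
    IsGL11 (Ring.inverse M) ∧ sdet (Ring.inverse M) * sdet M = 1 := by
  have h1 := one_mem_even N
  obtain ⟨m, a, b, hm, um, ha, hb, e⟩ := h.exists_gauss
  have hs := sdet_mem_even h
  have us := sdet_isUnit h
  have us' := isUnit_inverse us
  have hs' := inverse_mem_even hs
  have hm' := inverse_mem_even hm
  have um' := isUnit_inverse um
  have e' := gauss_mul_inv hm' (Ring.mul_inverse_cancel _ um) hs hs'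
    (Ring.mul_inverse_cancel _ us) ha hb
  rw [← e] at e'
  have hi : Ring.inverse M = gauss (Ring.inverse m) (Ring.inverse (sdet M)) (-(sdet M * a))
      (-(Ring.inverse (sdet M) * b)) := by
    rw [← mul_one (Ring.inverse M), ← e', ← mul_assoc, Ring.inverse_mul_cancel _ h.isUnit, one_mul]
  have oa := neg_mem (even_mul_odd hs ha)
  have ob := neg_mem (even_mul_odd hs' hb)
  rw [hi]
  exact ⟨gauss_isGL11 hm' um' hs' us' oa ob,
    by rw [sdet_gauss hm' um' hs' us' oa ob, Ring.inverse_mul_cancel _ us]⟩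

/-- The cocycle condition in the Gaussian parametrization. -/
theorem gauss_cocycle {m m₁ m₂ s s₁ s₁' s₂ a a₁ a₂ b b₁ b₂ : Grassmann N}
    (um₁ : IsUnit m₁) (hm₂ : m₂ ∈ parityPart N 0) (um₂ : IsUnit m₂) (us : IsUnit s)
    (hs : s₁ ∈ parityPart N 0) (hs' : s₁' ∈ parityPart N 0) (h : s₁ * s₁' = 1)
    (es : s = s₁ * s₂) (ha : a ∈ parityPart N 1) (hb : b ∈ parityPart N 1)
    (ha₁ : a₁ ∈ parityPart N 1) (hb₁ : b₁ ∈ parityPart N 1)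
    (ha₂ : a₂ ∈ parityPart N 1) (hb₂ : b₂ ∈ parityPart N 1)
    (e : gauss m s a b = gauss m₁ s₁ a₁ b₁ * gauss m₂ s₂ a₂ b₂) :
    m = m₁ * m₂ * expE ((1 / 2 : ℂ) • (a₁ * (s₁ * b₂) - s₁' * a₂ * b₁)) ∧
      a = a₁ + s₁' * a₂ ∧ b = b₁ + s₁ * b₂ := by
  rw [gauss_mul hm₂ hs hs' h ha₁ hb₁ ha₂ hb₂, ← es] at e
  exact gauss_injective ((um₁.mul um₂).mul (expE_isUnit (gauss_mul_mem hs hs' ha₁ hb₁ ha₂ hb₂).2))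
    us ha hb (add_mem ha₁ (even_mul_odd hs' ha₂)) (add_mem hb₁ (even_mul_odd hs hb₂)) e

end Algebra

/-! ### Invariants of an arbitrary bundle -/

section Invariants

variable {C : Type*} [TopologicalSpace C] [ChartedSpace ℂ C] {N : ℕ} {l : LineCocycle C N}

/-- The frame in which the Berezinian bundle has the transition functions of `L`. -/
noncomputable def FramedBundle.normFrame (E : FramedBundle l) (x p : C) : Mat N :=
  gauss 1 (E.t x p) 0 0

theorem FramedBundle.normFrame_isGL11 (E : FramedBundle l) {x p : C} (hp : p ∈ E.cov.set x) :
    IsGL11 (E.normFrame x p) :=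
  gauss_isGL11 (one_mem_even N) isUnit_one (E.t_even x p hp) (E.t_unit x p hp) (zero_mem _)
    (zero_mem _)

theorem FramedBundle.sdet_normFrame (E : FramedBundle l) {x p : C} (hp : p ∈ E.cov.set x) :
    sdet (E.normFrame x p) = E.t x p :=
  sdet_gauss (one_mem_even N) isUnit_one (E.t_even x p hp) (E.t_unit x p hp) (zero_mem _)
    (zero_mem _)

theorem FramedBundle.normFrame_hol (E : FramedBundle l) (x : C) :
    HolFun (E.cov.set x : Set C) (E.normFrame x) :=
  HolFun.gauss (HolFun.const _ 1) (E.t_hol x) (HolFun.const _ 0) (HolFun.const _ 0)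

/-- The invariants of a bundle. -/
theorem FramedBundle.exists_invariants (E : FramedBundle l) :
    ∃ (α : OddCocycle l.inv) (β : OddCocycle l) (m : C → C → C → Grassmann N),
      α.cov = E.cov ∧ β.cov = E.cov ∧ (∀ x y, HolFun (E.cov.inter x y) (m x y)) ∧
      (∀ x y, ∀ p ∈ E.cov.inter x y, m x y p ∈ parityPart N 0 ∧ IsUnit (m x y p)) ∧
      ∀ x y, ∀ p ∈ E.cov.inter x y, E.g x y p * E.normFrame y p =
        E.normFrame x p * gauss (m x y p) (l.tr x y p) (α.f x y p) (β.f x y p) := by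
  -- In the frames rescaled by `diag(t x, 1)` the Berezinians of the transition matrices are exactly
  -- those of `L`, so the other Gaussian coordinates can be read off.
  let G : C → C → C → Mat N := fun x y p =>
    Ring.inverse (E.normFrame x p) * (E.g x y p * E.normFrame y p)
  have uF : ∀ {x p}, p ∈ E.cov.set x → IsUnit (E.normFrame x p) := fun hp =>
    (E.normFrame_isGL11 hp).isUnit
  have hG : ∀ x y, HolFun (E.cov.inter x y) (G x y) := fun x y =>
    (((E.normFrame_hol x).mono fun p hp => hp.1).ringInverse fun p hp => uF hp.1).mul'
      ((E.hol x y).mul' ((E.normFrame_hol y).mono fun p hp => hp.2))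
  have glG : ∀ x y, ∀ p ∈ E.cov.inter x y, IsGL11 (G x y p) ∧ sdet (G x y p) = l.tr x y p := by
    intro x y p hp
    have hF := E.normFrame_isGL11 hp.1
    have hF' := hF.ringInverse
    have hgF := (E.gl x y p hp).mul (E.normFrame_isGL11 hp.2)
    have hGG := hF'.1.mul hgF.1
    refine ⟨hGG.1, ?_⟩
    change sdet (Ring.inverse (E.normFrame x p) * (E.g x y p * E.normFrame y p)) = _
    rw [hGG.2, hgF.2, E.sdet_normFrame hp.2, E.sdet_eq x y p hp, ← mul_assoc,
      ← E.sdet_normFrame hp.1, hF'.2, one_mul]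
  have cG : ∀ x y z p, p ∈ E.cov.set x → p ∈ E.cov.set y → p ∈ E.cov.set z →
      G x z p = G x y p * G y z p := by
    intro x y z p hx hy hz
    simp only [G]
    rw [E.cocycle x y z p hx hy hz]
    simp only [mul_assoc]
    rw [← mul_assoc (E.normFrame y p) (Ring.inverse _), Ring.mul_inverse_cancel _ (uF hy), one_mul]
  let α : C → C → C → Grassmann N := fun x y p => G x y p 1 0 * Ring.inverse (G x y p 0 0)
  let β : C → C → C → Grassmann N := fun x y p => G x y p 0 1 * Ring.inverse (G x y p 1 1)
  let m : C → C → C → Grassmann N := fun x y p =>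
    G x y p 1 1 * (1 - (1 / 2 : ℂ) • (α x y p * β x y p))
  have hα : ∀ x y, HolFun (E.cov.inter x y) (α x y) := fun x y =>
    ((hG x y).entry 1 0).mul (((hG x y).entry 0 0).ringInverse fun p hp => (glG x y p hp).1.2.1)
  have hβ : ∀ x y, HolFun (E.cov.inter x y) (β x y) := fun x y =>
    ((hG x y).entry 0 1).mul (((hG x y).entry 1 1).ringInverse fun p hp => (glG x y p hp).1.2.2)
  have hm : ∀ x y, HolFun (E.cov.inter x y) (m x y) := fun x y =>
    ((hG x y).entry 1 1).mul ((HolFun.const _ 1).sub (((hα x y).mul (hβ x y)).smul _))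
  have oα : ∀ x y, ∀ p ∈ E.cov.inter x y, α x y p ∈ parityPart N 1 := fun x y p hp =>
    odd_mul_even (glG x y p hp).1.1.2.2.2 (inverse_mem_even (glG x y p hp).1.1.1)
  have oβ : ∀ x y, ∀ p ∈ E.cov.inter x y, β x y p ∈ parityPart N 1 := fun x y p hp =>
    odd_mul_even (glG x y p hp).1.1.2.2.1 (inverse_mem_even (glG x y p hp).1.1.2.1)
  have em : ∀ x y, ∀ p ∈ E.cov.inter x y, m x y p ∈ parityPart N 0 := fun x y p hp =>
    mul_mem_even (glG x y p hp).1.1.2.1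
      (sub_mem (one_mem_even N) (smul_mem_parity _ (odd_mul_odd (oα x y p hp) (oβ x y p hp))))
  have um : ∀ x y, ∀ p ∈ E.cov.inter x y, IsUnit (m x y p) := fun x y p hp =>
    (glG x y p hp).1.2.2.mul (isUnit_one_sub _ (oα x y p hp) (oβ x y p hp))
  have eG : ∀ x y, ∀ p ∈ E.cov.inter x y,
      G x y p = gauss (m x y p) (l.tr x y p) (α x y p) (β x y p) := fun x y p hp => by
    have := (glG x y p hp).1.eq_gauss
    rwa [(glG x y p hp).2] at this
  have key : ∀ x y z p, p ∈ E.cov.set x → p ∈ E.cov.set y → p ∈ E.cov.set z →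
      α x z p = α x y p + l.tr y x p * α y z p ∧ β x z p = β x y p + l.tr x y p * β y z p := by
    intro x y z p hx hy hz
    have := cG x y z p hx hy hz
    rw [eG x z p ⟨hx, hz⟩, eG x y p ⟨hx, hy⟩, eG y z p ⟨hy, hz⟩] at this
    have lx := E.le x hx
    have ly := E.le y hy
    have lz := E.le z hz
    exact (gauss_cocycle (um x y p ⟨hx, hy⟩) (em y z p ⟨hy, hz⟩) (um y z p ⟨hy, hz⟩)
      (l.unit x z p ⟨lx, lz⟩) (l.even x y p ⟨lx, ly⟩) (l.even y x p ⟨ly, lx⟩)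
      (l.tr_mul_tr lx ly) (l.cocycle x y z p lx ly lz) (oα x z p ⟨hx, hz⟩) (oβ x z p ⟨hx, hz⟩)
      (oα x y p ⟨hx, hy⟩) (oβ x y p ⟨hx, hy⟩) (oα y z p ⟨hy, hz⟩) (oβ y z p ⟨hy, hz⟩) this).2
  refine ⟨⟨E.cov, E.le, α, hα, oα, fun x y z p hx hy hz => (key x y z p hx hy hz).1⟩,
    ⟨E.cov, E.le, β, hβ, oβ, fun x y z p hx hy hz => (key x y z p hx hy hz).2⟩, m, rfl, rfl, hm,
    fun x y p hp => ⟨em x y p hp, um x y p hp⟩, fun x y p hp => ?_⟩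
  change _ = _ * gauss (m x y p) (l.tr x y p) (α x y p) (β x y p)
  rw [← eG x y p hp, ← mul_assoc, Ring.mul_inverse_cancel _ (uF hp.1), one_mul]

/-- Follows from the cocycle condition of the bundle after cancelling that of `k`. The class `P`
enters only through the cover on which the identity is known. -/
theorem NormalForms.f_cocycle (S : NormalForms l) (P : Pic C N) (A : H1Odd l.inv) (B : H1Odd l)
    {x y z p : C} (hx : p ∈ (S.E P A B).cov.set x) (hy : p ∈ (S.E P A B).cov.set y)
    (hz : p ∈ (S.E P A B).cov.set z) :
    S.f A B x z p = S.f A B x y p * S.f A B y z p * expE ((1 / 2 : ℂ) •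
      ((S.α A).f x y p * (l.tr x y p * (S.β B).f y z p) -
        l.tr y x p * (S.α A).f y z p * (S.β B).f x y p)) := by
  have xy : p ∈ (S.E P A B).cov.inter x y := ⟨hx, hy⟩
  have yz : p ∈ (S.E P A B).cov.inter y z := ⟨hy, hz⟩
  have xz : p ∈ (S.E P A B).cov.inter x z := ⟨hx, hz⟩
  have e := (S.E P A B).cocycle x y z p hx hy hz
  rw [S.g_eq_gauss P A B xy, S.g_eq_gauss P A B yz, S.g_eq_gauss P A B xz] at e
  obtain ⟨e, -⟩ := gauss_cocycle (S.m_unit P A B xy) (S.m_even P A B yz) (S.m_unit P A B yz)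
    (S.tr_unit P A B xz) (S.tr_even P A B xy) (S.tr_even P A B xy.symm) (S.tr_mul_tr P A B xy)
    (l.cocycle x y z p (S.le_l P A B x hx) (S.le_l P A B y hy) (S.le_l P A B z hz))
    (S.odd_α P A B xz) (S.odd_β P A B xz) (S.odd_α P A B xy) (S.odd_β P A B xy) (S.odd_α P A B yz)
    (S.odd_β P A B yz) e
  simp only [NormalForms.m] at e
  refine (S.k_unit P A B xz).mul_left_cancel ?_
  have hk := S.le_k P A B
  rw [e, (S.k P).cocycle x y z p (hk x hx) (hk y hy) (hk z hz)]
  simp only [mul_assoc]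
  rw [← mul_assoc (S.f A B x y p), ← Grassmann.comm_of_even (S.k_even P A B yz) (S.f A B x y p),
    mul_assoc]

end Invariants

/-! ### Reduction of an arbitrary bundle to normal form -/

section Reduction

variable {C : Type*} [TopologicalSpace C] [ChartedSpace ℂ C] {N : ℕ} {l : LineCocycle C N}

theorem HolFun.expE {U : Set C} {Z : C → Grassmann N} (h : HolFun U Z) :
    HolFun U fun p => expE (Z p) := ((HolFun.const U 1).add h).add ((h.mul h).smul (1 / 2))

/-- Every bundle can be brought into normal form. -/
theorem NormalForms.exists_reduction (S : NormalForms l) (E : FramedBundle l) :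
    ∃ P A B, ∃ W : Cover C, W ≤ E.cov ∧ W ≤ (S.E P A B).cov ∧ ∃ r : C → C → Mat N,
      (∀ x, HolFun (W.set x : Set C) (r x)) ∧ (∀ x, ∀ p ∈ W.set x, IsGL11 (r x p)) ∧
      (∀ x y, ∀ p ∈ W.inter x y, r x p * E.g x y p = (S.E P A B).g x y p * r y p) ∧
      ∀ x, ∀ p ∈ W.set x, sdet (r x p) * E.t x p = 1 := by
  have h1 := one_mem_even N
  obtain ⟨α, β, m, hα, hβ, hm, em, eg⟩ := E.exists_invariants
  obtain ⟨W₁, h1α, h1S, u, hu, ou, eu⟩ :=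
    OddCocycle.exists_of_cls_eq (rfl.trans (S.α_cls α.cls).symm)
  obtain ⟨W₂, h2β, h2S, w, hw, ow, ew⟩ :=
    OddCocycle.exists_of_cls_eq (rfl.trans (S.β_cls β.cls).symm)
  set A := α.cls
  set B := β.cls
  -- The class of the bundle in `Pic` is not known yet. Any auxiliary class serves to provide a
  -- cover on which `f A B` is controlled.
  set P₀ : Pic C N := (LineCocycle.trivial C N).cls
  let U := (S.E P₀ A B).cov.inf (W₁.inf W₂)
  have hU₀ : U ≤ (S.E P₀ A B).cov := fun x p hp => hp.1
  have hU₁ : U ≤ W₁ := fun x p hp => hp.2.1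
  have hU₂ : U ≤ W₂ := fun x p hp => hp.2.2
  have hUE : U ≤ E.cov := hα ▸ Cover.le_trans hU₁ h1α
  have hUl : U ≤ l.cov := Cover.le_trans hUE E.le
  let Sα := (S.α A).f
  let Sβ := (S.β B).f
  have oα : ∀ x y, ∀ p ∈ U.inter x y, α.f x y p ∈ parityPart N 1 := fun x y p hp =>
    α.odd x y p (hα ▸ Cover.inter_mono hUE x y hp)
  have oβ : ∀ x y, ∀ p ∈ U.inter x y, β.f x y p ∈ parityPart N 1 := fun x y p hp =>
    β.odd x y p (hβ ▸ Cover.inter_mono hUE x y hp)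
  have oSα : ∀ x y, ∀ p ∈ U.inter x y, Sα x y p ∈ parityPart N 1 := fun x y p hp =>
    S.odd_α P₀ A B (Cover.inter_mono hU₀ x y hp)
  have oSβ : ∀ x y, ∀ p ∈ U.inter x y, Sβ x y p ∈ parityPart N 1 := fun x y p hp =>
    S.odd_β P₀ A B (Cover.inter_mono hU₀ x y hp)
  have ou' : ∀ x, ∀ p ∈ U.set x, u x p ∈ parityPart N 1 := fun x p hp => ou x p (hU₁ x hp)
  have ow' : ∀ x, ∀ p ∈ U.set x, w x p ∈ parityPart N 1 := fun x p hp => ow x p (hU₂ x hp)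
  let Z₁ : C → C → C → Grassmann N := fun x y p =>
    (1 / 2 : ℂ) • (u x p * β.f x y p - α.f x y p * w x p)
  let Z₂ : C → C → C → Grassmann N := fun x y p =>
    (1 / 2 : ℂ) • (Sα x y p * (l.tr x y p * w y p) - l.tr y x p * u y p * Sβ x y p)
  have mZ₁ : ∀ x y, ∀ p ∈ U.inter x y,
      Z₁ x y p ∈ parityPart N 0 ∧ Z₁ x y p * Z₁ x y p * Z₁ x y p = 0 := by
    intro x y p hp
    have := gauss_mul_mem h1 h1 (ou' x p hp.1) (ow' x p hp.1) (oα x y p hp) (oβ x y p hp)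
    simp only [one_mul] at this
    exact this
  have mZ₂ : ∀ x y, ∀ p ∈ U.inter x y,
      Z₂ x y p ∈ parityPart N 0 ∧ Z₂ x y p * Z₂ x y p * Z₂ x y p = 0 := fun x y p hp =>
    have hp' := Cover.inter_mono hUl x y hp
    gauss_mul_mem (l.even x y p hp') (l.even y x p hp'.symm) (oSα x y p hp) (oSβ x y p hp)
      (ou' y p hp.2) (ow' y p hp.2)
  have huU : ∀ x, HolFun (U.set x : Set C) (u x) := fun x => (hu x).mono (hU₁ x)
  have hwU : ∀ x, HolFun (U.set x : Set C) (w x) := fun x => (hw x).mono (hU₂ x)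
  have hαU : ∀ x y, HolFun (U.inter x y) (α.f x y) := fun x y =>
    (α.hol x y).mono (hα ▸ Cover.inter_mono hUE x y)
  have hβU : ∀ x y, HolFun (U.inter x y) (β.f x y) := fun x y =>
    (β.hol x y).mono (hβ ▸ Cover.inter_mono hUE x y)
  have hlU : ∀ x y, HolFun (U.inter x y) (l.tr x y) := fun x y =>
    (l.hol x y).mono (Cover.inter_mono hUl x y)
  have hZ₁ : ∀ x y, HolFun (U.inter x y) (Z₁ x y) := fun x y =>
    ((((huU x).mono fun p hp => hp.1).mul (hβU x y)).sub
      ((hαU x y).mul ((hwU x).mono fun p hp => hp.1))).smul _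
  have hZ₂ : ∀ x y, HolFun (U.inter x y) (Z₂ x y) := fun x y =>
    ((((S.α A).hol x y).mono (Cover.inter_mono (Cover.le_trans hU₁ h1S) x y)).mul
      ((hlU x y).mul ((hwU y).mono fun p hp => hp.2))).sub
      ((((hlU y x).mono fun p hp => ⟨hp.2, hp.1⟩).mul ((huU y).mono fun p hp => hp.2)).mul
        (((S.β B).hol x y).mono (Cover.inter_mono (Cover.le_trans hU₂ h2S) x y))) |>.smul _
  -- The central coordinate after the gauge change by `u` and `w` to the chosen representatives, as
  -- dictated by `SuperHiggs.gauge_iff`.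
  let m₂ : C → C → C → Grassmann N := fun x y p =>
    m x y p * expE (Z₁ x y p) * Ring.inverse (expE (Z₂ x y p))
  have hm₂ : ∀ x y, HolFun (U.inter x y) (m₂ x y) := fun x y =>
    (((hm x y).mono (Cover.inter_mono hUE x y)).mul (hZ₁ x y).expE).mul
      ((hZ₂ x y).expE.ringInverse fun p hp => expE_isUnit (mZ₂ x y p hp).2)
  have em₂ : ∀ x y, ∀ p ∈ U.inter x y, m₂ x y p ∈ parityPart N 0 := fun x y p hp =>
    mul_mem_even (mul_mem_even (em x y p (Cover.inter_mono hUE x y hp)).1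
      (expE_mem (mZ₁ x y p hp).1)) (inverse_mem_even (expE_mem (mZ₂ x y p hp).1))
  have um₂ : ∀ x y, ∀ p ∈ U.inter x y, IsUnit (m₂ x y p) := fun x y p hp =>
    ((em x y p (Cover.inter_mono hUE x y hp)).2.mul (expE_isUnit (mZ₁ x y p hp).2)).mul
      (isUnit_inverse (expE_isUnit (mZ₂ x y p hp).2))
  have uF : ∀ {x p}, p ∈ U.set x → IsUnit (E.normFrame x p) := fun hp =>
    (E.normFrame_isGL11 (hUE _ hp)).isUnit
  let R : C → C → Mat N := fun x p => gauss 1 1 (u x p) (w x p) * Ring.inverse (E.normFrame x p)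
  have uR : ∀ x, ∀ p ∈ U.set x, IsUnit (R x p) := fun x p hp =>
    (isUnit_gauss h1 isUnit_one h1 isUnit_one (ou' x p hp) (ow' x p hp)).mul
      (isUnit_inverse (uF hp))
  have hR : ∀ x y, ∀ p ∈ U.inter x y, R x p * E.g x y p =
      gauss (m₂ x y p) (l.tr x y p) (Sα x y p) (Sβ x y p) * R y p := by
    intro x y p hp
    have hp' := Cover.inter_mono hUl x y hp
    have hpE := Cover.inter_mono hUE x y hp
    have e : gauss 1 1 (u x p) (w x p) * gauss (m x y p) (l.tr x y p) (α.f x y p) (β.f x y p) =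
        gauss (m₂ x y p) (l.tr x y p) (Sα x y p) (Sβ x y p) * gauss 1 1 (u y p) (w y p) := by
      refine (SuperHiggs.gauge_iff (em x y p hpE).1 (um₂ x y p hp) h1 isUnit_one (l.even x y p hp')
        (l.unit x y p hp') (l.even y x p hp'.symm) (l.tr_mul_tr hp'.1 hp'.2) (ou' x p hp.1)
        (ow' x p hp.1) (oα x y p hp) (oβ x y p hp) (oSα x y p hp) (oSβ x y p hp) (ou' y p hp.2)
        (ow' y p hp.2)).2 ⟨?_, ?_, ?_⟩
      · have := eu x y p (Cover.inter_mono hU₁ x y hp)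
        change Sα x y p = _ + (_ - l.tr y x p * _) at this
        rw [this]
        abel
      · have := ew x y p (Cover.inter_mono hU₂ x y hp)
        change Sβ x y p = _ at this
        rw [this]
        abel
      · change _ = m₂ x y p * 1 * expE (Z₂ x y p)
        rw [one_mul, mul_one, mul_assoc _ (Ring.inverse _),
          Ring.inverse_mul_cancel _ (expE_isUnit (mZ₂ x y p hp).2), mul_one]
    have e' : Ring.inverse (E.normFrame x p) * E.g x y p =
        gauss (m x y p) (l.tr x y p) (α.f x y p) (β.f x y p) *
          Ring.inverse (E.normFrame y p) := by
      refine (uF hp.1).mul_left_cancel ((uF hp.2).mul_right_cancel ?_)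
      rw [← mul_assoc, Ring.mul_inverse_cancel _ (uF hp.1), one_mul, eg x y p hpE, ← mul_assoc,
        mul_assoc (_ * _) (Ring.inverse _), Ring.inverse_mul_cancel _ (uF hp.2), mul_one]
    simp only [R]
    rw [mul_assoc, e', ← mul_assoc, e, mul_assoc]
  have cm₂ : ∀ x y z p, p ∈ U.set x → p ∈ U.set y → p ∈ U.set z →
      m₂ x z p = m₂ x y p * m₂ y z p * expE ((1 / 2 : ℂ) • (Sα x y p * (l.tr x y p * Sβ y z p) -
        l.tr y x p * Sα y z p * Sβ x y p)) := by
    intro x y z p hx hy hz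
    have xy : p ∈ U.inter x y := ⟨hx, hy⟩
    have yz : p ∈ U.inter y z := ⟨hy, hz⟩
    have xz : p ∈ U.inter x z := ⟨hx, hz⟩
    have lx := hUl x hx
    have ly := hUl y hy
    have lz := hUl z hz
    refine (gauss_cocycle (um₂ x y p xy) (em₂ y z p yz) (um₂ y z p yz) (l.unit x z p ⟨lx, lz⟩)
      (l.even x y p ⟨lx, ly⟩) (l.even y x p ⟨ly, lx⟩) (l.tr_mul_tr lx ly)
      (l.cocycle x y z p lx ly lz) (oSα x z p xz) (oSβ x z p xz) (oSα x y p xy) (oSβ x y p xy)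
      (oSα y z p yz) (oSβ y z p yz) ((uR z p hz).mul_right_cancel ?_)).1
    rw [← hR x z p xz, mul_assoc (gauss _ _ _ _) (gauss _ _ _ _) (R z p), ← hR y z p yz, ← mul_assoc,
      ← hR x y p xy, mul_assoc (R x p),
      E.cocycle x y z p (hUE x hx) (hUE y hy) (hUE z hz)]
  have ef : ∀ x y, ∀ p ∈ U.inter x y, S.f A B x y p ∈ parityPart N 0 := fun x y p hp =>
    S.f_even P₀ A B (Cover.inter_mono hU₀ x y hp)
  have uf : ∀ x y, ∀ p ∈ U.inter x y, IsUnit (S.f A B x y p) := fun x y p hp =>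
    S.f_unit P₀ A B (Cover.inter_mono hU₀ x y hp)
  -- `m₂` and `f` fail the cocycle condition by the same factor, so their quotient is a
  -- multiplicative cocycle; its class is the sought element of `Pic`.
  let k : LineCocycle C N := {
    cov := U
    tr := fun x y p => m₂ x y p * Ring.inverse (S.f A B x y p)
    hol := fun x y => (hm₂ x y).mul
      (((S.f_hol P₀ A B).mono (Cover.inter_mono hU₀ x y)).ringInverse (uf x y))
    even := fun x y p hp => mul_mem_even (em₂ x y p hp) (inverse_mem_even (ef x y p hp))
    unit := fun x y p hp => (um₂ x y p hp).mul (isUnit_inverse (uf x y p hp))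
    cocycle := fun x y z p hx hy hz => by
      have xy : p ∈ U.inter x y := ⟨hx, hy⟩
      have yz : p ∈ U.inter y z := ⟨hy, hz⟩
      have xz : p ∈ U.inter x z := ⟨hx, hz⟩
      refine (uf x z p xz).mul_right_cancel ?_
      rw [mul_assoc, Ring.inverse_mul_cancel _ (uf x z p xz), mul_one, cm₂ x y z p hx hy hz,
        S.f_cocycle P₀ A B (hU₀ x hx) (hU₀ y hy) (hU₀ z hz)]
      simp only [← mul_assoc]
      congr 1
      simp only [mul_assoc]
      rw [← mul_assoc (Ring.inverse (S.f A B y z p)), ← Grassmann.comm_of_even (ef x y p xy)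
        (Ring.inverse (S.f A B y z p)), mul_assoc (S.f A B x y p),
        Ring.inverse_mul_cancel _ (uf y z p yz), mul_one,
        ← Grassmann.comm_of_even (ef x y p xy) (m₂ y z p), inverse_mul_mul (uf x y p xy)] }
  obtain ⟨W₃, h3U, h3S, q, q', hq, -, eq, hqk⟩ : LineCocycle.Rel k (S.k k.cls) :=
    Quotient.exact (S.k_cls k.cls).symm
  let W := W₃.inf (S.E k.cls A B).cov
  have hWU : W ≤ U := fun x p hp => h3U x hp.1
  have hWE : W ≤ E.cov := Cover.le_trans hWU hUE
  have hWS : W ≤ (S.E k.cls A B).cov := fun x p hp => hp.2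
  have uq : ∀ x, ∀ p ∈ W.set x, IsUnit (q x p) := fun x p hp => by
    obtain ⟨a1, a2, a3⟩ := eq x p hp.1
    exact ⟨⟨_, _, a3, by rw [Grassmann.comm_of_even a2, a3]⟩, rfl⟩
  have glq : ∀ x, ∀ p ∈ W.set x, IsGL11 (gauss (q x p) 1 (u x p) (w x p)) := fun x p hp =>
    gauss_isGL11 (eq x p hp.1).1 (uq x p hp) h1 isUnit_one (ou' x p (hWU x hp))
      (ow' x p (hWU x hp))
  have glF : ∀ x, ∀ p ∈ W.set x, IsGL11 (Ring.inverse (E.normFrame x p)) ∧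
      sdet (Ring.inverse (E.normFrame x p)) * sdet (E.normFrame x p) = 1 := fun x p hp =>
    (E.normFrame_isGL11 (hWE x hp)).ringInverse
  refine ⟨k.cls, A, B, W, hWE, hWS,
    -- The last factor normalizes the Berezinian, `u` and `w` change the odd representatives, and
    -- `q` changes `k` to the chosen representative of its class.
    fun x p => gauss (q x p) 1 (u x p) (w x p) * Ring.inverse (E.normFrame x p), fun x => ?_,
    fun x p hp => ((glq x p hp).mul (glF x p hp).1).1, fun x y p hp => ?_, fun x p hp => ?_⟩
  · exact (HolFun.gauss ((hq x).mono fun p hp => hp.1) (HolFun.const _ 1)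
      ((huU x).mono (hWU x)) ((hwU x).mono (hWU x))).mul'
      (((E.normFrame_hol x).mono (hWE x)).ringInverse fun p hp => uF (hWU x hp))
  · have hpU := Cover.inter_mono hWU x y hp
    have hpS := Cover.inter_mono hWS x y hp
    have er : ∀ x, gauss (q x p) 1 (u x p) (w x p) * Ring.inverse (E.normFrame x p) =
        Matrix.scalar (Fin 2) (q x p) * R x p := by
      intro x
      rw [← mul_assoc, scalar_mul_gauss, mul_one]
    have hS := Matrix.scalar_commute (n := Fin 2) (q y p) (commute_even (eq y p hp.2.1).1)
    beta_reduce
    rw [er, er, mul_assoc, hR x y p hpU,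
      ← mul_assoc (Matrix.scalar (Fin 2) (q x p)) (gauss _ _ _ _) (R y p),
      ← mul_assoc ((S.E k.cls A B).g x y p) _ (R y p), ← (hS _).eq,
      S.g_eq_gauss _ A B hpS, scalar_mul_gauss, scalar_mul_gauss]
    congr 2
    have e := hqk x y p ⟨hp.1.1, hp.2.1⟩
    change _ = q x p * (m₂ x y p * Ring.inverse (S.f A B x y p)) at e
    rw [Grassmann.comm_of_even (eq y p hp.2.1).1]
    change q x p * m₂ x y p = (S.k k.cls).tr x y p * S.f A B x y p * q y p
    rw [mul_assoc ((S.k k.cls).tr x y p), Grassmann.comm_of_even (ef x y p hpU),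
      ← mul_assoc ((S.k k.cls).tr x y p), e,
      mul_assoc (q x p) (_ * _) (S.f A B x y p), mul_assoc (m₂ x y p),
      Ring.inverse_mul_cancel _ (uf x y p hpU), mul_one]
  · beta_reduce
    rw [((glq x p hp).mul (glF x p hp).1).2, sdet_gauss (eq x p hp.1).1 (uq x p hp) h1 isUnit_one
      (ou' x p (hWU x hp)) (ow' x p (hWU x hp)), one_mul, ← E.sdet_normFrame (hWE x hp),
      (glF x p hp).2]

theorem OddSection.eq_zero [h : Subsingleton (OddSection l)] (s : OddSection l) (x p : C) :
    s.s x p = 0 := by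
  let z : OddSection l := ⟨fun _ _ => 0, fun _ => HolFun.const _ 0, fun _ _ _ => zero_mem _,
    fun _ _ _ _ => (mul_zero _).symm, fun _ _ _ => rfl⟩
  rw [h.elim s z]

end Reduction

/-! ### Isomorphism with a normal form, and uniqueness without odd sections -/

section Iso

variable {C : Type*} [TopologicalSpace C] [ChartedSpace ℂ C] [IsManifold 𝓘(ℂ, ℂ) ω C] {N : ℕ}
  {l : LineCocycle C N} {b : EvenForm C N}

theorem Iso.symm {X Y : HiggsBundle l b} (h : Iso X Y) : Iso Y X := by
  obtain ⟨W, hX, hY, r, hr, glr, hg, ht, hφ⟩ := h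
  have ur : ∀ {x p}, p ∈ W.set x → IsUnit (r x p) := fun hp => (glr _ _ hp).isUnit
  have swap : ∀ {x y p} {M M' : Mat N}, p ∈ W.set x → p ∈ W.set y → r x p * M = M' * r y p →
      Ring.inverse (r x p) * M' = M * Ring.inverse (r y p) := by
    intro x y p M M' hx hy e
    refine (ur hy).mul_right_cancel ?_
    rw [mul_assoc, ← e, ← mul_assoc, Ring.inverse_mul_cancel _ (ur hx), one_mul, mul_assoc,
      Ring.inverse_mul_cancel _ (ur hy), mul_one]
  refine ⟨W, hY, hX, fun x p => Ring.inverse (r x p), fun x => (hr x).ringInverse fun p hp => ur hp,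
    fun x p hp => (glr x p hp).ringInverse.1, fun x y p hp => swap hp.1 hp.2 (hg x y p hp),
    fun x p hp => ?_, fun x p hp v => swap hp hp (hφ x p hp v)⟩
  rw [← ht x p hp, ← mul_assoc, (glr x p hp).ringInverse.2, one_mul]

/-- Every Higgs bundle is isomorphic to one in normal form. -/
theorem NormalForms.exists_iso (S : NormalForms l) (X : HiggsBundle l b) :
    ∃ P A B, ∃ φ : HiggsField (S.E P A B) b, ∀ ψ : HiggsField (S.E P A B) b, ψ.form = φ.form →
      Iso ⟨S.E P A B, ψ⟩ X := by
  obtain ⟨P, A, B, W, hX, hW, r, hr, glr, hg, ht⟩ := S.exists_reduction X.bundle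
  have h := (X.higgs.isLocalHiggs hX).conj (g' := (S.E P A B).g) hr glr fun x y p hp =>
    ⟨1, one_mem_even N, isUnit_one, by rw [map_one, one_mul, hg x y p hp]⟩
  obtain ⟨φ, hφ⟩ := h.extend hW
  refine ⟨P, A, B, φ, fun ψ hψ => Iso.symm ⟨W, hX, hW, r, hr, glr, hg, fun x p hp => ?_,
    fun x p hp v => ?_⟩⟩
  · rw [ht x p hp]
    exact (S.t_eq P A B x p (hW x hp)).symm
  · change _ = ψ.form x p v * _
    rw [hψ, hφ x p hp, eq_conj_iff (glr x p hp).isUnit]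
    rfl

/-- If there are no odd sections of `L` and `L⁻¹`, isomorphic Higgs bundles in normal form are
equal. -/
theorem NormalForms.eq_of_iso (S : NormalForms l) {P P' : Pic C N} {A A' : H1Odd l.inv}
    {B B' : H1Odd l} (hlam : Subsingleton (OddSection l.inv)) (hrho : Subsingleton (OddSection l))
    (φ : HiggsField (S.E P A B) b) (φ' : HiggsField (S.E P' A' B') b)
    (h : Iso ⟨S.E P A B, φ⟩ ⟨S.E P' A' B', φ'⟩) :
    P' = P ∧ A' = A ∧ B' = B ∧ φ'.form = φ.form := by
  obtain ⟨hA, hB, lam, rho, ⟨k', hk', hk, -, -, htr⟩, hφ⟩ := (S.iso_iff φ φ').1 h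
  have hP : P' = P := by
    rw [← hk', ← S.k_cls P, eq_comm]
    refine Quotient.sound ⟨k'.cov, hk, fun _ _ h => h, fun _ _ => 1, fun _ _ => 1,
      fun _ => HolFun.const _ _, fun _ => HolFun.const _ _,
      fun _ _ _ => ⟨one_mem_even N, one_mem_even N, mul_one 1⟩, fun x y p hp => ?_⟩
    rw [htr x y p hp, lam.eq_zero, rho.eq_zero]
    simp
  subst hP hA hB
  refine ⟨rfl, rfl, rfl, HiggsField.form_eq fun x p hp v => ?_⟩
  have := hφ x p hp hp v
  rw [lam.eq_zero, rho.eq_zero, gauss_one_zero, one_mul, mul_one] at this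
  exact this.symm

end Iso

end SuperHiggs

/-! ### The classification theorem -/

theorem mainTheorem5 {C : Type*} [TopologicalSpace C] [T2Space C] [CompactSpace C]
    [ConnectedSpace C] [ChartedSpace ℂ C] [IsManifold 𝓘(ℂ, ℂ) ω C] (N : ℕ)
    (l : SuperHiggs.LineCocycle C N) (b : SuperHiggs.EvenForm C N) :
    Nonempty (SuperHiggs.NormalForms l) ∧
    ∀ S : SuperHiggs.NormalForms l,
      ∃ Φ : ∀ d : SuperHiggs.HiggsData l b, SuperHiggs.HiggsField (S.E d.pic d.A d.B) b,
        -- for fixed bundle, the off-diagonal entries of the Higgs field vary by `δ` and `γ`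
        (∀ d d' : SuperHiggs.HiggsData l b, d'.pic = d.pic → d'.A = d.A → d'.B = d.B →
          ∀ x, ∀ p ∈ (S.E d.pic d.A d.B).cov.set x, ∀ v,
            (Φ d').form x p v 0 1 - (Φ d).form x p v 0 1 = d'.δ.s x p v - d.δ.s x p v ∧
            (Φ d').form x p v 1 0 - (Φ d).form x p v 1 0 = d'.γ.s x p v - d.γ.s x p v) ∧
        -- for fixed bundle and off-diagonal entries, the diagonal entries vary by `a`
        (∀ d d' : SuperHiggs.HiggsData l b, d'.pic = d.pic → d'.A = d.A → d'.B = d.B →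
          d'.δ = d.δ → d'.γ = d.γ → ∀ x, ∀ p ∈ (S.E d.pic d.A d.B).cov.set x, ∀ v,
            (Φ d').form x p v 0 0 - (Φ d).form x p v 0 0 = d'.a.form p v - d.a.form p v) ∧
        -- every Higgs field on a bundle in normal form corresponds to exactly one datum
        (∀ P A B, ∀ φ : SuperHiggs.HiggsField (S.E P A B) b,
          ∃! d : SuperHiggs.HiggsData l b,
            d.pic = P ∧ d.A = A ∧ d.B = B ∧ (Φ d).form = φ.form) ∧
        -- every Higgs bundle with Berezinian `L` and supertrace `b` is parametrized by some datum
        (∀ X : SuperHiggs.HiggsBundle l b, ∃ d : SuperHiggs.HiggsData l b,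
          SuperHiggs.Iso ⟨S.E d.pic d.A d.B, Φ d⟩ X) ∧
        -- two data parametrize isomorphic Higgs bundles exactly if they are related by sections
        -- of `L⁻¹ ⊗ Λ₁` and `L ⊗ Λ₁`
        (∀ d d' : SuperHiggs.HiggsData l b,
          SuperHiggs.Iso ⟨S.E d.pic d.A d.B, Φ d⟩ ⟨S.E d'.pic d'.A d'.B, Φ d'⟩ ↔
            d'.A = d.A ∧ d'.B = d.B ∧
            ∃ (lam : SuperHiggs.OddSection l.inv) (rho : SuperHiggs.OddSection l),
              SuperHiggs.PicShift (S.k d.pic) (S.α d.A) (S.β d.B) lam rho d'.pic ∧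
              ∀ x, ∀ p ∈ (S.E d.pic d.A d.B).cov.set x, p ∈ (S.E d'.pic d'.A d'.B).cov.set x →
                ∀ v, SuperHiggs.gauss 1 1 (lam.s x p) (rho.s x p) * (Φ d).form x p v =
                  (Φ d').form x p v * SuperHiggs.gauss 1 1 (lam.s x p) (rho.s x p)) ∧
        -- in particular the parametrization is one to one if there are no such sections
        (Subsingleton (SuperHiggs.OddSection l.inv) → Subsingleton (SuperHiggs.OddSection l) →
          ∀ d d' : SuperHiggs.HiggsData l b,
            SuperHiggs.Iso ⟨S.E d.pic d.A d.B, Φ d⟩ ⟨S.E d'.pic d'.A d'.B, Φ d'⟩ → d = d') := by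
  refine ⟨SuperHiggs.nonempty_normalForms l, fun S => ?_⟩
  obtain ⟨Φ, hoff, hdiag, huniq⟩ := S.exists_parametrization b
  refine ⟨Φ, hoff, hdiag, huniq, fun X => ?_, fun d d' => S.iso_iff (Φ d) (Φ d'),
    fun hlam hrho d d' hiso => ?_⟩
  · obtain ⟨P, A, B, φ, hφ⟩ := S.exists_iso X
    obtain ⟨d, ⟨rfl, rfl, rfl, e⟩, -⟩ := huniq P A B φ
    exact ⟨d, hφ (Φ d) e⟩
  · obtain ⟨hP, hA, hB, e⟩ := S.eq_of_iso hlam hrho (Φ d) (Φ d') hiso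
    -- Both data parametrize the Higgs field `Φ d`, so they agree.
    exact (huniq _ _ _ (Φ d)).unique ⟨rfl, rfl, rfl, rfl⟩ ⟨hP, hA, hB, e⟩
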